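/- Let $d,m\in\mathbb N$, $p>1$, and let $\Omega\subset\mathbb R^d$ be a bounded open set with Lipschitz boundary. For $\varepsilon>0$, an open set $A\subseteq\Omega$, a measurable $a:\mathbb R^d\to[0,+\infty)$ and $u\in L^p(\Omega;\mathbb R^m)$ put $$G_\varepsilon[a](u,A)=\int_{\mathbb R^d}a(\xi)\int_{A_\varepsilon(\xi)}\Bigl|\frac{u(x+\varepsilon\xi)-u(x)}{\varepsilon}\Bigr|^p\,dx\,d\xi,\qquad A_\varepsilon(\xi)=\{x\in A : x+\varepsilon\xi\in A\}.$$ (i) Let $A\subseteq\Omega$ be open with Lipschitz boundary, and let $\{a_\varepsilon\}_{\varepsilon>0}\subset L^1(\mathbb R^d)$ be non-negative functions such that $$\limsup_{\varepsilon\to0}\int_{\mathbb R^d}a_\varepsilon(\xi)\,(|\xi|^p+1)\,d\xi<+\infty$$ and such that for every $\delta>0$ there is $r_\delta>0$ with $$\limsup_{\varepsilon\to0}\int_{\{|\xi|\ge r_\delta\}}a_\varepsilon(\xi)\,|\xi|^p\,d\xi<\delta .$$ Suppose that the measures $a_\varepsilon\,d\xi$ converge weakly* (that is, against continuous functions with compact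 support), as $\varepsilon\to0$, to $a\,d\xi$ for some $a\in L^1(\mathbb R^d)$ that is not almost everywhere zero. Then, with respect to the strong topology of $L^p(\Omega;\mathbb R^m)$, $$\Gamma(L^p)\text{-}\lim_{\varepsilon\to0}G_\varepsilon[a_\varepsilon](u,A)=\begin{cases}\displaystyle\int_{\mathbb R^d}a(\xi)\int_A|Du(x)\xi|^p\,dx\,d\xi&\text{if }u\in W^{1,p}(A;\mathbb R^m),\\[2mm]+\infty&\text{otherwise.}\end{cases}$$ (ii) In particular, let $a:\mathbb R^d\to[0,+\infty)$ be a fixed measurable kernel, not almost everywhere zero, with $\int_{\mathbb R^d}a(\xi)(1+|\xi|^p)\,d\xi<+\infty$, and put $\|M\|_a^p=\int_{\mathbb R^d}a(\xi)|M\xi|^p\,d\xi$ for $M\in\mathbb R^{m\times d}$. Then $$\Gamma(L^p)\text{-}\lim_{\varepsilon\to0}G_\varepsilon[a](u,\Omega)=\begin{cases}\displaystyle\int_\Omega\|Du(x)\|_a^p\,dx&\text{if }u\in W^{1,p}(\Omega;\mathbb R^m),\\[2mm]+\infty&\text{otherwise.}\end{cases}$$ -/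

import Mathlib

open MeasureTheory Filter Topology
open scoped ENNReal ContDiff

/-- An exponent `p > 1` is an admissible exponent for Mathlib's normed space `Lp`. -/
instance factOneLeOfReal {p : ℝ} [hp : Fact (1 < p)] : Fact (1 ≤ ENNReal.ofReal p) :=
  ⟨by simpa using ENNReal.ofReal_le_ofReal hp.out.le⟩

/-! ### Sets with Lipschitz boundary -/

/-- `A` has Lipschitz boundary: near each boundary point, after a rotation, `A` is the part of a
ball that lies strictly above the graph of a Lipschitz function of `d - 1` variables. The unit
vector `ν` is the vertical direction, and `(ℝ ∙ ν)ᗮ` is the hyperplane of the other variables. -/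
def HasLipschitzBoundary {d : ℕ} (A : Set (EuclideanSpace ℝ (Fin d))) : Prop :=
  ∀ x₀ ∈ frontier A, ∃ (ν : EuclideanSpace ℝ (Fin d)) (r : ℝ) (K : NNReal)
    (γ : (Submodule.span ℝ {ν})ᗮ → ℝ),
    ‖ν‖ = 1 ∧ 0 < r ∧ LipschitzWith K γ ∧
      A ∩ Metric.ball x₀ r =
        {x ∈ Metric.ball x₀ r |
          γ ((Submodule.span ℝ {ν})ᗮ.orthogonalProjectionOnto x) < inner ℝ ν x}

/-! ### The Sobolev space `W^{1,p}(A; ℝ^m)` -/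

/-- `D` is the weak (distributional) gradient of `u` on the open set `A`:
`∫_A ∂_v φ u = - ∫_A φ D v` for all test functions `φ ∈ C_c^∞(A)` and all directions `v`. -/
def IsWeakGradient {d m : ℕ} (A : Set (EuclideanSpace ℝ (Fin d)))
    (u : EuclideanSpace ℝ (Fin d) → EuclideanSpace ℝ (Fin m))
    (D : EuclideanSpace ℝ (Fin d) →
      (EuclideanSpace ℝ (Fin d) →L[ℝ] EuclideanSpace ℝ (Fin m))) : Prop :=
  ∀ φ : EuclideanSpace ℝ (Fin d) → ℝ, ContDiff ℝ ∞ φ → HasCompactSupport φ → tsupport φ ⊆ A →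
    ∀ v : EuclideanSpace ℝ (Fin d),
      ∫ x in A, (fderiv ℝ φ x v) • u x = - ∫ x in A, φ x • D x v

/-- `u ∈ W^{1,p}(A; ℝ^m)`: both `u` and a weak gradient of `u` are in `L^p(A)`. -/
def MemW1p {d m : ℕ} (p : ℝ) (A : Set (EuclideanSpace ℝ (Fin d)))
    (u : EuclideanSpace ℝ (Fin d) → EuclideanSpace ℝ (Fin m)) : Prop :=
  MemLp u (ENNReal.ofReal p) (volume.restrict A) ∧
    ∃ D : EuclideanSpace ℝ (Fin d) →
        (EuclideanSpace ℝ (Fin d) →L[ℝ] EuclideanSpace ℝ (Fin m)),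
      MemLp D (ENNReal.ofReal p) (volume.restrict A) ∧ IsWeakGradient A u D

open Classical in
/-- The weak gradient `Du` of `u ∈ W^{1,p}(A; ℝ^m)`, which is unique up to null sets of `A`
(and the value `0` if `u` is not in that space). -/
noncomputable def weakGradient {d m : ℕ} (p : ℝ) (A : Set (EuclideanSpace ℝ (Fin d)))
    (u : EuclideanSpace ℝ (Fin d) → EuclideanSpace ℝ (Fin m)) :
    EuclideanSpace ℝ (Fin d) → (EuclideanSpace ℝ (Fin d) →L[ℝ] EuclideanSpace ℝ (Fin m)) :=
  if h : MemW1p p A u then h.2.choose else 0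

/-! ### Gamma-convergence -/

/-- In the (metrizable) space `X`, the family `F ε` Gamma-converges to `F₀` as `ε → 0`, `ε > 0`:
along every sequence of positive numbers that tends to `0`, the liminf inequality holds and
recovery sequences exist. -/
def GammaConverges {X : Type*} [TopologicalSpace X] (F : ℝ → X → ℝ≥0∞) (F₀ : X → ℝ≥0∞) : Prop :=
  ∀ e : ℕ → ℝ, (∀ j, 0 < e j) → Tendsto e atTop (𝓝 0) → ∀ u : X,
    (∀ v : ℕ → X, Tendsto v atTop (𝓝 u) → F₀ u ≤ liminf (fun j => F (e j) (v j)) atTop) ∧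
    ∃ v : ℕ → X, Tendsto v atTop (𝓝 u) ∧ limsup (fun j => F (e j) (v j)) atTop ≤ F₀ u

/-! ### Convolution functionals and their limits -/

/-- The convolution functional
`G_ε[a](u, A) = ∫_{ℝ^d} a(ξ) ∫_{A_ε(ξ)} |(u(x + ε ξ) - u(x)) / ε|^p dx dξ`
with `A_ε(ξ) = {x ∈ A | x + ε ξ ∈ A}`, for a kernel `a ≥ 0`. -/
noncomputable def convFunctional {d m : ℕ} (p ε : ℝ) (a : EuclideanSpace ℝ (Fin d) → ℝ)
    (A : Set (EuclideanSpace ℝ (Fin d)))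
    (u : EuclideanSpace ℝ (Fin d) → EuclideanSpace ℝ (Fin m)) : ℝ≥0∞ :=
  ∫⁻ ξ, ENNReal.ofReal (a ξ) *
    ∫⁻ x in {x | x ∈ A ∧ x + ε • ξ ∈ A}, ‖ε⁻¹ • (u (x + ε • ξ) - u x)‖ₑ ^ p

/-- The measures `a_ε dξ` converge weakly* to `a dξ` as `ε → 0`, `ε > 0`: their integrals against
continuous functions with compact support converge. -/
def KernelsWeakStarConverge {d : ℕ} (aε : ℝ → EuclideanSpace ℝ (Fin d) → ℝ)
    (a : EuclideanSpace ℝ (Fin d) → ℝ) : Prop :=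
  ∀ φ : EuclideanSpace ℝ (Fin d) → ℝ, Continuous φ → HasCompactSupport φ →
    Tendsto (fun ε => ∫ ξ, φ ξ * aε ε ξ) (𝓝[>] 0) (𝓝 (∫ ξ, φ ξ * a ξ))

open Classical in
/-- The functional `∫_{ℝ^d} a(ξ) ∫_A |Du(x) ξ|^p dx dξ` on `W^{1,p}(A; ℝ^m)`, and `+∞` outside. -/
noncomputable def limitFunctional {d m : ℕ} (p : ℝ) (a : EuclideanSpace ℝ (Fin d) → ℝ)
    (A : Set (EuclideanSpace ℝ (Fin d)))
    (u : EuclideanSpace ℝ (Fin d) → EuclideanSpace ℝ (Fin m)) : ℝ≥0∞ :=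
  if MemW1p p A u then
    ∫⁻ ξ, ENNReal.ofReal (a ξ) * ∫⁻ x in A, ‖weakGradient p A u x ξ‖ₑ ^ p
  else ⊤

/-- `‖M‖_a^p = ∫_{ℝ^d} a(ξ) |M ξ|^p dξ`. -/
noncomputable def kernelNormPow {d m : ℕ} (p : ℝ) (a : EuclideanSpace ℝ (Fin d) → ℝ)
    (M : EuclideanSpace ℝ (Fin d) →L[ℝ] EuclideanSpace ℝ (Fin m)) : ℝ≥0∞ :=
  ∫⁻ ξ, ENNReal.ofReal (a ξ) * ‖M ξ‖ₑ ^ p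

open Classical in
/-- The functional `∫_A ‖Du(x)‖_a^p dx` on `W^{1,p}(A; ℝ^m)`, and `+∞` outside. -/
noncomputable def gradientNormFunctional {d m : ℕ} (p : ℝ) (a : EuclideanSpace ℝ (Fin d) → ℝ)
    (A : Set (EuclideanSpace ℝ (Fin d)))
    (u : EuclideanSpace ℝ (Fin d) → EuclideanSpace ℝ (Fin m)) : ℝ≥0∞ :=
  if MemW1p p A u then ∫⁻ x in A, kernelNormPow p a (weakGradient p A u x) else ⊤

/-!
Along a sequence of scales `e j → 0`, only three properties of the kernels `b j = a_(e j)` matter: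
bounded `p`-th moments, uniformly small `p`-th moments at infinity, and weak* convergence to `a`.
They are collected in `KernelSequence`, which a fixed kernel satisfies as well
(`kernelSequence_const`), so both parts follow from `KernelSequence.gamma_convergence`; in the
second part the limit functional is rewritten with Tonelli's theorem.

*Liminf inequality and compactness.* Let `v j → u` in `L^1(A)`. By Jensen's inequality and
translation invariance, mollifying `v j` does not increase the functional, apart from a loss of
domain near the boundary of `A` (`lintegral_mollify_translate_sub_le`). For a fixed mollifier the
difference quotients of the mollified functions converge uniformly to the derivative of the
mollified `u`, and `ξ ↦ ∫_K |Dw(x) ξ|^p dx` is continuous, so weak* convergence of the kernels gives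
the liminf inequality for mollifications (`KernelSequence.lintegral_fderiv_mollify_le_liminf`).
If the liminf is finite, this bounds the directional energies of the mollified gradients. A kernel
`a` that is not almost everywhere zero is not carried by a proper subspace, so these energies
control `|Dw|^p` (`exists_mul_enorm_rpow_le_lintegral`), and the mollified gradients are bounded in
`L^p`. Weak compactness for `p > 1` yields a weak gradient
(`exists_hasWeakGradient_of_lintegral_le`), the mollified gradients converge to it almost
everywhere, and Fatou's lemma removes the mollification
(`KernelSequence.limitFunctional_le_liminf`).

*Recovery sequences.* For a `C^1` function `w` with compact support, the limsup inequality follows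
from uniform convergence of the difference quotients for bounded `ξ` and from the Lipschitz bound
together with the smallness of the moments for large `ξ` (`KernelSequence.limsup_le_of_contDiff`).
Such functions are dense in `W^{1,p}(A)` when `A` has Lipschitz boundary: locally, `A` is pushed
into itself by small translations (`HasInwardShifts`), so the pieces given by a partition of unity
can be mollified with kernels supported around the translation vector, and no extension operator
is needed (`exists_contDiff_lintegral_sub_le`). The functional on `A` ignores the values on `Ω \ A`,
where the approximating function is left equal to `u`, and a diagonal argument concludes
(`exists_recovery_sequence`).
-/

set_option linter.unusedSectionVars false

/-! ### Convexity inequalities and mollification -/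

/-- By convexity, the factor of `s ^ p` can be any number larger than `1`. -/
lemma exists_add_rpow_le {p : ℝ} (hp : 1 ≤ p) {l : ℝ≥0∞} (hl : 1 < l) :
    ∃ C : ℝ≥0∞, C ≠ ⊤ ∧ ∀ s t : ℝ≥0∞, (s + t) ^ p ≤ l * s ^ p + C * t ^ p := by
  have hp0 : 0 ≤ p := zero_le_one.trans hp
  -- a convex weight `w < 1` so close to `1` that `w * w⁻¹ ^ p ≤ l`
  obtain ⟨w, hw, hw0, hw1⟩ : ∃ w : ℝ,
      ENNReal.ofReal (w * w⁻¹ ^ p) < l ∧ 0 < w ∧ w < 1 := by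
    have hc : ContinuousAt (fun w : ℝ => ENNReal.ofReal (w * w⁻¹ ^ p)) 1 := by
      refine ENNReal.continuous_ofReal.continuousAt.comp (continuousAt_id.mul ?_)
      exact (continuousAt_inv₀ one_ne_zero).rpow_const (Or.inr hp0)
    have h1 : ∀ᶠ w in 𝓝[<] (1 : ℝ), ENNReal.ofReal (w * w⁻¹ ^ p) < l :=
      (hc.eventually_lt continuousAt_const (by simpa using hl)).filter_mono nhdsWithin_le_nhds
    have h2 : ∀ᶠ w in 𝓝[<] (1 : ℝ), 0 < w ∧ w < 1 := Ioo_mem_nhdsLT zero_lt_one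
    obtain ⟨w, h⟩ := (h1.and h2).exists
    exact ⟨w, h⟩
  have hv0 : 0 < 1 - w := by linarith
  refine ⟨ENNReal.ofReal ((1 - w) * (1 - w)⁻¹ ^ p), ENNReal.ofReal_ne_top, fun s t => ?_⟩
  have key : ∀ {r : ℝ} (z : ℝ≥0∞), 0 < r →
      ENNReal.ofReal r * (ENNReal.ofReal r⁻¹ * z) = z := by
    intro r z hr
    rw [← mul_assoc, ← ENNReal.ofReal_mul hr.le, mul_inv_cancel₀ hr.ne', ENNReal.ofReal_one,
      one_mul]
  have key2 : ∀ {r : ℝ} (z : ℝ≥0∞), 0 < r → ENNReal.ofReal r * (ENNReal.ofReal r⁻¹ * z) ^ p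
      = ENNReal.ofReal (r * r⁻¹ ^ p) * z ^ p := by
    intro r z hr
    rw [ENNReal.mul_rpow_of_nonneg _ _ hp0, ← mul_assoc, ENNReal.ofReal_mul hr.le,
      ENNReal.ofReal_rpow_of_nonneg (by positivity) hp0]
  have h := ENNReal.rpow_arith_mean_le_arith_mean2_rpow (ENNReal.ofReal w)
    (ENNReal.ofReal (1 - w)) (ENNReal.ofReal w⁻¹ * s) (ENNReal.ofReal (1 - w)⁻¹ * t)
    (by rw [← ENNReal.ofReal_add hw0.le hv0.le]; simp) hp
  rw [key _ hw0, key _ hv0, key2 _ hw0, key2 _ hv0] at h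
  exact h.trans (by gcongr)

/-- Jensen's inequality for `t ↦ t ^ p` and a probability measure. -/
lemma lintegral_rpow_le_of_isProbabilityMeasure {α : Type*} [MeasurableSpace α] {μ : Measure α}
    [IsProbabilityMeasure μ] {p : ℝ} (hp : 1 ≤ p) {f : α → ℝ≥0∞} (hf : AEMeasurable f μ) :
    (∫⁻ x, f x ∂μ) ^ p ≤ ∫⁻ x, f x ^ p ∂μ := by
  have hp0 : 0 < p := zero_lt_one.trans_le hp
  have h := eLpNorm'_le_eLpNorm'_of_exponent_le zero_lt_one hp μ hf.aestronglyMeasurable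
  simp only [eLpNorm', enorm_eq_self, ENNReal.rpow_one, div_one] at h
  calc (∫⁻ x, f x ∂μ) ^ p ≤ ((∫⁻ x, f x ^ p ∂μ) ^ (1 / p)) ^ p := by gcongr
    _ = _ := by rw [← ENNReal.rpow_mul, one_div_mul_cancel hp0.ne', ENNReal.rpow_one]

section Mollifier

variable {E F : Type*} [NormedAddCommGroup E] [NormedSpace ℝ E] [FiniteDimensional ℝ E]
  [MeasureSpace E] [BorelSpace E] [(volume : Measure E).IsAddHaarMeasure]
  [NormedAddCommGroup F] [NormedSpace ℝ F] [CompleteSpace F]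

/-- A smooth, compactly supported probability density. Its support need not be centred at `0`. -/
structure IsMollifier (ρ : E → ℝ) : Prop where
  contDiff : ContDiff ℝ ∞ ρ
  hasCompactSupport : HasCompactSupport ρ
  nonneg : ∀ x, 0 ≤ ρ x
  integral_eq_one : ∫ x, ρ x = 1

/-- The convolution `x ↦ ∫ ρ(t) f(x - t) dt`. -/
noncomputable def mollify (ρ : E → ℝ) (f : E → F) : E → F :=
  convolution ρ f (ContinuousLinearMap.lsmul ℝ ℝ) volume

lemma mollify_apply (ρ : E → ℝ) (f : E → F) (x : E) : mollify ρ f x = ∫ t, ρ t • f (x - t) := by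
  simp [mollify, convolution]

lemma mollify_apply_swap (ρ : E → ℝ) (f : E → F) (x : E) :
    mollify ρ f x = ∫ t, ρ (x - t) • f t := by
  simp [mollify, convolution_eq_swap]

namespace IsMollifier

variable {ρ : E → ℝ} (hρ : IsMollifier ρ)
include hρ

lemma integrable_smul {f : E → F} (hf : LocallyIntegrable f) (x : E) :
    Integrable fun t => ρ t • f (x - t) := by
  simpa using (hρ.hasCompactSupport.convolutionExists_left (ContinuousLinearMap.lsmul ℝ ℝ)
    hρ.contDiff.continuous hf x).integrable

lemma integrable_smul_swap {f : E → F} (hf : LocallyIntegrable f) (x : E) :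
    Integrable fun t => ρ (x - t) • f t := by
  simpa using (hρ.hasCompactSupport.convolutionExists_left (ContinuousLinearMap.lsmul ℝ ℝ)
    hρ.contDiff.continuous hf x).integrable_swap

lemma integrable : Integrable ρ := hρ.contDiff.continuous.integrable_of_hasCompactSupport
  hρ.hasCompactSupport

lemma isProbabilityMeasure :
    IsProbabilityMeasure (volume.withDensity fun x => ENNReal.ofReal (ρ x)) := by
  constructor
  rw [withDensity_apply _ MeasurableSet.univ, Measure.restrict_univ,
    ← ofReal_integral_eq_lintegral_ofReal hρ.integrable (.of_forall hρ.nonneg),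
    hρ.integral_eq_one, ENNReal.ofReal_one]

lemma measurable_ofReal : Measurable fun x => ENNReal.ofReal (ρ x) :=
  hρ.contDiff.continuous.measurable.ennreal_ofReal

/-- Jensen's inequality for averages with respect to a mollifier. -/
lemma enorm_integral_rpow_le {p : ℝ} (hp : 1 ≤ p) {f : E → F} (hf : AEStronglyMeasurable f) :
    ‖∫ t, ρ t • f t‖ₑ ^ p ≤ ∫⁻ t, ENNReal.ofReal (ρ t) * ‖f t‖ₑ ^ p := by
  have hac : volume.withDensity (fun x => ENNReal.ofReal (ρ x)) ≪ (volume : Measure E) :=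
    withDensity_absolutelyContinuous _ _
  have := hρ.isProbabilityMeasure
  calc ‖∫ t, ρ t • f t‖ₑ ^ p ≤ (∫⁻ t, ENNReal.ofReal (ρ t) * ‖f t‖ₑ) ^ p := by
        gcongr
        refine (enorm_integral_le_lintegral_enorm _).trans_eq ?_
        simp [enorm_smul, Real.enorm_of_nonneg (hρ.nonneg _)]
    _ = (∫⁻ t, ‖f t‖ₑ ∂(volume.withDensity fun x => ENNReal.ofReal (ρ x))) ^ p := by
        rw [lintegral_withDensity_eq_lintegral_mul₀ hρ.measurable_ofReal.aemeasurable hf.enorm]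
        rfl
    _ ≤ ∫⁻ t, ‖f t‖ₑ ^ p ∂(volume.withDensity fun x => ENNReal.ofReal (ρ x)) :=
        lintegral_rpow_le_of_isProbabilityMeasure hp (hf.enorm.mono_ac hac)
    _ = _ := by
        rw [lintegral_withDensity_eq_lintegral_mul₀ hρ.measurable_ofReal.aemeasurable
          (hf.enorm.pow_const p)]
        rfl

lemma lintegral_ofReal : ∫⁻ x, ENNReal.ofReal (ρ x) = 1 := by
  rw [← ofReal_integral_eq_lintegral_ofReal hρ.integrable (.of_forall hρ.nonneg),
    hρ.integral_eq_one, ENNReal.ofReal_one]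

lemma mollify_sub {f g : E → F} (hf : LocallyIntegrable f) (hg : LocallyIntegrable g) :
    mollify ρ (f - g) = mollify ρ f - mollify ρ g := by
  ext x
  simp only [mollify_apply, Pi.sub_apply, smul_sub]
  rw [integral_sub (hρ.integrable_smul hf x) (hρ.integrable_smul hg x)]

/-- The `L^p` distance of `f` from its mollification is at most the average of the `L^p` distances
of `f` from its translates. -/
lemma lintegral_mollify_sub_le {p : ℝ} (hp : 1 ≤ p) {f : E → F} (hf : LocallyIntegrable f) :
    ∫⁻ x, ‖mollify ρ f x - f x‖ₑ ^ p ≤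
      ∫⁻ t, ENNReal.ofReal (ρ t) * ∫⁻ x, ‖f (x - t) - f x‖ₑ ^ p := by
  have hm : AEStronglyMeasurable (fun z : E × E => f (z.1 - z.2) - f z.1)
      (volume.prod volume) :=
    (hf.aestronglyMeasurable.comp_quasiMeasurePreserving
      (quasiMeasurePreserving_sub_of_right_invariant volume volume)).sub
      hf.aestronglyMeasurable.comp_fst
  calc ∫⁻ x, ‖mollify ρ f x - f x‖ₑ ^ p
      ≤ ∫⁻ x, ∫⁻ t, ENNReal.ofReal (ρ t) * ‖f (x - t) - f x‖ₑ ^ p := by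
        refine lintegral_mono fun x => ?_
        have h1 : mollify ρ f x - f x = ∫ t, ρ t • (f (x - t) - f x) := by
          simp only [smul_sub]
          rw [integral_sub (hρ.integrable_smul hf x) (hρ.integrable.smul_const _),
            integral_smul_const, hρ.integral_eq_one, one_smul, mollify_apply]
        rw [h1]
        refine hρ.enorm_integral_rpow_le hp ?_
        refine AEStronglyMeasurable.sub ?_ aestronglyMeasurable_const
        exact hf.aestronglyMeasurable.comp_quasiMeasurePreserving
          (quasiMeasurePreserving_sub_left_of_right_invariant volume x)
    _ = ∫⁻ t, ∫⁻ x, ENNReal.ofReal (ρ t) * ‖f (x - t) - f x‖ₑ ^ p := by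
        rw [lintegral_lintegral_swap]
        exact (hρ.measurable_ofReal.comp measurable_snd).aemeasurable.mul
          (hm.enorm.pow_const p)
    _ = _ := by
        refine lintegral_congr fun t => ?_
        rw [lintegral_const_mul' _ _ ENNReal.ofReal_ne_top]

end IsMollifier

/-- Translations are continuous in `L^p`. -/
lemma tendsto_lintegral_translate_sub {p : ℝ} (hp : 1 ≤ p) {f : E → F}
    (hf : MemLp f (ENNReal.ofReal p) volume) :
    Tendsto (fun y => ∫⁻ x, ‖f (x + y) - f x‖ₑ ^ p) (𝓝 0) (𝓝 0) := by
  have hp0 : 0 < p := zero_lt_one.trans_le hp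
  have : Fact (1 ≤ ENNReal.ofReal p) := ⟨by simpa using ENNReal.ofReal_le_ofReal hp⟩
  have hmp : ∀ y : E, MeasurePreserving (fun x : E => x + y) volume volume :=
    fun y => measurePreserving_add_right volume y
  let g : E → C(E, E) := fun y => ⟨fun x => x + y, by fun_prop⟩
  have hg : Continuous g := by
    refine ContinuousMap.continuous_of_continuous_uncurry _ ?_
    simp only [g, Function.uncurry_def, ContinuousMap.coe_mk]
    fun_prop
  have h1 := ((continuous_const (y := hf.toLp f)).compMeasurePreservingLp hg hmp
    ENNReal.ofReal_ne_top).tendsto 0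
  have h0 : Lp.compMeasurePreserving (g 0) (hmp 0) (hf.toLp f) = hf.toLp f := by
    rw [Lp.toLp_compMeasurePreserving]
    congr 1
    simp [g, Function.comp_def]
  rw [h0, tendsto_iff_edist_tendsto_0] at h1
  have h2 : ∀ y, ∫⁻ x, ‖f (x + y) - f x‖ₑ ^ p =
      (edist (Lp.compMeasurePreserving (g y) (hmp y) (hf.toLp f)) (hf.toLp f)) ^ p := by
    intro y
    rw [Lp.toLp_compMeasurePreserving, Lp.edist_toLp_toLp,
      eLpNorm_eq_lintegral_rpow_enorm_toReal (by simpa using hp0) ENNReal.ofReal_ne_top,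
      ENNReal.toReal_ofReal hp0.le, ← ENNReal.rpow_mul, one_div_mul_cancel hp0.ne',
      ENNReal.rpow_one]
    rfl
  simp_rw [h2]
  have := (ENNReal.continuous_rpow_const (y := p)).tendsto 0 |>.comp h1
  simpa [hp0, Function.comp_def] using this

/-- Mollification with a mollifier supported near `0` changes a function of `L^p` only a little. -/
lemma exists_lintegral_mollify_sub_le {p : ℝ} (hp : 1 ≤ p) {f : E → F}
    (hf : MemLp f (ENNReal.ofReal p) volume) {δ : ℝ≥0∞} (hδ : 0 < δ) :
    ∃ η : ℝ, 0 < η ∧ ∀ ρ : E → ℝ, IsMollifier ρ → Function.support ρ ⊆ Metric.closedBall 0 η →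
      ∫⁻ x, ‖mollify ρ f x - f x‖ₑ ^ p ≤ δ := by
  have h := (tendsto_lintegral_translate_sub hp hf).eventually_le_const hδ
  obtain ⟨η, hη, hb⟩ := Metric.eventually_nhds_iff_ball.1 h
  refine ⟨η / 2, half_pos hη, fun ρ hρ hs => ?_⟩
  have hloc : LocallyIntegrable f :=
    hf.locallyIntegrable (by simpa using ENNReal.ofReal_le_ofReal hp)
  calc ∫⁻ x, ‖mollify ρ f x - f x‖ₑ ^ p
      ≤ ∫⁻ t, ENNReal.ofReal (ρ t) * ∫⁻ x, ‖f (x - t) - f x‖ₑ ^ p :=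
        hρ.lintegral_mollify_sub_le hp hloc
    _ ≤ ∫⁻ t, ENNReal.ofReal (ρ t) * δ := by
        refine lintegral_mono fun t => ?_
        by_cases ht : ρ t = 0
        · simp [ht]
        · have h3 := hs ht
          simp only [Metric.mem_closedBall, dist_zero_right] at h3
          gcongr
          simpa [sub_eq_add_neg] using hb (-t) (by simp; linarith)
    _ = δ := by
        rw [lintegral_mul_const _ hρ.measurable_ofReal, hρ.lintegral_ofReal, one_mul]

end Mollifier

/-! ### Derivatives of mollifications -/

/-- The sum of locally integrable functions with values in a normed group; the general version
makes the elaborator unfold the instances of spaces of linear maps. -/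
lemma MeasureTheory.LocallyIntegrable.add_normed {X G : Type*} [MeasurableSpace X]
    [TopologicalSpace X] [NormedAddCommGroup G] {μ : Measure X} {f g : X → G}
    (hf : LocallyIntegrable f μ) (hg : LocallyIntegrable g μ) : LocallyIntegrable (f + g) μ :=
  hf.add hg

/-- The extension by zero of an integrable function is locally integrable. -/
lemma MeasureTheory.IntegrableOn.locallyIntegrable_indicator {X G : Type*} [MeasurableSpace X]
    [TopologicalSpace X] [NormedAddCommGroup G] {μ : Measure X} {f : X → G} {A : Set X}
    (hf : IntegrableOn f A μ) (hA : MeasurableSet A) : LocallyIntegrable (A.indicator f) μ :=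
  (hf.integrable_indicator hA).locallyIntegrable

section MollifierDerivative

variable {E F : Type*} [NormedAddCommGroup E] [NormedSpace ℝ E] [FiniteDimensional ℝ E]
  [MeasureSpace E] [BorelSpace E] [(volume : Measure E).IsAddHaarMeasure]
  [NormedAddCommGroup F] [NormedSpace ℝ F] [CompleteSpace F]

namespace IsMollifier

variable {ρ : E → ℝ} (hρ : IsMollifier ρ)
include hρ

lemma contDiff_mollify {f : E → F} (hf : LocallyIntegrable f) : ContDiff ℝ ∞ (mollify ρ f) :=
  hρ.hasCompactSupport.contDiff_convolution_left (n := ⊤) _ hρ.contDiff hf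

lemma hasCompactSupport_mollify {f : E → F} (hf : HasCompactSupport f) :
    HasCompactSupport (mollify ρ f) :=
  hρ.hasCompactSupport.convolution _ hf

lemma fderiv_mollify_apply {f : E → F} (hf : LocallyIntegrable f) (x v : E) :
    fderiv ℝ (mollify ρ f) x v = ∫ y, fderiv ℝ ρ (x - y) v • f y := by
  have h := hρ.hasCompactSupport.hasFDerivAt_convolution_left (ContinuousLinearMap.lsmul ℝ ℝ)
    (hρ.contDiff.of_le (by exact_mod_cast le_top)) hf x
  have hint : ConvolutionExistsAt (fderiv ℝ ρ) f x
      ((ContinuousLinearMap.lsmul ℝ ℝ).precompL E) volume :=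
    (hρ.hasCompactSupport.fderiv ℝ).convolutionExists_left _
      (hρ.contDiff.continuous_fderiv (by simp)) hf x
  unfold mollify
  rw [h.fderiv, convolution_eq_swap, ContinuousLinearMap.integral_apply hint.integrable_swap]
  simp

lemma mollify_clm_apply {G : E → E →L[ℝ] F} (hG : LocallyIntegrable G) (x v : E) :
    mollify ρ G x v = ∫ y, ρ (x - y) • G y v := by
  rw [mollify_apply_swap, ContinuousLinearMap.integral_apply (hρ.integrable_smul_swap hG x)]
  simp

end IsMollifier

/-- Mollification commutes with the weak gradient at the points `x` for which `x - tsupport ρ` meets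
the support of the cutoff `φ` only inside `A`. -/
lemma IsMollifier.fderiv_mollify_of_integral_fderiv_smul {ρ : E → ℝ} (hρ : IsMollifier ρ)
    {A : Set E} (hA : MeasurableSet A) {u : E → F} {D : E → E →L[ℝ] F}
    (hD : ∀ ψ : E → ℝ, ContDiff ℝ ∞ ψ → HasCompactSupport ψ → tsupport ψ ⊆ A →
      ∀ v : E, ∫ y in A, (fderiv ℝ ψ y v) • u y = - ∫ y in A, ψ y • D y v)
    {φ : E → ℝ} (hφ : ContDiff ℝ ∞ φ)
    (hu₁ : LocallyIntegrable (A.indicator fun y => φ y • u y))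
    (hD₁ : LocallyIntegrable (A.indicator fun y => φ y • D y))
    (hu₂ : LocallyIntegrable (A.indicator fun y => (fderiv ℝ φ y).smulRight (u y)))
    {x : E} (hx : ∀ y ∈ tsupport φ, x - y ∈ tsupport ρ → y ∈ A) :
    fderiv ℝ (mollify ρ (A.indicator fun y => φ y • u y)) x =
      mollify ρ (A.indicator fun y => φ y • D y + (fderiv ℝ φ y).smulRight (u y)) x := by
  set r : E → ℝ := fun y => ρ (x - y) with hr
  have hrs : ContDiff ℝ ∞ r := hρ.contDiff.comp (contDiff_const.sub contDiff_id)
  have hrc : HasCompactSupport r := by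
    simpa [hr, Function.comp_def] using
      hρ.hasCompactSupport.comp_homeomorph (Homeomorph.subLeft x)
  have hrf : ∀ y v, fderiv ℝ r y v = - fderiv ℝ ρ (x - y) v := by
    intro y v
    have h1 : HasFDerivAt r ((fderiv ℝ ρ (x - y)).comp
        (-ContinuousLinearMap.id ℝ (E))) y :=
      ((hρ.contDiff.differentiable (by simp)) (x - y)).hasFDerivAt.comp y
        ((hasFDerivAt_id y).const_sub x)
    rw [h1.fderiv]
    simp
  ext1 v
  have hψ : ContDiff ℝ ∞ (fun y => r y * φ y) := hrs.mul hφ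
  have hψc : HasCompactSupport (fun y => r y * φ y) := hrc.mul_right
  have hψA : tsupport (fun y => r y * φ y) ⊆ A := by
    intro y hy
    refine hx y (tsupport_mul_subset_right hy) ?_
    have h1 : tsupport r ⊆ (fun y => x - y) ⁻¹' tsupport ρ :=
      closure_minimal (fun z hz => subset_tsupport _ hz)
        ((isClosed_tsupport ρ).preimage (by fun_prop))
    exact h1 (tsupport_mul_subset_left hy)
  have key := hD _ hψ hψc hψA v
  have hder : ∀ y, fderiv ℝ (fun y => r y * φ y) y v =
      r y * fderiv ℝ φ y v - fderiv ℝ ρ (x - y) v * φ y := by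
    intro y
    rw [fderiv_fun_mul (hrs.differentiable (by simp) y) (hφ.differentiable (by simp) y)]
    simp [hrf]
    ring
  set U : E → F := A.indicator fun y => φ y • u y with hU
  set G₁ : E → E →L[ℝ] F := A.indicator fun y => φ y • D y with hG₁
  set G₂ : E → E →L[ℝ] F := A.indicator fun y => (fderiv ℝ φ y).smulRight (u y) with hG₂
  have e0 : (A.indicator fun y => φ y • D y + (fderiv ℝ φ y).smulRight (u y)) = G₁ + G₂ :=
    Set.indicator_add _ _ _
  -- integrability of the three terms of the product rule
  have i1 : Integrable (fun y => fderiv ℝ ρ (x - y) v • U y) := by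
    refine hu₁.integrable_smul_left_of_hasCompactSupport ?_ ?_
    · exact ((hρ.contDiff.continuous_fderiv (by simp)).comp
        (continuous_const.sub continuous_id)).clm_apply continuous_const
    · have h2 : HasCompactSupport (fun y => fderiv ℝ r y v) := hrc.fderiv_apply ℝ v
      simpa [hrf, HasCompactSupport, tsupport] using h2
  have i2 : Integrable (fun y => r y • G₂ y v) :=
    (ContinuousLinearMap.apply ℝ F v).integrable_comp
      (hu₂.integrable_smul_left_of_hasCompactSupport hrs.continuous hrc)
  have i3 : Integrable (fun y => r y • G₁ y v) :=
    (ContinuousLinearMap.apply ℝ F v).integrable_comp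
      (hD₁.integrable_smul_left_of_hasCompactSupport hrs.continuous hrc)
  have e1 : ∫ y in A, fderiv ℝ (fun y => r y * φ y) y v • u y =
      (∫ y, r y • G₂ y v) - ∫ y, fderiv ℝ ρ (x - y) v • U y := by
    rw [← integral_sub i2 i1, ← integral_indicator hA]
    congr 1 with y
    by_cases hy : y ∈ A <;> simp [hU, hG₂, hy, hder, sub_smul, mul_smul]
  have e2 : ∫ y in A, (r y * φ y) • D y v = ∫ y, r y • G₁ y v := by
    rw [← integral_indicator hA]
    congr 1 with y
    by_cases hy : y ∈ A <;> simp [hG₁, hy, mul_smul]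
  have e3 : mollify ρ (G₁ + G₂) x v = (∫ y, r y • G₁ y v) + ∫ y, r y • G₂ y v := by
    rw [hρ.mollify_clm_apply (hD₁.add_normed hu₂), ← integral_add i3 i2]
    simp [hr, smul_add]
  rw [e0, e3, hρ.fderiv_mollify_apply hu₁]
  rw [e1, e2] at key
  rw [sub_eq_iff_eq_add.1 key]
  abel

end MollifierDerivative

/-! ### Kernels -/

section Kernel

variable {E F : Type*} [NormedAddCommGroup E] [NormedSpace ℝ E] [FiniteDimensional ℝ E]
  [MeasureSpace E] [BorelSpace E] [(volume : Measure E).IsAddHaarMeasure]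
  [NormedAddCommGroup F] [NormedSpace ℝ F] [FiniteDimensional ℝ F]

/-- The continuous cutoff that equals `1` on the ball of radius `r` and `0` off the ball of radius
`r + 1`, and is affine in the norm between them. -/
noncomputable def ballCutoff (r : ℝ) (ξ : E) : ℝ := max 0 (min 1 (r + 1 - ‖ξ‖))

lemma continuous_ballCutoff (r : ℝ) : Continuous (ballCutoff r : E → ℝ) := by
  unfold ballCutoff; fun_prop

lemma ballCutoff_nonneg (r : ℝ) (ξ : E) : 0 ≤ ballCutoff r ξ := le_max_left _ _

lemma ballCutoff_le_one (r : ℝ) (ξ : E) : ballCutoff r ξ ≤ 1 := by simp [ballCutoff]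

lemma ballCutoff_eq_one {r : ℝ} {ξ : E} (h : ‖ξ‖ ≤ r) : ballCutoff r ξ = 1 := by
  rw [ballCutoff, min_eq_left (by linarith), max_eq_right zero_le_one]

lemma ballCutoff_eq_zero {r : ℝ} {ξ : E} (h : r + 1 ≤ ‖ξ‖) : ballCutoff r ξ = 0 := by
  rw [ballCutoff, max_eq_left]
  exact (min_le_right _ _).trans (by linarith)

lemma hasCompactSupport_ballCutoff (r : ℝ) : HasCompactSupport (ballCutoff r : E → ℝ) := by
  have := FiniteDimensional.proper ℝ E
  refine HasCompactSupport.of_support_subset_isCompact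
    (isCompact_closedBall (0 : E) (r + 1)) fun ξ hξ => ?_
  by_contra h
  simp only [Metric.mem_closedBall, dist_zero_right, not_le] at h
  exact hξ (ballCutoff_eq_zero h.le)

/-- A sequence `b j` of nonnegative integrable kernels that converges weakly* to `a`, with `p`-th
moments that are bounded and uniformly small at infinity. -/
structure KernelSequence (p : ℝ) (b : ℕ → E → ℝ) (a : E → ℝ) : Prop where
  integrable : ∀ j, Integrable (b j)
  nonneg : ∀ j ξ, 0 ≤ b j ξ
  bounded : ∃ M : ℝ≥0∞, M ≠ ⊤ ∧ ∀ᶠ j in atTop, ∫⁻ ξ, ENNReal.ofReal (b j ξ * (‖ξ‖ ^ p + 1)) ≤ M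
  tail : ∀ δ : ℝ, 0 < δ → ∃ r : ℝ, 0 < r ∧ ∀ᶠ j in atTop,
    ∫⁻ ξ in (Metric.ball 0 r)ᶜ, ENNReal.ofReal (b j ξ * ‖ξ‖ ^ p) ≤ ENNReal.ofReal δ
  integrable_limit : Integrable a
  tendsto : ∀ φ : E → ℝ, Continuous φ → HasCompactSupport φ →
    Tendsto (fun j => ∫ ξ, φ ξ * b j ξ) atTop (𝓝 (∫ ξ, φ ξ * a ξ))

/-- The standard sequence of bump functions at the origin, supported in balls of radius
`1 / (n + 1)`. -/
noncomputable def stdBump (n : ℕ) : ContDiffBump (0 : E) where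
  rIn := 1 / (2 * (n + 1))
  rOut := 1 / (n + 1)
  rIn_pos := by positivity
  rIn_lt_rOut := by
    apply one_div_lt_one_div_of_lt
    · positivity
    · have : (0 : ℝ) ≤ n := n.cast_nonneg
      linarith

/-- The mollifiers given by the standard bump functions. -/
noncomputable def stdMollifier (n : ℕ) : E → ℝ := (stdBump n : ContDiffBump (0 : E)).normed volume

lemma isMollifier_stdMollifier (n : ℕ) : IsMollifier (stdMollifier n : E → ℝ) where
  contDiff := ContDiffBump.contDiff_normed _
  hasCompactSupport := ContDiffBump.hasCompactSupport_normed _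
  nonneg := ContDiffBump.nonneg_normed _
  integral_eq_one := ContDiffBump.integral_normed _

lemma tsupport_stdMollifier (n : ℕ) :
    tsupport (stdMollifier n : E → ℝ) = Metric.closedBall 0 (1 / (n + 1)) :=
  ContDiffBump.tsupport_normed_eq _

/-- Mollifications of a locally integrable function converge to it almost everywhere, by the
Lebesgue differentiation theorem. -/
lemma ae_tendsto_mollify_stdMollifier {G : Type*} [NormedAddCommGroup G] [NormedSpace ℝ G]
    [CompleteSpace G] {g : E → G} (hg : LocallyIntegrable g) :
    ∀ᵐ x, Tendsto (fun n => mollify (stdMollifier n) g x) atTop (𝓝 (g x)) := by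
  refine ContDiffBump.ae_convolution_tendsto_right_of_locallyIntegrable (K := 2)
    (φ := fun n => stdBump n) (l := atTop) ?_ ?_ hg
  · exact tendsto_one_div_add_atTop_nhds_zero_nat
  · refine .of_forall fun n => ?_
    simp only [stdBump]
    have : (0 : ℝ) < n + 1 := by positivity
    field_simp
    exact le_rfl

namespace KernelSequence

variable {p : ℝ} {b : ℕ → E → ℝ} {a : E → ℝ} (h : KernelSequence p b a)
include h

/-- The mollified limit kernel is nonnegative, since its values are limits of integrals of
nonnegative functions. -/
lemma ae_nonneg : ∀ᵐ ξ, 0 ≤ a ξ := by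
  filter_upwards [ae_tendsto_mollify_stdMollifier h.integrable_limit.locallyIntegrable] with x hx
  refine ge_of_tendsto' hx fun n => ?_
  have hm := isMollifier_stdMollifier (E := E) n
  rw [mollify_apply_swap]
  refine ge_of_tendsto' (h.tendsto (fun y => stdMollifier n (x - y)) ?_ ?_) fun j => ?_
  · exact hm.contDiff.continuous.comp (by fun_prop)
  · simpa [Function.comp_def] using hm.hasCompactSupport.comp_homeomorph (Homeomorph.subLeft x)
  · exact integral_nonneg fun ξ => mul_nonneg (hm.nonneg _) (h.nonneg _ _)

lemma aemeasurable (j : ℕ) : AEMeasurable (fun ξ => ENNReal.ofReal (b j ξ)) :=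
  (h.integrable j).aestronglyMeasurable.aemeasurable.ennreal_ofReal

lemma aemeasurable_limit : AEMeasurable (fun ξ => ENNReal.ofReal (a ξ)) :=
  h.integrable_limit.aestronglyMeasurable.aemeasurable.ennreal_ofReal

/-- Weak* convergence in terms of lower Lebesgue integrals. -/
lemma tendsto_lintegral {φ : E → ℝ} (hφ : Continuous φ) (hc : HasCompactSupport φ)
    (h0 : ∀ ξ, 0 ≤ φ ξ) :
    Tendsto (fun j => ∫⁻ ξ, ENNReal.ofReal (b j ξ) * ENNReal.ofReal (φ ξ)) atTop
      (𝓝 (∫⁻ ξ, ENNReal.ofReal (a ξ) * ENNReal.ofReal (φ ξ))) := by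
  obtain ⟨C, hC⟩ := hφ.bounded_above_of_compact_support hc
  have key : ∀ f : E → ℝ, Integrable f → (∀ᵐ ξ, 0 ≤ f ξ) →
      ∫⁻ ξ, ENNReal.ofReal (f ξ) * ENNReal.ofReal (φ ξ) = ENNReal.ofReal (∫ ξ, φ ξ * f ξ) := by
    intro f hf hf0
    have hi : Integrable fun ξ => φ ξ * f ξ :=
      hf.bdd_mul hφ.aestronglyMeasurable (.of_forall hC)
    rw [ofReal_integral_eq_lintegral_ofReal hi]
    · refine lintegral_congr fun ξ => ?_
      rw [ENNReal.ofReal_mul (h0 ξ), mul_comm]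
    · filter_upwards [hf0] with ξ hξ using mul_nonneg (h0 ξ) hξ
  rw [key a h.integrable_limit h.ae_nonneg]
  simp_rw [fun j => key (b j) (h.integrable j) (.of_forall (h.nonneg j))]
  exact (ENNReal.continuous_ofReal.tendsto _).comp (h.tendsto φ hφ hc)

/-- The limit kernel has a finite `p`-th moment. -/
lemma lintegral_limit_lt_top (hp : 0 ≤ p) :
    ∫⁻ ξ, ENNReal.ofReal (a ξ) * ‖ξ‖ₑ ^ p < ⊤ := by
  obtain ⟨M, hM, hb⟩ := h.bounded
  have h1 : ∀ n : ℕ, ∫⁻ ξ, ENNReal.ofReal (a ξ) * ENNReal.ofReal (ballCutoff n ξ * ‖ξ‖ ^ p) ≤ M := by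
    intro n
    refine le_of_tendsto (h.tendsto_lintegral ?_ ?_ ?_) ?_
    · exact (continuous_ballCutoff _).mul (continuous_norm.rpow_const fun _ => Or.inr hp)
    · exact (hasCompactSupport_ballCutoff _).mul_right
    · exact fun ξ => mul_nonneg (ballCutoff_nonneg _ _) (by positivity)
    · filter_upwards [hb] with j hj
      refine le_trans (lintegral_mono fun ξ => ?_) hj
      rw [← ENNReal.ofReal_mul (h.nonneg _ _)]
      refine ENNReal.ofReal_le_ofReal (mul_le_mul_of_nonneg_left ?_ (h.nonneg _ _))
      have h2 := mul_le_mul_of_nonneg_right (ballCutoff_le_one n ξ)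
        (Real.rpow_nonneg (norm_nonneg ξ) p)
      linarith
  have h2 : ∀ ξ : E, Tendsto (fun n : ℕ => ENNReal.ofReal (a ξ) *
      ENNReal.ofReal (ballCutoff n ξ * ‖ξ‖ ^ p)) atTop (𝓝 (ENNReal.ofReal (a ξ) * ‖ξ‖ₑ ^ p)) := by
    intro ξ
    refine ENNReal.Tendsto.const_mul ?_ (Or.inr ENNReal.ofReal_ne_top)
    refine tendsto_const_nhds.congr' ?_
    filter_upwards [eventually_ge_atTop ⌈‖ξ‖⌉₊] with n hn
    rw [ballCutoff_eq_one (Nat.ceil_le.1 hn), one_mul,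
      ← ENNReal.ofReal_rpow_of_nonneg (norm_nonneg _) hp, ofReal_norm]
  have hm : ∀ n : ℕ, AEMeasurable fun ξ : E => ENNReal.ofReal (a ξ) *
      ENNReal.ofReal (ballCutoff n ξ * ‖ξ‖ ^ p) := fun n =>
    h.aemeasurable_limit.mul ((continuous_ballCutoff _).mul
      (continuous_norm.rpow_const fun _ => Or.inr hp)).measurable.ennreal_ofReal.aemeasurable
  calc ∫⁻ ξ, ENNReal.ofReal (a ξ) * ‖ξ‖ₑ ^ p
      = ∫⁻ ξ, liminf (fun n : ℕ => ENNReal.ofReal (a ξ) *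
          ENNReal.ofReal (ballCutoff n ξ * ‖ξ‖ ^ p)) atTop :=
        lintegral_congr fun ξ => (h2 ξ).liminf_eq.symm
    _ ≤ liminf (fun n : ℕ => ∫⁻ ξ, ENNReal.ofReal (a ξ) *
          ENNReal.ofReal (ballCutoff n ξ * ‖ξ‖ ^ p)) atTop := lintegral_liminf_le' hm
    _ ≤ liminf (fun _ : ℕ => M) atTop := liminf_le_liminf (.of_forall h1)
    _ = M := by simp
    _ < ⊤ := hM.lt_top

end KernelSequence

/-- A nonnegative kernel that is not almost everywhere zero controls the operator norm: it is not
carried by the kernel of a nonzero linear map, which is a null set, and the unit sphere of linear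
maps is compact. -/
lemma exists_mul_enorm_rpow_le_lintegral {p : ℝ} (hp : 0 < p) {a : E → ℝ}
    (ha : AEMeasurable a) (h0 : ∀ᵐ ξ, 0 ≤ a ξ) (hne : ¬ a =ᵐ[volume] 0) :
    ∃ c : ℝ≥0∞, c ≠ 0 ∧ ∀ M : E →L[ℝ] F,
      c * ‖M‖ₑ ^ p ≤ ∫⁻ ξ, ENNReal.ofReal (a ξ) * ‖M ξ‖ₑ ^ p := by
  have := FiniteDimensional.proper ℝ (E →L[ℝ] F)
  set N : (E →L[ℝ] F) → ℝ≥0∞ := fun M => ∫⁻ ξ, ENNReal.ofReal (a ξ) * ‖M ξ‖ₑ ^ p with hN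
  have hsph : ∃ c : ℝ≥0∞, c ≠ 0 ∧ ∀ M ∈ Metric.sphere (0 : E →L[ℝ] F) 1, c ≤ N M := by
    by_contra! hcon
    choose M hM1 hM2 using fun n : ℕ => hcon ((n : ℝ≥0∞) + 1)⁻¹ (by simp)
    obtain ⟨M₀, hM₀, σ, hσ, hlim⟩ := (isCompact_sphere (0 : E →L[ℝ] F) 1).tendsto_subseq hM1
    have hmeas : ∀ L : E →L[ℝ] F, AEMeasurable fun ξ => ENNReal.ofReal (a ξ) * ‖L ξ‖ₑ ^ p :=
      fun L => ha.ennreal_ofReal.mul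
        ((L.continuous.enorm.measurable).pow_const p).aemeasurable
    have hN0 : N M₀ = 0 := by
      refine le_antisymm ?_ (zero_le)
      calc N M₀ = ∫⁻ ξ, liminf (fun n => ENNReal.ofReal (a ξ) * ‖M (σ n) ξ‖ₑ ^ p) atTop := by
            refine lintegral_congr fun ξ => (Tendsto.liminf_eq ?_).symm
            refine ENNReal.Tendsto.const_mul ?_ (Or.inr ENNReal.ofReal_ne_top)
            refine (ENNReal.continuous_rpow_const.tendsto _).comp ?_
            refine (continuous_enorm.tendsto _).comp ?_
            exact ((ContinuousLinearMap.apply ℝ F ξ).continuous.tendsto _).comp hlim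
        _ ≤ liminf (fun n => N (M (σ n))) atTop := lintegral_liminf_le' fun n => hmeas _
        _ ≤ liminf (fun n => (((σ n : ℕ) : ℝ≥0∞) + 1)⁻¹) atTop :=
            liminf_le_liminf (.of_forall fun n => (hM2 _).le)
        _ = 0 := by
            refine Tendsto.liminf_eq ?_
            have h1 : Tendsto (fun n : ℕ => ((n : ℝ≥0∞) + 1)⁻¹) atTop (𝓝 0) := by
              have := (ENNReal.tendsto_inv_nat_nhds_zero).comp (tendsto_add_atTop_nat 1)
              simpa [Function.comp_def] using this
            exact h1.comp hσ.tendsto_atTop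
    have hM0 : M₀ ≠ 0 := by
      rintro rfl
      simp at hM₀
    refine hne ?_
    have hker : volume (LinearMap.ker (M₀ : E →ₗ[ℝ] F) : Set E) = 0 := by
      refine Measure.addHaar_submodule _ _ fun htop => hM0 ?_
      ext ξ
      have : ξ ∈ LinearMap.ker (M₀ : E →ₗ[ℝ] F) := htop ▸ Submodule.mem_top
      simpa using this
    have hae := (lintegral_eq_zero_iff' (hmeas M₀)).1 hN0
    have hker' : ∀ᵐ ξ : E, ξ ∉ (LinearMap.ker (M₀ : E →ₗ[ℝ] F) : Set E) :=
      measure_eq_zero_iff_ae_notMem.1 hker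
    filter_upwards [hae, hker', h0] with ξ h1 h2 h3
    simp only [Pi.zero_apply, mul_eq_zero, ENNReal.ofReal_eq_zero] at h1 ⊢
    rcases h1 with h1 | h1
    · exact le_antisymm h1 h3
    · rw [ENNReal.rpow_eq_zero_iff_of_pos hp, enorm_eq_zero] at h1
      exact absurd (by simpa using h1) h2
  obtain ⟨c, hc, hcN⟩ := hsph
  refine ⟨c, hc, fun M => ?_⟩
  rcases eq_or_ne M 0 with rfl | hM
  · have h1 : ‖(0 : E →L[ℝ] F)‖ₑ = 0 := by rw [← ofReal_norm, norm_zero, ENNReal.ofReal_zero]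
    rw [h1, ENNReal.zero_rpow_of_pos hp, mul_zero]
    exact zero_le
  have hM' : ‖M‖ ≠ 0 := norm_ne_zero_iff.2 hM
  have hM'' : ‖M‖ₑ ≠ 0 := by
    rw [← ofReal_norm]
    exact (ENNReal.ofReal_pos.2 (norm_pos_iff.2 hM)).ne'
  have h1 := hcN (‖M‖⁻¹ • M) (by simp [norm_smul, hM'])
  have h2 : N (‖M‖⁻¹ • M) * ‖M‖ₑ ^ p = N M := by
    simp only [hN]
    rw [← lintegral_mul_const' _ _ (ENNReal.rpow_ne_top_of_nonneg hp.le enorm_ne_top)]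
    refine lintegral_congr fun ξ => ?_
    rw [smul_apply, enorm_smul, mul_assoc,
      ← ENNReal.mul_rpow_of_nonneg _ _ hp.le, enorm_inv hM', enorm_norm, mul_right_comm,
      ENNReal.inv_mul_cancel hM'' enorm_ne_top, one_mul]
  calc c * ‖M‖ₑ ^ p ≤ N (‖M‖⁻¹ • M) * ‖M‖ₑ ^ p := by gcongr
    _ = N M := h2

end Kernel

/-! ### Difference quotients -/

section DifferenceQuotients

variable {E F : Type*} [NormedAddCommGroup E] [NormedSpace ℝ E] [FiniteDimensional ℝ E]
  [MeasureSpace E] [BorelSpace E] [(volume : Measure E).IsAddHaarMeasure]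
  [NormedAddCommGroup F] [NormedSpace ℝ F] [FiniteDimensional ℝ F]

/-- Mollification does not increase the `L^p` norm of difference quotients, by Jensen's inequality
and translation invariance; the domain has to shrink by the radius of the mollifier. -/
lemma lintegral_mollify_translate_sub_le [CompleteSpace F] {p : ℝ} (hp : 1 ≤ p) {ρ : E → ℝ}
    (hρ : IsMollifier ρ) {U : E → F} (hU : LocallyIntegrable U) {K B : Set E}
    (hK : MeasurableSet K) (hB : MeasurableSet B) (c : ℝ) (z : E)
    (hKB : ∀ x ∈ K, ∀ t, ρ t ≠ 0 → x - t ∈ B) :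
    ∫⁻ x in K, ‖c • (mollify ρ U (x + z) - mollify ρ U x)‖ₑ ^ p ≤
      ∫⁻ x in B, ‖c • (U (x + z) - U x)‖ₑ ^ p := by
  set g : E → F := fun x => c • (U (x + z) - U x) with hg
  have hm : AEStronglyMeasurable g :=
    ((hU.aestronglyMeasurable.comp_measurePreserving (measurePreserving_add_right volume z)).sub
      hU.aestronglyMeasurable).const_smul c
  have hmol : ∀ x, c • (mollify ρ U (x + z) - mollify ρ U x) = ∫ t, ρ t • g (x - t) := by
    intro x
    rw [mollify_apply, mollify_apply, ← integral_sub (hρ.integrable_smul hU _)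
      (hρ.integrable_smul hU _), ← integral_smul]
    congr 1 with t
    rw [hg]
    simp only
    rw [smul_comm (ρ t) c, ← smul_sub, add_sub_right_comm]
  have hm2 : AEMeasurable (fun q : E × E => ENNReal.ofReal (ρ q.2) * ‖g (q.1 - q.2)‖ₑ ^ p)
      ((volume.restrict K).prod volume) := by
    refine (hρ.measurable_ofReal.comp measurable_snd).aemeasurable.mul (AEMeasurable.pow_const ?_ p)
    have h1 : AEStronglyMeasurable (fun q : E × E => g (q.1 - q.2)) (volume.prod volume) :=
      hm.comp_quasiMeasurePreserving
        (quasiMeasurePreserving_sub_of_right_invariant volume volume)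
    refine (h1.mono_measure ?_).enorm
    exact Measure.prod_mono Measure.restrict_le_self le_rfl
  calc ∫⁻ x in K, ‖c • (mollify ρ U (x + z) - mollify ρ U x)‖ₑ ^ p
      ≤ ∫⁻ x in K, ∫⁻ t, ENNReal.ofReal (ρ t) * ‖g (x - t)‖ₑ ^ p := by
        refine lintegral_mono fun x => ?_
        simp only
        rw [hmol]
        exact hρ.enorm_integral_rpow_le hp (hm.comp_quasiMeasurePreserving
          (quasiMeasurePreserving_sub_left_of_right_invariant volume x))
    _ = ∫⁻ t, ∫⁻ x in K, ENNReal.ofReal (ρ t) * ‖g (x - t)‖ₑ ^ p := lintegral_lintegral_swap hm2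
    _ ≤ ∫⁻ t, ENNReal.ofReal (ρ t) * ∫⁻ x in B, ‖g x‖ₑ ^ p := by
        refine lintegral_mono fun t => ?_
        simp only
        rw [lintegral_const_mul' _ _ ENNReal.ofReal_ne_top]
        by_cases ht : ρ t = 0
        · simp [ht]
        refine mul_le_mul_right ?_ _
        rw [← lintegral_indicator hK, ← lintegral_indicator hB,
          ← lintegral_sub_right_eq_self (B.indicator fun x => ‖g x‖ₑ ^ p) t]
        refine lintegral_mono fun x => ?_
        by_cases hx : x ∈ K
        · simp [hx, hKB x hx t ht]
        · simp [hx]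
    _ = ∫⁻ x in B, ‖g x‖ₑ ^ p := by
        rw [lintegral_mul_const _ hρ.measurable_ofReal, hρ.lintegral_ofReal, one_mul]

/-- The difference quotients of a compactly supported `C^1` function converge uniformly. -/
lemma exists_norm_smul_sub_sub_fderiv_le {w : E → F} (hw : ContDiff ℝ 1 w)
    (hc : HasCompactSupport w) {δ : ℝ} (hδ : 0 < δ) :
    ∃ s : ℝ, 0 < s ∧ ∀ ε : ℝ, 0 < ε → ∀ x ξ : E, ε * ‖ξ‖ < s →
      ‖ε⁻¹ • (w (x + ε • ξ) - w x) - fderiv ℝ w x ξ‖ ≤ δ * ‖ξ‖ := by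
  have huc : UniformContinuous (fderiv ℝ w) :=
    (hc.fderiv ℝ).uniformContinuous_of_continuous (hw.continuous_fderiv one_ne_zero)
  obtain ⟨s, hs, h⟩ := Metric.uniformContinuous_iff.1 huc δ hδ
  refine ⟨s, hs, fun ε hε x ξ hξ => ?_⟩
  have hx : x ∈ Metric.ball x s := Metric.mem_ball_self hs
  have hy : x + ε • ξ ∈ Metric.ball x s := by
    simpa [norm_smul, abs_of_pos hε] using hξ
  have h1 := (convex_ball x s).norm_image_sub_le_of_norm_fderiv_le' (𝕜 := ℝ) (f := w)
    (φ := fderiv ℝ w x) (C := δ) (fun z _ => hw.differentiable one_ne_zero z)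
    (fun z hz => by simpa [dist_eq_norm] using (h hz).le) hx hy
  have h2 : ε⁻¹ • (w (x + ε • ξ) - w x) - fderiv ℝ w x ξ =
      ε⁻¹ • (w (x + ε • ξ) - w x - fderiv ℝ w x (x + ε • ξ - x)) := by
    rw [add_sub_cancel_left, map_smul, smul_sub _ (_ - _), smul_smul, inv_mul_cancel₀ hε.ne',
      one_smul]
  rw [h2, norm_smul, norm_inv, Real.norm_of_nonneg hε.le, inv_mul_le_iff₀ hε]
  refine h1.trans_eq ?_
  rw [add_sub_cancel_left, norm_smul, Real.norm_of_nonneg hε.le]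
  ring

/-- The difference quotients of a mollification are controlled by the `L^1` norm. -/
lemma IsMollifier.exists_enorm_smul_mollify_sub_le [CompleteSpace F] {ρ : E → ℝ}
    (hρ : IsMollifier ρ) :
    ∃ L : NNReal, ∀ U : E → F, Integrable U → ∀ ε : ℝ, 0 < ε → ∀ x ξ : E,
      ‖ε⁻¹ • (mollify ρ U (x + ε • ξ) - mollify ρ U x)‖ₑ ≤ L * ‖ξ‖ₑ * ∫⁻ y, ‖U y‖ₑ := by
  obtain ⟨L, hL⟩ := hρ.contDiff.lipschitzWith_of_hasCompactSupport hρ.hasCompactSupport (by simp)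
  refine ⟨L, fun U hU ε hε x ξ => ?_⟩
  have h1 : ε⁻¹ • (mollify ρ U (x + ε • ξ) - mollify ρ U x) =
      ∫ y, (ε⁻¹ * (ρ (x + ε • ξ - y) - ρ (x - y))) • U y := by
    rw [mollify_apply_swap, mollify_apply_swap,
      ← integral_sub (hρ.integrable_smul_swap hU.locallyIntegrable _)
      (hρ.integrable_smul_swap hU.locallyIntegrable _), ← integral_smul]
    congr 1 with y
    rw [mul_smul, sub_smul]
  rw [h1]
  refine (enorm_integral_le_lintegral_enorm _).trans ?_
  rw [← lintegral_const_mul'' _ hU.aestronglyMeasurable.enorm]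
  refine lintegral_mono fun y => ?_
  rw [enorm_smul]
  gcongr
  have h2 := hL.dist_le_mul (x + ε • ξ - y) (x - y)
  rw [dist_eq_norm, dist_eq_norm, sub_sub_sub_cancel_right, add_sub_cancel_left, norm_smul,
    Real.norm_of_nonneg hε.le] at h2
  have h3 : ‖ε⁻¹ * (ρ (x + ε • ξ - y) - ρ (x - y))‖ ≤ L * ‖ξ‖ := by
    rw [norm_mul, norm_inv, Real.norm_of_nonneg hε.le, inv_mul_le_iff₀ hε]
    linarith
  rw [← ofReal_norm, ← ofReal_norm, ← ENNReal.ofReal_coe_nnreal, ← ENNReal.ofReal_mul L.coe_nonneg]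
  exact ENNReal.ofReal_le_ofReal h3

/-- The `p`-energy in the direction `ξ` of a bounded field of linear maps is continuous in `ξ`. -/
lemma continuous_integral_norm_apply_rpow {p : ℝ} (hp : 0 ≤ p) {G : E → E →L[ℝ] F}
    (hG : Continuous G) {B : ℝ} (hB : ∀ x, ‖G x‖ ≤ B) {K : Set E} (hK : volume K ≠ ⊤) :
    Continuous fun ξ => ∫ x in K, ‖G x ξ‖ ^ p := by
  have := FiniteDimensional.proper ℝ E
  have : IsFiniteMeasure (volume.restrict K) := ⟨by simpa using hK.lt_top⟩
  refine continuous_iff_continuousAt.2 fun ξ₀ => ?_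
  refine continuousAt_of_dominated (bound := fun _ => (B * (‖ξ₀‖ + 1)) ^ p) ?_ ?_ ?_ ?_
  · refine .of_forall fun ξ => Continuous.aestronglyMeasurable ?_
    exact (hG.clm_apply continuous_const).norm.rpow_const fun _ => Or.inr hp
  · filter_upwards [Metric.ball_mem_nhds ξ₀ zero_lt_one] with ξ hξ
    refine .of_forall fun x => ?_
    rw [Real.norm_of_nonneg (by positivity)]
    have h1 : ‖ξ‖ ≤ ‖ξ₀‖ + 1 := by
      have h2 := norm_le_norm_add_norm_sub' ξ ξ₀
      rw [Metric.mem_ball, dist_eq_norm] at hξ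
      linarith
    gcongr
    exact (G x).le_of_opNorm_le_of_le (hB x) h1
  · exact integrable_const _
  · refine .of_forall fun x => ?_
    exact ((G x).continuous.norm.rpow_const fun _ => Or.inr hp).continuousAt

lemma ofReal_integral_norm_apply_rpow {p : ℝ} (hp : 0 ≤ p) {G : E → E →L[ℝ] F}
    (hG : Continuous G) {B : ℝ} (hB : ∀ x, ‖G x‖ ≤ B) {K : Set E} (hK : volume K ≠ ⊤) (ξ : E) :
    ENNReal.ofReal (∫ x in K, ‖G x ξ‖ ^ p) = ∫⁻ x in K, ‖G x ξ‖ₑ ^ p := by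
  have : IsFiniteMeasure (volume.restrict K) := ⟨by simpa using hK.lt_top⟩
  rw [ofReal_integral_eq_lintegral_ofReal]
  · refine lintegral_congr fun x => ?_
    rw [← ENNReal.ofReal_rpow_of_nonneg (norm_nonneg _) hp, ofReal_norm]
  · refine Integrable.of_bound (Continuous.aestronglyMeasurable ?_) ((B * ‖ξ‖) ^ p) ?_
    · exact (hG.clm_apply continuous_const).norm.rpow_const fun _ => Or.inr hp
    · refine .of_forall fun x => ?_
      rw [Real.norm_of_nonneg (by positivity)]
      gcongr
      exact (G x).le_of_opNorm_le (hB x) ξ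
  · exact .of_forall fun x => by positivity

/-- Weak* convergence of the kernels, tested with the continuous function
`ξ ↦ ∫_K |G(x) ξ|^p dx`, cut off for large `ξ`. -/
lemma KernelSequence.tendsto_lintegral_directional {p : ℝ} {b : ℕ → E → ℝ} {a : E → ℝ}
    (h : KernelSequence p b a) (hp : 0 ≤ p) {G : E → E →L[ℝ] F} (hG : Continuous G) {B : ℝ}
    (hB : ∀ x, ‖G x‖ ≤ B) {K : Set E} (hK : volume K ≠ ⊤) (r : ℝ) :
    Tendsto (fun j => ∫⁻ ξ, ENNReal.ofReal (b j ξ) *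
        (ENNReal.ofReal (ballCutoff r ξ) * ∫⁻ x in K, ‖G x ξ‖ₑ ^ p)) atTop
      (𝓝 (∫⁻ ξ, ENNReal.ofReal (a ξ) *
        (ENNReal.ofReal (ballCutoff r ξ) * ∫⁻ x in K, ‖G x ξ‖ₑ ^ p))) := by
  have h1 := h.tendsto_lintegral
    ((continuous_ballCutoff r).mul (continuous_integral_norm_apply_rpow hp hG hB hK))
    (hasCompactSupport_ballCutoff r).mul_right
    (fun ξ => mul_nonneg (ballCutoff_nonneg _ _)
      (integral_nonneg fun x => Real.rpow_nonneg (norm_nonneg _) _))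
  simpa only [Pi.mul_apply, ENNReal.ofReal_mul (ballCutoff_nonneg _ _),
    ofReal_integral_norm_apply_rpow hp hG hB hK] using h1

end DifferenceQuotients

/-! ### The liminf inequality for mollifications -/

section LowerBound

variable {E F : Type*} [NormedAddCommGroup E] [NormedSpace ℝ E] [FiniteDimensional ℝ E]
  [MeasureSpace E] [BorelSpace E] [(volume : Measure E).IsAddHaarMeasure]
  [NormedAddCommGroup F] [NormedSpace ℝ F] [FiniteDimensional ℝ F] [CompleteSpace F]

/-- The points whose distance from the complement of `A` is larger than `r`. The extended distance
makes this the whole space if `A` is. -/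
def innerPart {E : Type*} [PseudoEMetricSpace E] (A : Set E) (r : ℝ) : Set E :=
  {x | ENNReal.ofReal r < Metric.infEDist x Aᶜ}

lemma isOpen_innerPart (A : Set E) (r : ℝ) : IsOpen (innerPart A r) :=
  isOpen_lt continuous_const Metric.continuous_infEDist

lemma mem_of_mem_innerPart {A : Set E} {r : ℝ} {x y : E} (hx : x ∈ innerPart A r)
    (hy : ‖y - x‖ ≤ r) : y ∈ A := by
  by_contra h
  have h1 : Metric.infEDist x Aᶜ ≤ edist x y := Metric.infEDist_le_edist_of_mem h
  rw [edist_dist, dist_comm, dist_eq_norm] at h1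
  exact absurd (hx.trans_le h1) (ENNReal.ofReal_le_ofReal hy).not_gt

lemma innerPart_subset {A : Set E} {r : ℝ} (hr : 0 ≤ r) : innerPart A r ⊆ A :=
  fun x hx => mem_of_mem_innerPart hx (by simpa using hr)

/-- A compact subset of an open set lies in one of its inner parts. -/
lemma exists_subset_innerPart {A K : Set E} (hA : IsOpen A) (hK : IsCompact K) (hKA : K ⊆ A) :
    ∃ r : ℝ, 0 < r ∧ K ⊆ innerPart A r := by
  rcases K.eq_empty_or_nonempty with rfl | hne
  · exact ⟨1, one_pos, Set.empty_subset _⟩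
  obtain ⟨x₀, hx₀, hmin⟩ := hK.exists_isMinOn hne
    (Metric.continuous_infEDist (s := Aᶜ)).continuousOn
  have hpos : 0 < Metric.infEDist x₀ Aᶜ := by
    rw [pos_iff_ne_zero]
    intro h0
    have := Metric.mem_closure_iff_infEDist_zero.2 h0
    rw [hA.isClosed_compl.closure_eq] at this
    exact this (hKA hx₀)
  obtain ⟨q, hq0, hq⟩ := ENNReal.lt_iff_exists_nnreal_btwn.1 hpos
  refine ⟨q, by exact_mod_cast hq0, fun x hx => ?_⟩
  rw [innerPart, Set.mem_ofPred_eq, ENNReal.ofReal_coe_nnreal]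
  exact hq.trans_le (hmin hx)

/-- The liminf inequality for mollifications and truncated kernels: the difference quotients of the
mollified functions converge uniformly, and mollifying does not increase the functional. -/
lemma KernelSequence.lintegral_ballCutoff_le_liminf {p : ℝ} {b : ℕ → E → ℝ} {a : E → ℝ}
    (h : KernelSequence p b a) (hp : 1 ≤ p) {e : ℕ → ℝ} (he : ∀ j, 0 < e j)
    (he0 : Tendsto e atTop (𝓝 0)) {A : Set E} (hA : IsOpen A) (hAb : Bornology.IsBounded A)
    {v : ℕ → E → F} {u : E → F} (hv : ∀ j, IntegrableOn (v j) A) (hu : IntegrableOn u A)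
    (hvu : Tendsto (fun j => ∫⁻ x in A, ‖v j x - u x‖ₑ) atTop (𝓝 0))
    {ρ : E → ℝ} (hρ : IsMollifier ρ) {η : ℝ} (hη : 0 < η)
    (hs : Function.support ρ ⊆ Metric.closedBall 0 η) {r : ℝ} (hr : 0 < r) :
    ∫⁻ ξ, ENNReal.ofReal (a ξ) * (ENNReal.ofReal (ballCutoff r ξ) *
        ∫⁻ x in innerPart A (2 * η), ‖fderiv ℝ (mollify ρ (A.indicator u)) x ξ‖ₑ ^ p) ≤
      liminf (fun j => ∫⁻ ξ, ENNReal.ofReal (b j ξ) *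
        ∫⁻ x in {x | x ∈ A ∧ x + e j • ξ ∈ A},
          ‖(e j)⁻¹ • (v j (x + e j • ξ) - v j x)‖ₑ ^ p) atTop := by
  have := FiniteDimensional.proper ℝ E
  have hp0 : 0 < p := zero_lt_one.trans_le hp
  set K := innerPart A (2 * η) with hKdef
  have hKm : MeasurableSet K := (isOpen_innerPart _ _).measurableSet
  have hKA : K ⊆ A := innerPart_subset (by positivity)
  have hKfin : volume K ≠ ⊤ := ((measure_mono hKA).trans_lt hAb.measure_lt_top).ne
  set U : E → F := A.indicator u with hU
  set V : ℕ → E → F := fun j => A.indicator (v j) with hV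
  have hUi : Integrable U := hu.integrable_indicator hA.measurableSet
  have hVi : ∀ j, Integrable (V j) := fun j => (hv j).integrable_indicator hA.measurableSet
  set w := mollify ρ U with hw
  have hwd : ContDiff ℝ 1 w :=
    (hρ.contDiff_mollify hUi.locallyIntegrable).of_le (by exact_mod_cast le_top)
  have hUc : HasCompactSupport U := by
    refine HasCompactSupport.of_support_subset_isCompact hAb.isCompact_closure ?_
    exact (Set.support_indicator_subset).trans subset_closure
  have hwc : HasCompactSupport w := hρ.hasCompactSupport_mollify hUc
  obtain ⟨B, hB⟩ := (hwd.continuous_fderiv one_ne_zero).bounded_above_of_compact_support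
    (hwc.fderiv ℝ)
  obtain ⟨L, hL⟩ := hρ.exists_enorm_smul_mollify_sub_le (F := F)
  obtain ⟨M, hM, hbM⟩ := h.bounded
  set Gf : ℕ → ℝ≥0∞ := fun j => ∫⁻ ξ, ENNReal.ofReal (b j ξ) *
        ∫⁻ x in {x | x ∈ A ∧ x + e j • ξ ∈ A}, ‖(e j)⁻¹ • (v j (x + e j • ξ) - v j x)‖ₑ ^ p with hGf
  have hlim := h.tendsto_lintegral_directional hp0.le (hwd.continuous_fderiv one_ne_zero) hB hKfin r
  set X := ∫⁻ ξ, ENNReal.ofReal (a ξ) * (ENNReal.ofReal (ballCutoff r ξ) *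
        ∫⁻ x in K, ‖fderiv ℝ w x ξ‖ₑ ^ p) with hX
  -- up to an error `κ`, the derivative of `w` is a difference quotient of the mollified `v j`
  have hquot : ∀ κ : ℝ, 0 < κ → ∀ᶠ j in atTop, ∀ ξ : E, ‖ξ‖ ≤ r + 1 → ∀ x,
      ‖fderiv ℝ w x ξ‖ₑ ≤ ‖(e j)⁻¹ • (mollify ρ (V j) (x + e j • ξ) - mollify ρ (V j) x)‖ₑ
        + ENNReal.ofReal κ := by
    intro κ hκ
    have hr1 : 0 < r + 1 := by linarith
    obtain ⟨s, hs0, hsq⟩ := exists_norm_smul_sub_sub_fderiv_le hwd hwc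
      (δ := κ / 2 / (r + 1)) (by positivity)
    have h1 : ∀ᶠ j in atTop, e j * (r + 1) < s := by
      have := he0.mul_const (r + 1)
      rw [zero_mul] at this
      exact this.eventually_lt_const hs0
    have h2 : ∀ᶠ j in atTop,
        (L : ℝ≥0∞) * ENNReal.ofReal (r + 1) * ∫⁻ y, ‖(U - V j) y‖ₑ ≤ ENNReal.ofReal (κ / 2) := by
      have h3 : ∀ j, ∫⁻ y, ‖(U - V j) y‖ₑ = ∫⁻ x in A, ‖v j x - u x‖ₑ := by
        intro j
        rw [← lintegral_indicator hA.measurableSet]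
        refine lintegral_congr fun y => ?_
        by_cases hy : y ∈ A
        · simp [hU, hV, hy, enorm_sub_rev]
        · simp [hU, hV, hy]
      simp_rw [h3]
      have h4 := ENNReal.Tendsto.const_mul (a := (L : ℝ≥0∞) * ENNReal.ofReal (r + 1)) hvu
        (Or.inr (ENNReal.mul_ne_top ENNReal.coe_ne_top ENNReal.ofReal_ne_top))
      rw [mul_zero] at h4
      exact h4.eventually_le_const (by simpa using hκ)
    filter_upwards [h1, h2] with j hj1 hj2 ξ hξ x
    have q1 := hsq (e j) (he j) x ξ (by
      refine lt_of_le_of_lt ?_ hj1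
      exact mul_le_mul_of_nonneg_left hξ (he j).le)
    have q2 := hL (U - V j) (hUi.sub (hVi j)) (e j) (he j) x ξ
    rw [hρ.mollify_sub hUi.locallyIntegrable (hVi j).locallyIntegrable] at q2
    have q3 : fderiv ℝ w x ξ =
        (e j)⁻¹ • (mollify ρ (V j) (x + e j • ξ) - mollify ρ (V j) x) +
        ((e j)⁻¹ • ((mollify ρ U - mollify ρ (V j)) (x + e j • ξ) -
          (mollify ρ U - mollify ρ (V j)) x) -
        ((e j)⁻¹ • (w (x + e j • ξ) - w x) - fderiv ℝ w x ξ)) := by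
      simp only [hw, Pi.sub_apply, smul_sub]
      abel
    rw [q3]
    refine (enorm_add_le _ _).trans ?_
    gcongr
    refine enorm_sub_le.trans ?_
    have q4 : ‖(e j)⁻¹ • (w (x + e j • ξ) - w x) - fderiv ℝ w x ξ‖ₑ ≤ ENNReal.ofReal (κ / 2) := by
      rw [← ofReal_norm]
      refine ENNReal.ofReal_le_ofReal (q1.trans ?_)
      calc κ / 2 / (r + 1) * ‖ξ‖ ≤ κ / 2 / (r + 1) * (r + 1) := by gcongr
        _ = κ / 2 := by field_simp
    have q5 : ‖(e j)⁻¹ • ((mollify ρ U - mollify ρ (V j)) (x + e j • ξ) -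
        (mollify ρ U - mollify ρ (V j)) x)‖ₑ ≤ ENNReal.ofReal (κ / 2) := by
      refine q2.trans (le_trans ?_ hj2)
      gcongr
      rw [← ofReal_norm]
      exact ENNReal.ofReal_le_ofReal hξ
    calc _ ≤ ENNReal.ofReal (κ / 2) + ENNReal.ofReal (κ / 2) := add_le_add q5 q4
      _ = ENNReal.ofReal κ := by
        rw [← ENNReal.ofReal_add (by positivity) (by positivity), add_halves]
  -- the resulting inequality between the functionals
  have hfun : ∀ l : ℝ≥0∞, 1 < l → l ≠ ⊤ → ∃ C : ℝ≥0∞, C ≠ ⊤ ∧ ∀ κ : ℝ, 0 < κ → ∀ᶠ j in atTop,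
      ∫⁻ ξ, ENNReal.ofReal (b j ξ) * (ENNReal.ofReal (ballCutoff r ξ) *
        ∫⁻ x in K, ‖fderiv ℝ w x ξ‖ₑ ^ p) ≤ l * Gf j + C * ENNReal.ofReal κ ^ p := by
    intro l hl hl'
    obtain ⟨C, hC, hadd⟩ := exists_add_rpow_le hp hl
    refine ⟨C * volume K * M, ENNReal.mul_ne_top (ENNReal.mul_ne_top hC hKfin) hM,
      fun κ hκ => ?_⟩
    have h1 : ∀ᶠ j in atTop, e j * (r + 1) < η := by
      have := he0.mul_const (r + 1)
      rw [zero_mul] at this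
      exact this.eventually_lt_const hη
    filter_upwards [hquot κ hκ, h1, hbM] with j hj hj1 hjM
    have hinner : ∀ ξ : E, ENNReal.ofReal (ballCutoff r ξ) *
        ∫⁻ x in K, ‖fderiv ℝ w x ξ‖ₑ ^ p ≤
        l * (∫⁻ x in {x | x ∈ A ∧ x + e j • ξ ∈ A}, ‖(e j)⁻¹ • (v j (x + e j • ξ) - v j x)‖ₑ ^ p)
          + C * ENNReal.ofReal κ ^ p * volume K := by
      intro ξ
      rcases le_or_gt (r + 1) ‖ξ‖ with hξ | hξ
      · rw [ballCutoff_eq_zero hξ, ENNReal.ofReal_zero, zero_mul]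
        exact zero_le
      have hξj : ‖e j • ξ‖ ≤ η := by
        rw [norm_smul, Real.norm_of_nonneg (he j).le]
        exact (mul_le_mul_of_nonneg_left hξ.le (he j).le).trans hj1.le
      have hBm : MeasurableSet {x | x ∈ A ∧ x + e j • ξ ∈ A} :=
        (hA.inter (hA.preimage (continuous_id.add continuous_const))).measurableSet
      calc ENNReal.ofReal (ballCutoff r ξ) * ∫⁻ x in K, ‖fderiv ℝ w x ξ‖ₑ ^ p
          ≤ 1 * ∫⁻ x in K, ‖fderiv ℝ w x ξ‖ₑ ^ p := by
            gcongr
            simpa using ballCutoff_le_one r ξ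
        _ ≤ ∫⁻ x in K, (l * ‖(e j)⁻¹ • (mollify ρ (V j) (x + e j • ξ) -
              mollify ρ (V j) x)‖ₑ ^ p + C * ENNReal.ofReal κ ^ p) := by
            rw [one_mul]
            refine lintegral_mono fun x => ?_
            exact (ENNReal.rpow_le_rpow (hj ξ hξ.le x) hp0.le).trans (hadd _ _)
        _ = l * (∫⁻ x in K, ‖(e j)⁻¹ • (mollify ρ (V j) (x + e j • ξ) -
              mollify ρ (V j) x)‖ₑ ^ p) + C * ENNReal.ofReal κ ^ p * volume K := by
            have hcm : Continuous (mollify ρ (V j)) :=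
              (hρ.contDiff_mollify (hVi j).locallyIntegrable).continuous
            have hmeas : Measurable fun x => ‖(e j)⁻¹ • (mollify ρ (V j) (x + e j • ξ) -
                mollify ρ (V j) x)‖ₑ ^ p :=
              (Continuous.measurable (by fun_prop)).pow_const p
            rw [lintegral_add_right _ measurable_const, lintegral_const_mul _ hmeas,
              lintegral_const, Measure.restrict_apply_univ]
        _ ≤ l * (∫⁻ x in {x | x ∈ A ∧ x + e j • ξ ∈ A},
              ‖(e j)⁻¹ • (V j (x + e j • ξ) - V j x)‖ₑ ^ p) +
              C * ENNReal.ofReal κ ^ p * volume K := by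
            refine add_le_add_left (mul_le_mul_right ?_ _) _
            refine lintegral_mollify_translate_sub_le hp hρ (hVi j).locallyIntegrable hKm hBm _ _ ?_
            intro x hx t ht
            have ht' : ‖t‖ ≤ η := by simpa using hs ht
            refine ⟨mem_of_mem_innerPart hx ?_, mem_of_mem_innerPart hx ?_⟩
            · rw [sub_sub_cancel_left, norm_neg]
              linarith
            · rw [show x - t + e j • ξ - x = e j • ξ - t by abel]
              exact (norm_sub_le _ _).trans (by linarith)
        _ = _ := by
            congr 2
            refine setLIntegral_congr_fun hBm fun x hx => ?_
            simp only [hV, Set.indicator_of_mem hx.1, Set.indicator_of_mem hx.2]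
    have hbm := h.aemeasurable j
    calc ∫⁻ ξ, ENNReal.ofReal (b j ξ) * (ENNReal.ofReal (ballCutoff r ξ) *
          ∫⁻ x in K, ‖fderiv ℝ w x ξ‖ₑ ^ p)
        ≤ ∫⁻ ξ, (l * (ENNReal.ofReal (b j ξ) * ∫⁻ x in {x | x ∈ A ∧ x + e j • ξ ∈ A},
            ‖(e j)⁻¹ • (v j (x + e j • ξ) - v j x)‖ₑ ^ p) +
            C * ENNReal.ofReal κ ^ p * volume K * ENNReal.ofReal (b j ξ)) := by
          refine lintegral_mono fun ξ => ?_
          refine (mul_le_mul_right (hinner ξ) _).trans_eq ?_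
          ring
      _ = (∫⁻ ξ, l * (ENNReal.ofReal (b j ξ) * ∫⁻ x in {x | x ∈ A ∧ x + e j • ξ ∈ A},
            ‖(e j)⁻¹ • (v j (x + e j • ξ) - v j x)‖ₑ ^ p)) +
            C * ENNReal.ofReal κ ^ p * volume K * ∫⁻ ξ, ENNReal.ofReal (b j ξ) := by
          rw [lintegral_add_right' _ (hbm.const_mul _), lintegral_const_mul'' _ hbm]
      _ ≤ l * Gf j + C * ENNReal.ofReal κ ^ p * volume K * M := by
          gcongr
          · exact (lintegral_const_mul' _ _ hl').le
          · refine le_trans (lintegral_mono fun ξ => ENNReal.ofReal_le_ofReal ?_) hjM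
            refine le_mul_of_one_le_right (h.nonneg _ _) ?_
            have := Real.rpow_nonneg (norm_nonneg ξ) p
            linarith
      _ = l * Gf j + C * volume K * M * ENNReal.ofReal κ ^ p := by ring
  -- let first `j → ∞` along a subsequence, then `κ → 0`, and finally `l → 1`
  refine le_of_forall_gt_imp_ge_of_dense fun L' hL' => ?_
  rcases eq_or_ne L' ⊤ with rfl | hL'top
  · exact le_top
  have hfreq : ∃ᶠ j in atTop, Gf j < L' := frequently_lt_of_liminf_lt (by isBoundedDefault) hL'
  have hXl : ∀ l : ℝ≥0∞, 1 < l → l ≠ ⊤ → X ≤ l * L' := by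
    intro l hl hl'
    obtain ⟨C, hC, hCκ⟩ := hfun l hl hl'
    have h1 : ∀ κ : ℝ, 0 < κ → X ≤ l * L' + C * ENNReal.ofReal κ ^ p := by
      intro κ hκ
      refine le_of_tendsto_of_frequently hlim ((hfreq.and_eventually (hCκ κ hκ)).mono ?_)
      rintro j ⟨hj1, hj2⟩
      exact hj2.trans (by gcongr)
    have h2 : Tendsto (fun κ : ℝ => l * L' + C * ENNReal.ofReal κ ^ p) (𝓝[>] 0)
        (𝓝 (l * L' + C * ENNReal.ofReal 0 ^ p)) := by
      refine Tendsto.mono_left ?_ nhdsWithin_le_nhds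
      refine tendsto_const_nhds.add (ENNReal.Tendsto.const_mul ?_ (Or.inr hC))
      exact ((ENNReal.continuous_rpow_const.comp ENNReal.continuous_ofReal).tendsto 0)
    rw [ENNReal.ofReal_zero, ENNReal.zero_rpow_of_pos hp0, mul_zero, add_zero] at h2
    exact ge_of_tendsto h2 (by filter_upwards [self_mem_nhdsWithin] with κ hκ using h1 κ hκ)
  have h3 : Tendsto (fun l : ℝ≥0∞ => l * L') (𝓝[>] 1) (𝓝 (1 * L')) :=
    (ENNReal.Tendsto.mul_const tendsto_id (Or.inr hL'top)).mono_left nhdsWithin_le_nhds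
  rw [one_mul] at h3
  refine ge_of_tendsto h3 ?_
  filter_upwards [self_mem_nhdsWithin, nhdsWithin_le_nhds (eventually_ne_nhds ENNReal.one_ne_top)]
    with l hl hl' using hXl l hl hl'

/-- The liminf inequality for mollifications. -/
lemma KernelSequence.lintegral_fderiv_mollify_le_liminf {p : ℝ} {b : ℕ → E → ℝ} {a : E → ℝ}
    (h : KernelSequence p b a) (hp : 1 ≤ p) {e : ℕ → ℝ} (he : ∀ j, 0 < e j)
    (he0 : Tendsto e atTop (𝓝 0)) {A : Set E} (hA : IsOpen A) (hAb : Bornology.IsBounded A)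
    {v : ℕ → E → F} {u : E → F} (hv : ∀ j, IntegrableOn (v j) A) (hu : IntegrableOn u A)
    (hvu : Tendsto (fun j => ∫⁻ x in A, ‖v j x - u x‖ₑ) atTop (𝓝 0))
    {ρ : E → ℝ} (hρ : IsMollifier ρ) {η : ℝ} (hη : 0 < η)
    (hs : Function.support ρ ⊆ Metric.closedBall 0 η) :
    ∫⁻ ξ, ENNReal.ofReal (a ξ) *
        ∫⁻ x in innerPart A (2 * η), ‖fderiv ℝ (mollify ρ (A.indicator u)) x ξ‖ₑ ^ p ≤
      liminf (fun j => ∫⁻ ξ, ENNReal.ofReal (b j ξ) *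
        ∫⁻ x in {x | x ∈ A ∧ x + e j • ξ ∈ A},
          ‖(e j)⁻¹ • (v j (x + e j • ξ) - v j x)‖ₑ ^ p) atTop := by
  set w := mollify ρ (A.indicator u) with hw
  have hUi : Integrable (A.indicator u) := hu.integrable_indicator hA.measurableSet
  have hwd : Continuous (fderiv ℝ w) :=
    (hρ.contDiff_mollify hUi.locallyIntegrable).continuous_fderiv (by simp)
  have hmeas : Measurable fun ξ => ∫⁻ x in innerPart A (2 * η), ‖fderiv ℝ w x ξ‖ₑ ^ p := by
    refine Measurable.lintegral_prod_right' (f := fun q : E × E => ‖fderiv ℝ w q.2 q.1‖ₑ ^ p) ?_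
    refine (Continuous.measurable ?_).pow_const p
    exact ((hwd.comp continuous_snd).clm_apply continuous_fst).enorm
  set S : E → ℝ≥0∞ := fun ξ => ∫⁻ x in innerPart A (2 * η), ‖fderiv ℝ w x ξ‖ₑ ^ p with hS
  calc ∫⁻ ξ, ENNReal.ofReal (a ξ) * S ξ
      = ∫⁻ ξ, liminf (fun n : ℕ => ENNReal.ofReal (a ξ) *
          (ENNReal.ofReal (ballCutoff ((n : ℝ) + 1) ξ) * S ξ)) atTop := by
        refine lintegral_congr fun ξ => (Tendsto.liminf_eq ?_).symm
        refine tendsto_const_nhds.congr' ?_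
        filter_upwards [eventually_ge_atTop ⌈‖ξ‖⌉₊] with n hn
        rw [ballCutoff_eq_one ((Nat.ceil_le.1 hn).trans (by linarith)), ENNReal.ofReal_one,
          one_mul]
    _ ≤ liminf (fun n : ℕ => ∫⁻ ξ, ENNReal.ofReal (a ξ) *
          (ENNReal.ofReal (ballCutoff ((n : ℝ) + 1) ξ) * S ξ)) atTop :=
        lintegral_liminf_le' fun n => h.aemeasurable_limit.mul
          ((continuous_ballCutoff _).measurable.ennreal_ofReal.mul hmeas).aemeasurable
    _ ≤ liminf (fun _ : ℕ => _) atTop := liminf_le_liminf (.of_forall fun n =>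
        h.lintegral_ballCutoff_le_liminf hp he he0 hA hAb hv hu hvu hρ hη hs (by positivity))
    _ = _ := by simp

end LowerBound

/-! ### Weak compactness in `L^p` -/

section WeakCompactness

variable {α : Type*} [MeasurableSpace α] {μ : Measure α} [IsFiniteMeasure μ]

/-- Hölder's inequality: bounded sets of `L^p` are uniformly integrable. -/
lemma setLIntegral_enorm_le_of_lintegral_rpow_le {p : ℝ} (hp : 1 < p) {f : α → ℝ}
    (hf : AEStronglyMeasurable f μ) {C : ℝ≥0∞} (hC : ∫⁻ x, ‖f x‖ₑ ^ p ∂μ ≤ C) (S : Set α) :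
    ∫⁻ x in S, ‖f x‖ₑ ∂μ ≤ C ^ (1 / p) * μ S ^ (1 / p.conjExponent) := by
  have hpq := Real.HolderConjugate.conjExponent hp
  have h := ENNReal.lintegral_mul_le_Lp_mul_Lq (μ.restrict S) hpq
    (f := fun x => ‖f x‖ₑ) (g := fun _ => 1) hf.restrict.enorm aemeasurable_const
  simp only [Pi.mul_apply, mul_one, ENNReal.one_rpow, lintegral_const, one_mul,
    Measure.restrict_apply_univ] at h
  refine h.trans ?_
  have hp0 : 0 < p := by linarith
  gcongr
  exact (setLIntegral_le_lintegral _ _).trans hC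

/-- Weak sequential compactness of bounded sequences in `L^p`, `p > 1`, along an ultrafilter. The
limits of the integrals over measurable sets form a signed measure, by Hölder's inequality, and its
Radon–Nikodym density is the weak limit. -/
lemma exists_tendsto_integral_mul_of_lintegral_rpow_le {ι : Type*} (𝒰 : Ultrafilter ι) {p : ℝ}
    (hp : 1 < p) {f : ι → α → ℝ} (hf : ∀ k, AEStronglyMeasurable (f k) μ) {C : ℝ≥0∞} (hC : C ≠ ⊤)
    (hfC : ∀ k, ∫⁻ x, ‖f k x‖ₑ ^ p ∂μ ≤ C) :
    ∃ g : α → ℝ, Integrable g μ ∧ ∀ φ : α → ℝ, Measurable φ → (∃ M, ∀ x, |φ x| ≤ M) →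
      Tendsto (fun k => ∫ x, φ x * f k x ∂μ) 𝒰 (𝓝 (∫ x, φ x * g x ∂μ)) := by
  have hp0 : 0 < p := by linarith
  have hpq := Real.HolderConjugate.conjExponent hp
  have hq0 : 0 < 1 / p.conjExponent := one_div_pos.2 hpq.symm.pos
  set N : Set α → ℝ≥0∞ := fun S => C ^ (1 / p) * μ S ^ (1 / p.conjExponent) with hN
  have hNtop : ∀ S, N S ≠ ⊤ := fun S => ENNReal.mul_ne_top
    (ENNReal.rpow_ne_top_of_nonneg (by positivity) hC)
    (ENNReal.rpow_ne_top_of_nonneg hq0.le (measure_ne_top _ _))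
  have hle : ∀ k S, ∫⁻ x in S, ‖f k x‖ₑ ∂μ ≤ N S := fun k S =>
    setLIntegral_enorm_le_of_lintegral_rpow_le hp (hf k) (hfC k) S
  have hfi : ∀ k, Integrable (f k) μ := fun k => ⟨hf k, by
    have := hle k Set.univ
    rw [Measure.restrict_univ] at this
    exact this.trans_lt (hNtop _).lt_top⟩
  have hbdd : ∀ k S, |∫ x in S, f k x ∂μ| ≤ (N S).toReal := by
    intro k S
    rw [← Real.norm_eq_abs]
    refine (norm_integral_le_lintegral_norm _).trans (ENNReal.toReal_mono (hNtop S) ?_)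
    simpa only [ofReal_norm] using hle k S
  -- bounded sequences of reals converge along an ultrafilter
  have hconv : ∀ (y : ι → ℝ) (R : ℝ), (∀ k, |y k| ≤ R) → ∃ t, Tendsto y 𝒰 (𝓝 t) := by
    intro y R hy
    obtain ⟨t, -, ht⟩ := (isCompact_Icc (a := -R) (b := R)).ultrafilter_le_nhds (𝒰.map y)
      (le_principal_iff.2 (Filter.mem_map.2 (univ_mem' fun k => abs_le.1 (hy k))))
    exact ⟨t, ht⟩
  choose T hT using fun S => hconv (fun k => ∫ x in S, f k x ∂μ) _ (fun k => hbdd k S)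
  have hTle : ∀ S, |T S| ≤ (N S).toReal := fun S =>
    le_of_tendsto (hT S).abs (.of_forall fun k => hbdd k S)
  have hTempty : T ∅ = 0 := tendsto_nhds_unique (hT ∅) (by simp)
  have hTunion : ∀ S S', MeasurableSet S' → Disjoint S S' → T (S ∪ S') = T S + T S' := by
    intro S S' hS' hd
    refine tendsto_nhds_unique (hT _) (((hT S).add (hT S')).congr fun k => ?_)
    rw [setIntegral_union hd hS' (hfi k).integrableOn (hfi k).integrableOn]
  have hTfin : ∀ (s : Finset ℕ) (S : ℕ → Set α), (∀ i, MeasurableSet (S i)) →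
      Pairwise (Function.onFun Disjoint S) → T (⋃ i ∈ s, S i) = ∑ i ∈ s, T (S i) := by
    intro s S hS hd
    induction s using Finset.induction_on with
    | empty => simpa using hTempty
    | insert i s hi ih =>
      rw [Finset.set_biUnion_insert, Set.union_comm, hTunion _ _ (hS i), ih,
        Finset.sum_insert hi, add_comm]
      refine Set.disjoint_iUnion₂_left.2 fun k hk => hd ?_
      rintro rfl
      exact hi hk
  classical
  let s : SignedMeasure α :=
    { measureOf' := fun S => if MeasurableSet S then T S else 0
      empty' := by simp [hTempty]
      not_measurable' := fun S hS => by simp [hS]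
      m_iUnion' := by
        intro S hS hd
        simp only [hS, MeasurableSet.iUnion hS, if_true]
        rw [HasSum, SummationFilter.unconditional_filter, tendsto_iff_norm_sub_tendsto_zero]
        have h1 : Tendsto (fun t : Finset ℕ => (N (⋃ i ∈ {i | i ∉ t}, S i)).toReal) atTop
            (𝓝 0) := by
          have h2 : ∑' i, μ (S i) ≠ ⊤ := by
            rw [← measure_iUnion hd hS]
            exact measure_ne_top _ _
          have h3 := ENNReal.tendsto_tsum_compl_atTop_zero h2
          have h4 : Tendsto (fun t : Finset ℕ => N (⋃ i ∈ {i | i ∉ t}, S i)) atTop (𝓝 0) := by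
            have h5 : ∀ t : Finset ℕ, μ (⋃ i ∈ {i | i ∉ t}, S i) = ∑' i : {i // i ∉ t}, μ (S i) :=
              fun t => measure_biUnion (Set.to_countable _) (fun i _ k _ hik => hd hik)
                fun i _ => hS i
            simp only [hN, h5]
            have h6 := ENNReal.Tendsto.const_mul (a := C ^ (1 / p))
              ((ENNReal.continuous_rpow_const (y := 1 / p.conjExponent)).tendsto 0 |>.comp h3)
              (Or.inr (ENNReal.rpow_ne_top_of_nonneg (by positivity) hC))
            rw [ENNReal.zero_rpow_of_pos hq0, mul_zero] at h6
            exact h6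
          exact (ENNReal.tendsto_toReal ENNReal.zero_ne_top).comp h4
        refine squeeze_zero (fun _ => norm_nonneg _) (fun t => ?_) h1
        have h7 : (⋃ i, S i) = (⋃ i ∈ t, S i) ∪ ⋃ i ∈ {i | i ∉ t}, S i := by
          ext x
          simp only [Set.mem_iUnion, Set.mem_union, Set.mem_ofPred_eq, exists_prop]
          constructor
          · rintro ⟨i, hi⟩
            by_cases hit : i ∈ t
            · exact Or.inl ⟨i, hit, hi⟩
            · exact Or.inr ⟨i, hit, hi⟩
          · rintro (⟨i, -, hi⟩ | ⟨i, -, hi⟩) <;> exact ⟨i, hi⟩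
        have h8 : Disjoint (⋃ i ∈ t, S i) (⋃ i ∈ {i | i ∉ t}, S i) := by
          refine Set.disjoint_iUnion₂_left.2 fun i hi => Set.disjoint_iUnion₂_right.2 fun k hk => ?_
          refine hd ?_
          rintro rfl
          exact hk hi
        rw [h7, hTunion _ _ (MeasurableSet.biUnion (Set.to_countable _) fun i _ => hS i) h8,
          hTfin t S hS hd, sub_add_cancel_left, norm_neg, Real.norm_eq_abs]
        exact hTle _ }
  have hsapp : ∀ S, MeasurableSet S → s S = T S := fun S hS => if_pos hS
  have hsac : s ≪ᵥ μ.toENNRealVectorMeasure := by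
    refine VectorMeasure.AbsolutelyContinuous.mk fun S hS hS0 => ?_
    rw [Measure.toENNRealVectorMeasure_apply_measurable hS] at hS0
    rw [hsapp S hS, ← abs_nonpos_iff]
    refine (hTle S).trans_eq ?_
    simp only [hN, hS0, ENNReal.zero_rpow_of_pos hq0, mul_zero, ENNReal.toReal_zero]
  set g : α → ℝ := s.rnDeriv μ with hg
  have hgi : Integrable g μ := SignedMeasure.integrable_rnDeriv s μ
  have hgS : ∀ S, MeasurableSet S → ∫ x in S, g x ∂μ = T S := by
    intro S hS
    rw [← withDensityᵥ_apply hgi hS, SignedMeasure.withDensityᵥ_rnDeriv_eq s μ hsac, hsapp S hS]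
  refine ⟨g, hgi, fun φ hφ hM => ?_⟩
  obtain ⟨M, hM0, hM⟩ : ∃ M, 0 ≤ M ∧ ∀ x, |φ x| ≤ M := by
    obtain ⟨M, hM⟩ := hM
    exact ⟨|M|, abs_nonneg _, fun x => (hM x).trans (le_abs_self _)⟩
  have hsimple : ∀ ψ : SimpleFunc α ℝ,
      Tendsto (fun k => ∫ x, ψ x * f k x ∂μ) 𝒰 (𝓝 (∫ x, ψ x * g x ∂μ)) := by
    intro ψ
    have hint : ∀ (ψ : SimpleFunc α ℝ) {y : α → ℝ}, Integrable y μ →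
        Integrable (fun x => ψ x * y x) μ := by
      intro ψ y hy
      obtain ⟨R, hR⟩ := ψ.exists_forall_norm_le
      exact hy.bdd_mul ψ.measurable.aestronglyMeasurable (.of_forall hR)
    induction ψ using SimpleFunc.induction with
    | @const c S hS =>
      have h1 : ∀ y : α → ℝ, ∫ x, (SimpleFunc.piecewise S hS (SimpleFunc.const α c)
          (SimpleFunc.const α 0)) x * y x ∂μ = c * ∫ x in S, y x ∂μ := by
        intro y
        rw [← integral_const_mul, ← integral_indicator hS]
        congr 1 with x
        by_cases hx : x ∈ S <;> simp [hx]
      simp only [h1, hgS S hS]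
      exact (hT S).const_mul c
    | @add ψ₁ ψ₂ _ h₁ h₂ =>
      simp only [SimpleFunc.coe_add, Pi.add_apply, add_mul]
      rw [integral_add (hint ψ₁ hgi) (hint ψ₂ hgi)]
      refine (h₁.add h₂).congr fun k => ?_
      rw [integral_add (hint ψ₁ (hfi k)) (hint ψ₂ (hfi k))]
  -- bounded measurable functions are uniform limits of simple functions
  have happrox : ∀ δ : ℝ, 0 < δ → ∃ ψ : SimpleFunc α ℝ, ∀ x, |φ x - ψ x| ≤ δ := by
    intro δ hδ
    have hfin : (Set.range fun x => ⌊φ x / δ⌋).Finite := by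
      refine (Set.finite_Icc ⌊-M / δ⌋ ⌊M / δ⌋).subset ?_
      rintro _ ⟨x, rfl⟩
      have := abs_le.1 (hM x)
      exact ⟨Int.floor_mono (by gcongr; exact this.1), Int.floor_mono (by gcongr; exact this.2)⟩
    have hmeas : Measurable fun x => ⌊φ x / δ⌋ := (hφ.div_const δ).floor
    let ψ₀ : SimpleFunc α ℤ := ⟨fun x => ⌊φ x / δ⌋, fun y => hmeas (measurableSet_singleton y), hfin⟩
    refine ⟨ψ₀.map fun n : ℤ => (n : ℝ) * δ, fun x => ?_⟩
    have e : (ψ₀.map fun n : ℤ => (n : ℝ) * δ) x = ⌊φ x / δ⌋ * δ := rfl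
    rw [e]
    have h1 := Int.floor_le (φ x / δ)
    have h2 := Int.lt_floor_add_one (φ x / δ)
    rw [le_div_iff₀ hδ] at h1
    rw [div_lt_iff₀ hδ] at h2
    rw [abs_le]
    constructor <;> nlinarith
  have hφi : ∀ {y : α → ℝ}, Integrable y μ → Integrable (fun x => φ x * y x) μ :=
    fun hy => hy.bdd_mul hφ.aestronglyMeasurable (.of_forall hM)
  have hnear : ∀ (ψ : SimpleFunc α ℝ) (δ : ℝ), (∀ x, |φ x - ψ x| ≤ δ) → ∀ {y : α → ℝ},
      Integrable y μ → |∫ x, φ x * y x ∂μ - ∫ x, ψ x * y x ∂μ| ≤ δ * ∫ x, |y x| ∂μ := by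
    intro ψ δ hψ y hy
    obtain ⟨R, hR⟩ := ψ.exists_forall_norm_le
    rw [← integral_sub (hφi hy) (hy.bdd_mul ψ.measurable.aestronglyMeasurable (.of_forall hR)),
      ← integral_const_mul]
    refine (abs_integral_le_integral_abs).trans ?_
    refine integral_mono_of_nonneg (.of_forall fun x => abs_nonneg _) (hy.abs.const_mul δ)
      (.of_forall fun x => ?_)
    simp only
    rw [← sub_mul, abs_mul]
    gcongr
    exact hψ x
  set R := (N Set.univ).toReal with hR
  have hfR : ∀ k, ∫ x, |f k x| ∂μ ≤ R := by
    intro k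
    rw [hR, ← ENNReal.ofReal_le_ofReal_iff ENNReal.toReal_nonneg, ENNReal.ofReal_toReal (hNtop _),
      ofReal_integral_eq_lintegral_ofReal (hfi k).abs (.of_forall fun x => abs_nonneg _)]
    have := hle k Set.univ
    rw [Measure.restrict_univ] at this
    refine le_trans (lintegral_mono fun x => ?_) this
    rw [← Real.norm_eq_abs, ofReal_norm]
  obtain ⟨ℓ, hℓ⟩ := hconv (fun k => ∫ x, φ x * f k x ∂μ) (M * R) (by
    intro k
    refine (abs_integral_le_integral_abs).trans ?_
    refine le_trans ?_ (mul_le_mul_of_nonneg_left (hfR k) hM0)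
    rw [← integral_const_mul]
    refine integral_mono_of_nonneg (.of_forall fun x => abs_nonneg _) ((hfi k).abs.const_mul M)
      (.of_forall fun x => ?_)
    simp only
    rw [abs_mul]
    gcongr
    exact hM x)
  suffices ℓ = ∫ x, φ x * g x ∂μ from this ▸ hℓ
  have hI0 : 0 ≤ ∫ x, |g x| ∂μ := integral_nonneg fun x => abs_nonneg _
  have hR0 : 0 ≤ R := ENNReal.toReal_nonneg
  refine eq_of_forall_dist_le fun κ hκ => ?_
  obtain ⟨ψ, hψ⟩ := happrox (κ / (R + ∫ x, |g x| ∂μ + 1)) (by positivity)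
  set δ := κ / (R + ∫ x, |g x| ∂μ + 1) with hδ
  have hδ0 : 0 ≤ δ := by positivity
  have h1 : |ℓ - ∫ x, ψ x * g x ∂μ| ≤ δ * R := by
    refine le_of_tendsto (hℓ.sub (hsimple ψ)).abs (.of_forall fun k => ?_)
    exact (hnear ψ δ hψ (hfi k)).trans (mul_le_mul_of_nonneg_left (hfR k) hδ0)
  have h2 := hnear ψ δ hψ hgi
  have h3 : δ * (R + ∫ x, |g x| ∂μ + 1) = κ := by
    rw [hδ]
    field_simp
  rw [Real.dist_eq]
  rw [abs_le] at h1 h2 ⊢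
  constructor <;> nlinarith

end WeakCompactness

/-- Weak compactness of bounded sequences in `L^p`, `p > 1`, for functions with values in a
finite-dimensional space. -/
lemma exists_tendsto_integral_smul_of_lintegral_rpow_le {α : Type*} [MeasurableSpace α]
    {μ : Measure α} [IsFiniteMeasure μ] {V : Type*} [NormedAddCommGroup V] [NormedSpace ℝ V]
    [FiniteDimensional ℝ V] {ι : Type*} (𝒰 : Ultrafilter ι) {p : ℝ}
    (hp : 1 < p) {f : ι → α → V} (hf : ∀ k, AEStronglyMeasurable (f k) μ) {C : ℝ≥0∞} (hC : C ≠ ⊤)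
    (hfC : ∀ k, ∫⁻ x, ‖f k x‖ₑ ^ p ∂μ ≤ C) :
    ∃ g : α → V, Integrable g μ ∧ ∀ φ : α → ℝ, Measurable φ → (∃ M, ∀ x, |φ x| ≤ M) →
      Tendsto (fun k => ∫ x, φ x • f k x ∂μ) 𝒰 (𝓝 (∫ x, φ x • g x ∂μ)) := by
  have hp0 : 0 < p := by linarith
  have := FiniteDimensional.complete ℝ V
  set B := Module.finBasis ℝ V with hB
  let c : Fin (Module.finrank ℝ V) → V →L[ℝ] ℝ := fun i => LinearMap.toContinuousLinearMap (B.coord i)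
  have hrepr : ∀ y : V, y = ∑ i, c i y • B i := fun y => by
    conv_lhs => rw [← B.sum_repr y]
    rfl
  have hci : ∀ i, ∃ g : α → ℝ, Integrable g μ ∧ ∀ φ : α → ℝ, Measurable φ →
      (∃ M, ∀ x, |φ x| ≤ M) →
      Tendsto (fun k => ∫ x, φ x * c i (f k x) ∂μ) 𝒰 (𝓝 (∫ x, φ x * g x ∂μ)) := by
    intro i
    refine exists_tendsto_integral_mul_of_lintegral_rpow_le 𝒰 hp
      (fun k => (c i).continuous.comp_aestronglyMeasurable (hf k))
      (C := ‖c i‖ₑ ^ p * C) (ENNReal.mul_ne_top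
        (ENNReal.rpow_ne_top_of_nonneg hp0.le enorm_ne_top) hC) fun k => ?_
    calc ∫⁻ x, ‖c i (f k x)‖ₑ ^ p ∂μ ≤ ∫⁻ x, ‖c i‖ₑ ^ p * ‖f k x‖ₑ ^ p ∂μ := by
          refine lintegral_mono fun x => ?_
          rw [← ENNReal.mul_rpow_of_nonneg _ _ hp0.le]
          gcongr
          exact (c i).le_opENorm _
      _ = ‖c i‖ₑ ^ p * ∫⁻ x, ‖f k x‖ₑ ^ p ∂μ :=
          lintegral_const_mul' _ _ (ENNReal.rpow_ne_top_of_nonneg hp0.le enorm_ne_top)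
      _ ≤ _ := by gcongr; exact hfC k
  choose g hgi hg using hci
  have hfi : ∀ k, Integrable (f k) μ := by
    intro k
    have h1 : MemLp (f k) (ENNReal.ofReal p) μ := by
      refine ⟨hf k, ?_⟩
      rw [eLpNorm_lt_top_iff_lintegral_rpow_enorm_lt_top (by simpa using hp0)
        ENNReal.ofReal_ne_top, ENNReal.toReal_ofReal hp0.le]
      exact (hfC k).trans_lt hC.lt_top
    exact h1.integrable (by simpa using ENNReal.ofReal_le_ofReal hp.le)
  refine ⟨fun x => ∑ i, g i x • B i, integrable_finsetSum _ fun i _ => (hgi i).smul_const _,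
    fun φ hφ hM => ?_⟩
  have hM' := hM
  obtain ⟨M, hM⟩ := hM
  have hint : ∀ {y : α → ℝ}, Integrable y μ → Integrable (fun x => φ x * y x) μ :=
    fun hy => hy.bdd_mul hφ.aestronglyMeasurable (.of_forall hM)
  have key : ∀ y : Fin (Module.finrank ℝ V) → α → ℝ, (∀ i, Integrable (y i) μ) →
      ∫ x, φ x • ∑ i, y i x • B i ∂μ = ∑ i, (∫ x, φ x * y i x ∂μ) • B i := by
    intro y hy
    simp only [Finset.smul_sum, smul_smul]
    rw [integral_finsetSum _ fun i _ => (hint (hy i)).smul_const _]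
    simp only [integral_smul_const]
  rw [key g hgi]
  have h2 : ∀ k, ∫ x, φ x • f k x ∂μ = ∑ i, (∫ x, φ x * c i (f k x) ∂μ) • B i := by
    intro k
    rw [← key (fun i x => c i (f k x)) fun i => (c i).integrable_comp (hfi k)]
    congr 1 with x
    rw [← hrepr]
  simp only [h2]
  exact tendsto_finsetSum _ fun i _ => (hg i φ hφ hM').smul_const _

/-! ### Weak gradients and mollification -/

section Gradient

variable {E F : Type*} [NormedAddCommGroup E] [NormedSpace ℝ E] [FiniteDimensional ℝ E]
  [MeasureSpace E] [BorelSpace E] [(volume : Measure E).IsAddHaarMeasure]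
  [NormedAddCommGroup F] [NormedSpace ℝ F] [FiniteDimensional ℝ F] [CompleteSpace F]

/-- `D` is the weak gradient of `u` on `A`, for functions between general finite-dimensional spaces;
on Euclidean spaces this is `IsWeakGradient` by definition. -/
def HasWeakGradient (A : Set E) (u : E → F) (D : E → E →L[ℝ] F) : Prop :=
  ∀ ψ : E → ℝ, ContDiff ℝ ∞ ψ → HasCompactSupport ψ → tsupport ψ ⊆ A →
      ∀ v : E, ∫ y in A, (fderiv ℝ ψ y v) • u y = - ∫ y in A, ψ y • D y v

/-- Mollification commutes with the weak gradient away from the boundary. -/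
lemma IsMollifier.fderiv_mollify_eq {ρ : E → ℝ} (hρ : IsMollifier ρ)
    {A : Set E} (hA : MeasurableSet A) {u : E → F} {D : E → E →L[ℝ] F}
    (hD : HasWeakGradient A u D) (hu : IntegrableOn u A) (hDi : IntegrableOn D A)
    {x : E} (hx : ∀ y, x - y ∈ tsupport ρ → y ∈ A) :
    fderiv ℝ (mollify ρ (A.indicator u)) x = mollify ρ (A.indicator D) x := by
  have h := hρ.fderiv_mollify_of_integral_fderiv_smul hA hD (φ := fun _ => 1) contDiff_const
    (by simpa using hu.locallyIntegrable_indicator hA)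
    (by simpa using hDi.locallyIntegrable_indicator hA)
    (by
      have h0 : (A.indicator fun y => (fderiv ℝ (fun _ : E => (1 : ℝ)) y).smulRight (u y)) =
          (0 : E → E →L[ℝ] F) := by
        ext y v
        by_cases hy : y ∈ A <;> simp [hy]
      rw [h0]
      exact continuous_zero.locallyIntegrable)
    (fun y _ => hx y)
  have h1 : (fun y => (1 : ℝ) • D y + (fderiv ℝ (fun _ : E => (1 : ℝ)) y).smulRight (u y)) = D := by
    ext y v
    simp
  have h2 : (fun y => (1 : ℝ) • u y) = u := by ext; simp
  rwa [h1, h2] at h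

/-- The gradients of the standard mollifications of `u`, restricted to the part of `A` where they
only depend on values of `u` in `A`. -/
noncomputable def mollifiedGradient (A : Set E) (u : E → F) (n : ℕ) : E → E →L[ℝ] F :=
  (innerPart A (2 * (1 / (n + 1)))).indicator
    (fderiv ℝ (mollify (stdMollifier n) (A.indicator u)))

lemma eventually_mem_innerPart {A K : Set E} (hA : IsOpen A) (hK : IsCompact K) (hKA : K ⊆ A) :
    ∀ᶠ n : ℕ in atTop, K ⊆ innerPart A (2 * (1 / ((n : ℝ) + 1))) := by
  obtain ⟨r, hr, hKr⟩ := exists_subset_innerPart hA hK hKA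
  have h1 : Tendsto (fun n : ℕ => 2 * (1 / ((n : ℝ) + 1))) atTop (𝓝 (2 * 0)) :=
    tendsto_one_div_add_atTop_nhds_zero_nat.const_mul 2
  rw [mul_zero] at h1
  filter_upwards [h1.eventually_le_const hr] with n hn
  exact hKr.trans fun x hx => (ENNReal.ofReal_le_ofReal hn).trans_lt hx

/-- The mollified gradients converge to any integrable weak gradient almost everywhere. -/
lemma ae_tendsto_mollifiedGradient {A : Set E} (hA : IsOpen A) {u : E → F} {D : E → E →L[ℝ] F}
    (hD : HasWeakGradient A u D) (hu : IntegrableOn u A) (hDi : IntegrableOn D A) :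
    ∀ᵐ x ∂(volume.restrict A), Tendsto (fun n => mollifiedGradient A u n x) atTop (𝓝 (D x)) := by
  have := FiniteDimensional.complete ℝ (E →L[ℝ] F)
  have h1 := ae_tendsto_mollify_stdMollifier
    (hDi.locallyIntegrable_indicator hA.measurableSet)
  rw [ae_restrict_iff' hA.measurableSet]
  filter_upwards [h1] with x hx hxA
  rw [Set.indicator_of_mem hxA] at hx
  refine hx.congr' ?_
  filter_upwards [eventually_mem_innerPart hA isCompact_singleton
    (Set.singleton_subset_iff.2 hxA)] with n hn
  have hxn : x ∈ innerPart A (2 * (1 / ((n : ℝ) + 1))) := hn rfl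
  rw [mollifiedGradient, Set.indicator_of_mem hxn]
  refine ((isMollifier_stdMollifier n).fderiv_mollify_eq hA.measurableSet hD hu hDi ?_).symm
  intro y hy
  rw [tsupport_stdMollifier, Metric.mem_closedBall, dist_zero_right] at hy
  refine mem_of_mem_innerPart hxn ?_
  rw [norm_sub_rev]
  refine hy.trans ?_
  have : (0 : ℝ) < 1 / ((n : ℝ) + 1) := by positivity
  linarith

lemma measurable_mollifiedGradient (A : Set E) {u : E → F} (hu : LocallyIntegrable (A.indicator u))
    (n : ℕ) : Measurable (mollifiedGradient A u n) := by
  refine Measurable.indicator ?_ (isOpen_innerPart _ _).measurableSet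
  exact (((isMollifier_stdMollifier n).contDiff_mollify hu).continuous_fderiv (by simp)).measurable

/-- If the mollified gradients are bounded in `L^p(A)`, `p > 1`, then `u` has a weak gradient. -/
lemma exists_hasWeakGradient_of_lintegral_le {p : ℝ} (hp : 1 < p) {A : Set E} (hA : IsOpen A)
    (hAb : Bornology.IsBounded A) {u : E → F} (hu : IntegrableOn u A) {C : ℝ≥0∞} (hC : C ≠ ⊤)
    (hb : ∀ n, ∫⁻ x in A, ‖mollifiedGradient A u n x‖ₑ ^ p ≤ C) :
    ∃ D : E → E →L[ℝ] F, MemLp D (ENNReal.ofReal p) (volume.restrict A) ∧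
      HasWeakGradient A u D := by
  have hp0 : 0 < p := by linarith
  have := FiniteDimensional.proper ℝ E
  have hfin : IsFiniteMeasure (volume.restrict A) := ⟨by simpa using hAb.measure_lt_top⟩
  have hUi := hu.integrable_indicator hA.measurableSet
  have hmeas := measurable_mollifiedGradient A hUi.locallyIntegrable
  obtain ⟨D, hDi, hD⟩ := exists_tendsto_integral_smul_of_lintegral_rpow_le
    (hyperfilter ℕ) hp (fun n => (hmeas n).aestronglyMeasurable) hC hb
  have hgrad : HasWeakGradient A u D := by
    intro ψ hψ hψc hψA v
    have hψ' : ContDiff ℝ 1 ψ := hψ.of_le (by exact_mod_cast le_top)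
    have hdc : Continuous fun x => fderiv ℝ ψ x v :=
      (hψ'.continuous_fderiv one_ne_zero).clm_apply continuous_const
    have hds : HasCompactSupport fun x => fderiv ℝ ψ x v := hψc.fderiv_apply ℝ v
    set w : ℕ → E → F := fun n => mollify (stdMollifier n) (A.indicator u) with hw
    have hwd : ∀ n, ContDiff ℝ 1 (w n) := fun n =>
      ((isMollifier_stdMollifier n).contDiff_mollify hUi.locallyIntegrable).of_le
        (by exact_mod_cast le_top)
    have hLint : ∀ f : E → E →L[ℝ] F, IntegrableOn f A →
        Integrable (fun x => ψ x • f x) (volume.restrict A) := by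
      intro f hf
      obtain ⟨M, hM⟩ := hψ.continuous.bounded_above_of_compact_support hψc
      exact hf.bdd_smul M hψ.continuous.aestronglyMeasurable (.of_forall hM)
    have hfint : ∀ n, IntegrableOn (mollifiedGradient A u n) A := by
      intro n
      have hmem : MemLp (mollifiedGradient A u n) (ENNReal.ofReal p) (volume.restrict A) := by
        refine ⟨(hmeas n).aestronglyMeasurable, ?_⟩
        rw [eLpNorm_lt_top_iff_lintegral_rpow_enorm_lt_top (by simpa using hp0)
          ENNReal.ofReal_ne_top, ENNReal.toReal_ofReal hp0.le]
        exact (hb n).trans_lt hC.lt_top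
      exact hmem.integrable (by simpa using ENNReal.ofReal_le_ofReal hp.le)
    have happly : ∀ f : E → E →L[ℝ] F, IntegrableOn f A →
        (∫ x in A, ψ x • f x) v = ∫ x in A, ψ x • f x v := fun f hf => by
      rw [ContinuousLinearMap.integral_apply (hLint f hf)]
      rfl
    have h1 : Tendsto (fun n => ∫ x in A, ψ x • mollifiedGradient A u n x v) (hyperfilter ℕ)
        (𝓝 (∫ x in A, ψ x • D x v)) := by
      have h2 := ((ContinuousLinearMap.apply ℝ F v).continuous.tendsto _).comp
        (hD ψ hψ.continuous.measurable (hψ.continuous.bounded_above_of_compact_support hψc))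
      simp only [Function.comp_def, ContinuousLinearMap.apply_apply] at h2
      rw [happly D hDi] at h2
      refine h2.congr fun n => happly _ (hfint n)
    have hat : (hyperfilter ℕ : Filter ℕ) ≤ atTop := by
      rw [← Nat.cofinite_eq_atTop]
      exact hyperfilter_le_cofinite
    -- for large `n` the support of `ψ` lies in the inner part of `A`, so that one can integrate by
    -- parts on the whole space
    have h2 : ∀ᶠ n in atTop, ∫ x in A, ψ x • mollifiedGradient A u n x v =
        - ∫ x, fderiv ℝ ψ x v • w n x := by
      filter_upwards [eventually_mem_innerPart hA hψc.isCompact hψA] with n hn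
      have hdw : Continuous fun x => fderiv ℝ (w n) x v :=
        ((hwd n).continuous_fderiv one_ne_zero).clm_apply continuous_const
      rw [← integral_smul_fderiv_eq_neg_fderiv_smul_of_integrable (μ := volume)]
      · rw [setIntegral_eq_integral_of_forall_compl_eq_zero fun x hx => by
          rw [image_eq_zero_of_notMem_tsupport fun h => hx (hψA h), zero_smul]]
        congr 1 with x
        by_cases hx : x ∈ tsupport ψ
        · rw [mollifiedGradient, Set.indicator_of_mem (hn hx)]
        · rw [image_eq_zero_of_notMem_tsupport hx, zero_smul, zero_smul]
      · exact (hdc.smul (hwd n).continuous).integrable_of_hasCompactSupport hds.smul_right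
      · exact (hψ.continuous.smul hdw).integrable_of_hasCompactSupport hψc.smul_right
      · exact (hψ.continuous.smul (hwd n).continuous).integrable_of_hasCompactSupport
          hψc.smul_right
      · exact fun x _ => hψ'.differentiable one_ne_zero x
      · exact fun x _ => (hwd n).differentiable one_ne_zero x
    have h3 : Tendsto (fun n => ∫ x, fderiv ℝ ψ x v • w n x) atTop
        (𝓝 (∫ x, fderiv ℝ ψ x v • A.indicator u x)) := by
      obtain ⟨M, hM⟩ := hdc.bounded_above_of_compact_support hds
      refine tendsto_integral_of_L1 _ ?_ (.of_forall fun n =>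
        (hdc.smul (hwd n).continuous).integrable_of_hasCompactSupport hds.smul_right) ?_
      · exact (hUi.bdd_smul M hdc.aestronglyMeasurable (.of_forall hM)).aestronglyMeasurable
      have h4 : Tendsto (fun n => ∫⁻ x, ‖w n x - A.indicator u x‖ₑ) atTop (𝓝 0) := by
        refine ENNReal.tendsto_nhds_zero.2 fun δ hδ => ?_
        obtain ⟨η, hη, hηb⟩ := exists_lintegral_mollify_sub_le le_rfl
          (f := A.indicator u) (by simpa using memLp_one_iff_integrable.2 hUi) hδ
        filter_upwards [tendsto_one_div_add_atTop_nhds_zero_nat.eventually_le_const hη] with n hn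
        have h5 := hηb _ (isMollifier_stdMollifier n) ((subset_tsupport _).trans (by
          rw [tsupport_stdMollifier]
          exact Metric.closedBall_subset_closedBall hn))
        simpa using h5
      have h6 := ENNReal.Tendsto.const_mul (a := ENNReal.ofReal M) h4 (Or.inr ENNReal.ofReal_ne_top)
      rw [mul_zero] at h6
      refine tendsto_of_tendsto_of_tendsto_of_le_of_le tendsto_const_nhds h6
        (fun _ => zero_le) fun n => ?_
      simp only
      rw [← lintegral_const_mul' _ _ ENNReal.ofReal_ne_top]
      refine lintegral_mono fun x => ?_
      simp only
      rw [← smul_sub, enorm_smul]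
      gcongr
      rw [← ofReal_norm]
      exact ENNReal.ofReal_le_ofReal (hM x)
    have h7 : ∫ x, fderiv ℝ ψ x v • A.indicator u x = ∫ x in A, fderiv ℝ ψ x v • u x := by
      rw [← integral_indicator hA.measurableSet]
      congr 1 with x
      by_cases hx : x ∈ A <;> simp [hx]
    rw [h7] at h3
    have h8 := tendsto_nhds_unique h1 ((h3.neg.congr' (h2.mono fun n hn => hn.symm)).mono_left hat)
    rw [h8, neg_neg]
  refine ⟨D, ⟨hDi.aestronglyMeasurable, ?_⟩, hgrad⟩
  rw [eLpNorm_lt_top_iff_lintegral_rpow_enorm_lt_top (by simpa using hp0)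
    ENNReal.ofReal_ne_top, ENNReal.toReal_ofReal hp0.le]
  refine lt_of_le_of_lt ?_ hC.lt_top
  calc ∫⁻ x in A, ‖D x‖ₑ ^ p
      = ∫⁻ x in A, liminf (fun n => ‖mollifiedGradient A u n x‖ₑ ^ p) atTop := by
        refine lintegral_congr_ae ?_
        filter_upwards [ae_tendsto_mollifiedGradient hA hgrad hu hDi] with x hx
        exact (((ENNReal.continuous_rpow_const.comp continuous_enorm).tendsto _).comp
          hx).liminf_eq.symm
    _ ≤ liminf (fun n => ∫⁻ x in A, ‖mollifiedGradient A u n x‖ₑ ^ p) atTop :=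
        lintegral_liminf_le fun n => (hmeas n).enorm.pow_const p
    _ ≤ liminf (fun _ : ℕ => C) atTop := liminf_le_liminf (.of_forall hb)
    _ = C := by simp

end Gradient

/-! ### The liminf inequality -/

lemma memW1p_iff_hasWeakGradient {d m : ℕ} {p : ℝ} {A : Set (EuclideanSpace ℝ (Fin d))}
    {u : EuclideanSpace ℝ (Fin d) → EuclideanSpace ℝ (Fin m)} :
    MemW1p p A u ↔ MemLp u (ENNReal.ofReal p) (volume.restrict A) ∧
      ∃ D, MemLp D (ENNReal.ofReal p) (volume.restrict A) ∧ HasWeakGradient A u D := Iff.rfl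

lemma MemW1p.weakGradient_spec {d m : ℕ} {p : ℝ} {A : Set (EuclideanSpace ℝ (Fin d))}
    {u : EuclideanSpace ℝ (Fin d) → EuclideanSpace ℝ (Fin m)} (h : MemW1p p A u) :
    MemLp (weakGradient p A u) (ENNReal.ofReal p) (volume.restrict A) ∧
      HasWeakGradient A u (weakGradient p A u) := by
  rw [weakGradient, dif_pos h]
  exact h.2.choose_spec

lemma const_mul_liminf_le {c : ℝ≥0∞} (hc : c ≠ ⊤) (f : ℕ → ℝ≥0∞) :
    c * liminf f atTop ≤ liminf (fun n => c * f n) atTop := by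
  have hmono : Monotone fun t => c * t := fun s t hst => mul_le_mul_right hst _
  exact (hmono.map_liminf_of_continuousAt f (ENNReal.continuous_const_mul hc).continuousAt).le

/-- Fatou's lemma for iterated integrals with a weight. -/
lemma lintegral_mul_lintegral_le_of_tendsto {α β : Type*} [MeasurableSpace α] [MeasurableSpace β]
    {μ : Measure α} [SFinite μ] {ν : Measure β} {c : β → ℝ≥0∞} (hc : AEMeasurable c ν)
    (hc' : ∀ y, c y ≠ ⊤) {f : ℕ → α → β → ℝ≥0∞} (hf : ∀ n, Measurable fun q : α × β => f n q.1 q.2)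
    {g : α → β → ℝ≥0∞} (hfg : ∀ᵐ x ∂μ, ∀ y, Tendsto (fun n => f n x y) atTop (𝓝 (g x y)))
    {L : ℝ≥0∞} (hb : ∀ n, ∫⁻ y, c y * ∫⁻ x, f n x y ∂μ ∂ν ≤ L) :
    ∫⁻ y, c y * ∫⁻ x, g x y ∂μ ∂ν ≤ L := by
  calc ∫⁻ y, c y * ∫⁻ x, g x y ∂μ ∂ν
      ≤ ∫⁻ y, liminf (fun n => c y * ∫⁻ x, f n x y ∂μ) atTop ∂ν := by
        refine lintegral_mono fun y => ?_
        have h1 : ∫⁻ x, g x y ∂μ ≤ liminf (fun n => ∫⁻ x, f n x y ∂μ) atTop := by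
          have h2 : ∫⁻ x, g x y ∂μ = ∫⁻ x, liminf (fun n => f n x y) atTop ∂μ := by
            refine lintegral_congr_ae ?_
            filter_upwards [hfg] with x hx using (hx y).liminf_eq.symm
          rw [h2]
          exact lintegral_liminf_le fun n => (hf n).comp measurable_prodMk_right
        exact (mul_le_mul_right h1 _).trans (const_mul_liminf_le (hc' y) _)
    _ ≤ liminf (fun n => ∫⁻ y, c y * ∫⁻ x, f n x y ∂μ ∂ν) atTop :=
        lintegral_liminf_le' fun n => hc.mul (Measurable.lintegral_prod_left' (hf n)).aemeasurable
    _ ≤ liminf (fun _ : ℕ => L) atTop := liminf_le_liminf (.of_forall hb)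
    _ = L := by simp

section GradientBounds

variable {E F : Type*} [NormedAddCommGroup E] [NormedSpace ℝ E] [FiniteDimensional ℝ E]
  [MeasureSpace E] [BorelSpace E] [(volume : Measure E).IsAddHaarMeasure]
  [NormedAddCommGroup F] [NormedSpace ℝ F] [FiniteDimensional ℝ F] [CompleteSpace F]

lemma measurable_enorm_apply_rpow {G : E → E →L[ℝ] F} (hG : Measurable G) (p : ℝ) :
    Measurable fun q : E × E => ‖G q.1 q.2‖ₑ ^ p := by
  refine Measurable.pow_const ?_ p
  have h1 : Continuous fun z : (E →L[ℝ] F) × E => z.1 z.2 :=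
    continuous_fst.clm_apply continuous_snd
  exact h1.enorm.measurable.comp ((hG.comp measurable_fst).prodMk measurable_snd)

lemma lintegral_mollifiedGradient_apply (A : Set E) (hA : MeasurableSet A) (u : E → F) (n : ℕ)
    {p : ℝ} (hp : 0 < p) (ξ : E) :
    ∫⁻ x in A, ‖mollifiedGradient A u n x ξ‖ₑ ^ p =
      ∫⁻ x in innerPart A (2 * (1 / ((n : ℝ) + 1))),
        ‖fderiv ℝ (mollify (stdMollifier n) (A.indicator u)) x ξ‖ₑ ^ p := by
  have hsub : innerPart A (2 * (1 / ((n : ℝ) + 1))) ⊆ A := innerPart_subset (by positivity)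
  rw [← lintegral_indicator hA, ← lintegral_indicator (isOpen_innerPart _ _).measurableSet]
  refine lintegral_congr fun x => ?_
  by_cases hx : x ∈ innerPart A (2 * (1 / ((n : ℝ) + 1)))
  · rw [Set.indicator_of_mem (hsub hx), Set.indicator_of_mem hx, mollifiedGradient,
      Set.indicator_of_mem hx]
  · rw [Set.indicator_of_notMem hx, mollifiedGradient]
    by_cases hxA : x ∈ A
    · rw [Set.indicator_of_mem hxA, Set.indicator_of_notMem hx]
      simp [hp]
    · rw [Set.indicator_of_notMem hxA]

/-- A bound for the energies of the mollified gradients passes to the weak gradient, by Fatou's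
lemma. -/
lemma lintegral_weakGradient_le {p : ℝ} {A : Set E} (hA : IsOpen A)
    {u : E → F} {D : E → E →L[ℝ] F} (hD : HasWeakGradient A u D) (hu : IntegrableOn u A)
    (hDi : IntegrableOn D A) {a : E → ℝ} (ha : AEMeasurable fun ξ => ENNReal.ofReal (a ξ))
    {L : ℝ≥0∞} (hb : ∀ n, ∫⁻ ξ, ENNReal.ofReal (a ξ) *
      ∫⁻ x in A, ‖mollifiedGradient A u n x ξ‖ₑ ^ p ≤ L) :
    ∫⁻ ξ, ENNReal.ofReal (a ξ) * ∫⁻ x in A, ‖D x ξ‖ₑ ^ p ≤ L := by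
  have hmeas := measurable_mollifiedGradient A (hu.locallyIntegrable_indicator hA.measurableSet)
  refine lintegral_mul_lintegral_le_of_tendsto (f := fun n x ξ => ‖mollifiedGradient A u n x ξ‖ₑ ^ p)
    (g := fun x ξ => ‖D x ξ‖ₑ ^ p) ha (fun _ => ENNReal.ofReal_ne_top)
    (fun n => measurable_enorm_apply_rpow (hmeas n) p) ?_ hb
  filter_upwards [ae_tendsto_mollifiedGradient hA hD hu hDi] with x hx ξ
  exact ((ENNReal.continuous_rpow_const.comp continuous_enorm).tendsto _).comp
    (((ContinuousLinearMap.apply ℝ F ξ).continuous.tendsto _).comp hx)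

/-- A bound for the energies of the mollified gradients bounds them in `L^p`. -/
lemma exists_lintegral_mollifiedGradient_le {p : ℝ} (hp : 0 < p) {A : Set E} (hA : IsOpen A)
    {u : E → F} (hu : IntegrableOn u A) {a : E → ℝ} (ha : AEMeasurable a)
    (h0 : ∀ᵐ ξ, 0 ≤ a ξ) (hne : ¬ a =ᵐ[volume] 0)
    {L : ℝ≥0∞} (hL : L ≠ ⊤) (hb : ∀ n, ∫⁻ ξ, ENNReal.ofReal (a ξ) *
      ∫⁻ x in A, ‖mollifiedGradient A u n x ξ‖ₑ ^ p ≤ L) :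
    ∃ C : ℝ≥0∞, C ≠ ⊤ ∧ ∀ n, ∫⁻ x in A, ‖mollifiedGradient A u n x‖ₑ ^ p ≤ C := by
  obtain ⟨c, hc, hcM⟩ := exists_mul_enorm_rpow_le_lintegral (F := F) hp ha h0 hne
  have hmeas := measurable_mollifiedGradient A (hu.locallyIntegrable_indicator hA.measurableSet)
  refine ⟨L / c, ENNReal.div_ne_top hL hc, fun n => ?_⟩
  rw [ENNReal.le_div_iff_mul_le (Or.inl hc) (Or.inr hL), mul_comm]
  rw [← lintegral_const_mul _ ((hmeas n).enorm.pow_const p)]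
  calc ∫⁻ x in A, c * ‖mollifiedGradient A u n x‖ₑ ^ p
      ≤ ∫⁻ x in A, ∫⁻ ξ, ENNReal.ofReal (a ξ) * ‖mollifiedGradient A u n x ξ‖ₑ ^ p :=
        lintegral_mono fun x => hcM _
    _ = ∫⁻ ξ, ∫⁻ x in A, ENNReal.ofReal (a ξ) * ‖mollifiedGradient A u n x ξ‖ₑ ^ p := by
        rw [lintegral_lintegral_swap]
        exact (ha.ennreal_ofReal.comp_snd).mul
          (measurable_enorm_apply_rpow (hmeas n) p).aemeasurable
    _ = ∫⁻ ξ, ENNReal.ofReal (a ξ) * ∫⁻ x in A, ‖mollifiedGradient A u n x ξ‖ₑ ^ p := by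
        refine lintegral_congr fun ξ => ?_
        rw [lintegral_const_mul' _ _ ENNReal.ofReal_ne_top]
    _ ≤ L := hb n

end GradientBounds

/-- The liminf inequality, which includes that `u` is a Sobolev function if the liminf is finite. -/
theorem KernelSequence.limitFunctional_le_liminf {d m : ℕ} {p : ℝ}
    {b : ℕ → EuclideanSpace ℝ (Fin d) → ℝ} {a : EuclideanSpace ℝ (Fin d) → ℝ}
    (h : KernelSequence p b a) (hp : 1 < p) (hne : ¬ a =ᵐ[volume] 0) {e : ℕ → ℝ}
    (he : ∀ j, 0 < e j) (he0 : Tendsto e atTop (𝓝 0)) {A : Set (EuclideanSpace ℝ (Fin d))}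
    (hA : IsOpen A) (hAb : Bornology.IsBounded A)
    {v : ℕ → EuclideanSpace ℝ (Fin d) → EuclideanSpace ℝ (Fin m)}
    {u : EuclideanSpace ℝ (Fin d) → EuclideanSpace ℝ (Fin m)}
    (hv : ∀ j, IntegrableOn (v j) A) (hu : MemLp u (ENNReal.ofReal p) (volume.restrict A))
    (hvu : Tendsto (fun j => ∫⁻ x in A, ‖v j x - u x‖ₑ) atTop (𝓝 0)) :
    limitFunctional p a A u ≤ liminf (fun j => convFunctional p (e j) (b j) A (v j)) atTop := by
  have hp0 : 0 < p := by linarith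
  have hp1 : 1 ≤ ENNReal.ofReal p := by simpa using ENNReal.ofReal_le_ofReal hp.le
  have hfin : IsFiniteMeasure (volume.restrict A) := ⟨by simpa using hAb.measure_lt_top⟩
  have hui : IntegrableOn u A := hu.integrable hp1
  set L := liminf (fun j => convFunctional p (e j) (b j) A (v j)) atTop with hLdef
  rcases eq_or_ne L ⊤ with hL | hL
  · rw [hL]
    exact le_top
  have hb : ∀ n, ∫⁻ ξ, ENNReal.ofReal (a ξ) *
      ∫⁻ x in A, ‖mollifiedGradient A u n x ξ‖ₑ ^ p ≤ L := by
    intro n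
    simp_rw [lintegral_mollifiedGradient_apply A hA.measurableSet u n hp0]
    refine h.lintegral_fderiv_mollify_le_liminf hp.le he he0 hA hAb hv hui hvu
      (isMollifier_stdMollifier n) (by positivity) ?_
    exact (subset_tsupport _).trans (tsupport_stdMollifier n).subset
  obtain ⟨C, hC, hCb⟩ := exists_lintegral_mollifiedGradient_le hp0 hA hui
    h.integrable_limit.aestronglyMeasurable.aemeasurable h.ae_nonneg hne hL hb
  have hmem : MemW1p p A u := memW1p_iff_hasWeakGradient.2
    ⟨hu, exists_hasWeakGradient_of_lintegral_le hp hA hAb hui hC hCb⟩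
  rw [limitFunctional, if_pos hmem]
  obtain ⟨hD, hDw⟩ := hmem.weakGradient_spec
  exact lintegral_weakGradient_le hA hDw hui (hD.integrable hp1) h.aemeasurable_limit hb

/-! ### Smooth approximation up to a Lipschitz boundary -/

/-- Near each point of its closure, `A` is mapped into itself by arbitrarily small translations,
together with all still smaller perturbations of them. For a set with Lipschitz boundary the
translations go in the vertical direction of the local graph. -/
def HasInwardShifts {E : Type*} [NormedAddCommGroup E] (A : Set E) : Prop :=
  ∀ x₀ ∈ closure A, ∃ R : ℝ, 0 < R ∧ ∀ η : ℝ, 0 < η → ∃ (z : E) (s : ℝ), 0 < s ∧ ‖z‖ + s ≤ η ∧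
    ∀ x ∈ A, ∀ y ∈ Metric.closedBall x₀ R, ‖x + z - y‖ ≤ s → y ∈ A

lemma HasLipschitzBoundary.hasInwardShifts {d : ℕ} {A : Set (EuclideanSpace ℝ (Fin d))}
    (hA : IsOpen A) (h : HasLipschitzBoundary A) : HasInwardShifts A := by
  intro x₀ hx₀
  by_cases hxA : x₀ ∈ A
  · obtain ⟨R, hR, hRA⟩ := Metric.nhds_basis_closedBall.mem_iff.1 (hA.mem_nhds hxA)
    exact ⟨R, hR, fun η hη => ⟨0, η, hη, by simp, fun x _ y hy _ => hRA hy⟩⟩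
  obtain ⟨ν, r, K, γ, hν, hr, hγ, hAr⟩ := h x₀ ⟨hx₀, by rwa [hA.interior_eq]⟩
  refine ⟨r / 2, half_pos hr, fun η hη => ?_⟩
  -- a vertical shift by `t` beats perturbations of size `t / (K + 1)`
  have hK : (0 : ℝ) < K + 1 := by positivity
  set t := min η (r / 2) / 2 with ht
  have ht0 : 0 < t := by positivity
  have htη : t ≤ η / 2 := by rw [ht]; gcongr; exact min_le_left _ _
  have htr : t ≤ r / 2 / 2 := by rw [ht]; gcongr; exact min_le_right _ _
  set s := t / (K + 1) / 2 with hs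
  have hs0 : 0 < s := by positivity
  have hst : (K + 1) * s = t / 2 := by rw [hs]; field_simp
  have hst' : s ≤ t / 2 := by
    have : (0 : ℝ) ≤ K * s := by positivity
    linarith
  refine ⟨t • ν, s, hs0, ?_, fun x hx y hy hxy => ?_⟩
  · rw [norm_smul, hν, Real.norm_of_nonneg ht0.le]
    linarith
  have hyr : y ∈ Metric.ball x₀ r := by
    rw [Metric.mem_closedBall] at hy
    rw [Metric.mem_ball]
    linarith
  have hxr : x ∈ Metric.ball x₀ r := by
    rw [Metric.mem_closedBall] at hy
    rw [Metric.mem_ball]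
    have h1 : dist x y ≤ t + s := by
      rw [dist_eq_norm, show x - y = (x + t • ν - y) - t • ν by abel]
      refine (norm_sub_le _ _).trans ?_
      rw [norm_smul, hν, Real.norm_of_nonneg ht0.le]
      linarith
    linarith [dist_triangle x y x₀]
  have hx' : x ∈ A ∩ Metric.ball x₀ r := ⟨hx, hxr⟩
  rw [hAr] at hx'
  suffices hy' : y ∈ A ∩ Metric.ball x₀ r from hy'.1
  rw [hAr]
  refine ⟨hyr, ?_⟩
  have hx2 := hx'.2
  set P := (Submodule.span ℝ {ν})ᗮ.orthogonalProjectionOnto with hP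
  have hPν : P ν = 0 := by
    rw [hP, Submodule.orthogonalProjectionOnto_eq_zero_iff]
    exact Submodule.le_orthogonal_orthogonal _ (Submodule.mem_span_singleton_self ν)
  set w := x + t • ν - y with hw
  have hy2 : y = x + t • ν - w := by rw [hw]; abel
  have hPy : P y = P x - P w := by
    rw [hy2, map_sub, map_add, map_smul, hPν, smul_zero, add_zero]
  have hγy : γ (P y) ≤ γ (P x) + K * s := by
    have h1 := hγ.dist_le_mul (P y) (P x)
    rw [Real.dist_eq, dist_eq_norm, hPy, sub_sub_cancel_left, norm_neg] at h1
    have h2 : ‖P w‖ ≤ s := (Submodule.norm_orthogonalProjectionOnto_apply_le _ w).trans hxy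
    have h3 : (K : ℝ) * ‖P w‖ ≤ K * s := by gcongr
    rw [← hPy] at h1
    linarith [le_abs_self (γ (P y) - γ (P x))]
  have hiw : inner ℝ ν w ≤ s := by
    refine (real_inner_le_norm ν w).trans ?_
    rw [hν, one_mul]
    exact hxy
  have hiy : inner ℝ ν y = inner ℝ ν x + t - inner ℝ ν w := by
    rw [hy2, inner_sub_right, inner_add_right, inner_smul_right, real_inner_self_eq_norm_sq, hν]
    ring
  rw [hiy]
  nlinarith

section Approximation

variable {E F : Type*} [NormedAddCommGroup E] [NormedSpace ℝ E] [FiniteDimensional ℝ E]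
  [MeasureSpace E] [BorelSpace E] [(volume : Measure E).IsAddHaarMeasure]
  [NormedAddCommGroup F] [NormedSpace ℝ F] [FiniteDimensional ℝ F] [CompleteSpace F]

lemma exists_isMollifier_tsupport_subset (c : E) {s : ℝ} (hs : 0 < s) :
    ∃ ρ : E → ℝ, IsMollifier ρ ∧ tsupport ρ ⊆ Metric.closedBall c s := by
  let f : ContDiffBump c := ⟨s / 2, s, half_pos hs, half_lt_self hs⟩
  exact ⟨f.normed volume, ⟨f.contDiff_normed, f.hasCompactSupport_normed, f.nonneg_normed,
    f.integral_normed⟩, f.tsupport_normed_eq.subset⟩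

/-- A finite smooth partition of unity on a compact set, subordinate to balls. -/
lemma exists_finite_smooth_partition {K : Set E} (hK : IsCompact K) (R : E → ℝ)
    (hR : ∀ x ∈ K, 0 < R x) :
    ∃ (t : Finset E) (f : t → E → ℝ), (∀ i : t, (i : E) ∈ K) ∧ (∀ i, ContDiff ℝ ∞ (f i)) ∧
      (∀ i : t, tsupport (f i) ⊆ Metric.ball (i : E) (R i)) ∧ ∀ x ∈ K, ∑ i, f i x = 1 := by
  have := FiniteDimensional.proper ℝ E
  obtain ⟨t, htK, htc⟩ := hK.elim_nhds_subcover (fun x => Metric.ball x (R x))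
    fun x hx => Metric.ball_mem_nhds x (hR x hx)
  obtain ⟨f, hf⟩ := SmoothPartitionOfUnity.exists_isSubordinate (modelWithCornersSelf ℝ E)
    hK.isClosed (fun i : t => Metric.ball (i : E) (R i)) (fun _ => Metric.isOpen_ball)
    (htc.trans (Set.iUnion₂_subset fun i hi =>
      Set.subset_iUnion (fun i : t => Metric.ball (i : E) (R i)) ⟨i, hi⟩))
  refine ⟨t, fun i => f i, fun i => htK i i.2, fun i => (f i).contMDiff.contDiff, hf,
    fun x hx => ?_⟩
  rw [← finsum_eq_sum_of_fintype]
  exact f.sum_eq_one hx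

/-- The product `φ u`, the two terms of its weak gradient, and their sum are in `L^p(A)` for a smooth
cutoff `φ`. -/
lemma memLp_smul_add_smulRight {p : ℝ≥0∞} {A : Set E} {u : E → F}
    {D : E → E →L[ℝ] F} (hu : MemLp u p (volume.restrict A)) (hD : MemLp D p (volume.restrict A))
    {φ : E → ℝ} (hφ : ContDiff ℝ ∞ φ) (hφc : HasCompactSupport φ) :
    MemLp (fun y => φ y • u y) p (volume.restrict A) ∧
    MemLp (fun y => φ y • D y) p (volume.restrict A) ∧
    MemLp (fun y => (fderiv ℝ φ y).smulRight (u y)) p (volume.restrict A) ∧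
    MemLp (fun y => φ y • D y + (fderiv ℝ φ y).smulRight (u y)) p (volume.restrict A) := by
  obtain ⟨M, hM⟩ := hφ.continuous.bounded_above_of_compact_support hφc
  have hdc : Continuous (fderiv ℝ φ) := hφ.continuous_fderiv (by simp)
  obtain ⟨M', hM'⟩ := hdc.bounded_above_of_compact_support (hφc.fderiv ℝ)
  have m1 : AEStronglyMeasurable (fun y => φ y • u y) (volume.restrict A) :=
    hφ.continuous.aestronglyMeasurable.smul hu.1
  have m2 : AEStronglyMeasurable (fun y => φ y • D y) (volume.restrict A) :=
    hφ.continuous.aestronglyMeasurable.smul hD.1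
  have m3 : AEStronglyMeasurable (fun y => (fderiv ℝ φ y).smulRight (u y))
      (volume.restrict A) := by
    have hc : Continuous fun q : (E →L[ℝ] ℝ) × F => q.1.smulRight q.2 :=
      ((ContinuousLinearMap.smulRightL ℝ E F).continuous.comp continuous_fst).clm_apply
        continuous_snd
    exact hc.comp_aestronglyMeasurable (hdc.aestronglyMeasurable.prodMk hu.1)
  have b2 : ∀ y, ‖φ y • D y‖ ≤ M * ‖D y‖ := fun y => by
    rw [norm_smul]
    exact mul_le_mul_of_nonneg_right (hM y) (norm_nonneg _)
  have b3 : ∀ y, ‖(fderiv ℝ φ y).smulRight (u y)‖ ≤ M' * ‖u y‖ := fun y => by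
    rw [ContinuousLinearMap.norm_smulRight_apply]
    exact mul_le_mul_of_nonneg_right (hM' y) (norm_nonneg _)
  refine ⟨hu.of_le_mul (c := M) m1 (.of_forall fun y => ?_), hD.of_le_mul m2 (.of_forall b2),
    hu.of_le_mul m3 (.of_forall b3), ?_⟩
  · rw [norm_smul]
    exact mul_le_mul_of_nonneg_right (hM y) (norm_nonneg _)
  · have h1 : MemLp (fun y => M * ‖D y‖ + M' * ‖u y‖) p (volume.restrict A) :=
      (hD.norm.const_mul M).add (hu.norm.const_mul M')
    refine h1.of_le (m2.add m3) (.of_forall fun y => ?_)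
    refine (norm_add_le _ _).trans ((add_le_add (b2 y) (b3 y)).trans (le_abs_self _))

/-- The extension by zero of a function in `L^p(A)` is in `L^p`. -/
lemma MeasureTheory.MemLp.indicator_of_restrict {X G : Type*} [MeasurableSpace X]
    [NormedAddCommGroup G] {μ : Measure X} {f : X → G} {A : Set X} {p : ℝ≥0∞}
    (hf : MemLp f p (μ.restrict A)) (hA : MeasurableSet A) : MemLp (A.indicator f) p μ :=
  (memLp_indicator_iff_restrict hA).2 hf

/-- A sum of finitely many functions that are small in `L^p` is small in `L^p`. -/
lemma setLIntegral_enorm_rpow_le_of_eq_sum {X G ι : Type*} [MeasurableSpace X] {μ : Measure X}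
    [NormedAddCommGroup G] [Fintype ι] {A : Set X} (hA : MeasurableSet A) {p : ℝ} (hp : 1 ≤ p)
    {g : X → G} {f : ι → X → G} (hf : ∀ i, AEStronglyMeasurable (f i) μ)
    (hgf : ∀ x ∈ A, g x = ∑ i, f i x) {δ : ℝ≥0∞} (hδ : ∀ i, ∫⁻ x, ‖f i x‖ₑ ^ p ∂μ ≤ δ) :
    ∫⁻ x in A, ‖g x‖ₑ ^ p ∂μ ≤
      (Fintype.card ι : ℝ≥0∞) ^ (p - 1) * (Fintype.card ι : ℝ≥0∞) * δ := by
  have hc : (Fintype.card ι : ℝ≥0∞) ^ (p - 1) ≠ ⊤ :=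
    ENNReal.rpow_ne_top_of_nonneg (by linarith) (ENNReal.natCast_ne_top _)
  calc ∫⁻ x in A, ‖g x‖ₑ ^ p ∂μ
      ≤ ∫⁻ x in A, (Fintype.card ι : ℝ≥0∞) ^ (p - 1) * ∑ i, ‖f i x‖ₑ ^ p ∂μ := by
        refine setLIntegral_mono_ae' hA (.of_forall fun x hx => ?_)
        rw [hgf x hx]
        refine (ENNReal.rpow_le_rpow (enorm_sum_le _ _) (by linarith)).trans ?_
        exact ENNReal.rpow_sum_le_const_mul_sum_rpow _ _ hp
    _ ≤ ∫⁻ x, (Fintype.card ι : ℝ≥0∞) ^ (p - 1) * ∑ i, ‖f i x‖ₑ ^ p ∂μ :=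
        setLIntegral_le_lintegral _ _
    _ = (Fintype.card ι : ℝ≥0∞) ^ (p - 1) * ∑ i, ∫⁻ x, ‖f i x‖ₑ ^ p ∂μ := by
        rw [lintegral_const_mul' _ _ hc, lintegral_finsetSum' _ fun i _ => (hf i).enorm.pow_const p]
    _ ≤ (Fintype.card ι : ℝ≥0∞) ^ (p - 1) * ∑ _i : ι, δ := by
        gcongr with i
        exact hδ i
    _ = _ := by simp [mul_assoc]

/-- If small inward shifts are available, functions in `W^{1,p}(A)` are limits of smooth compactly
supported functions on the whole space. Each piece of a partition of unity is mollified with a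
kernel that is supported near the inward shift instead of near `0`. -/
lemma exists_contDiff_lintegral_sub_le {p : ℝ} (hp : 1 ≤ p) {A : Set E} (hA : IsOpen A)
    (hAb : Bornology.IsBounded A) (hsh : HasInwardShifts A) {u : E → F} {D : E → E →L[ℝ] F}
    (hu : MemLp u (ENNReal.ofReal p) (volume.restrict A))
    (hD : MemLp D (ENNReal.ofReal p) (volume.restrict A)) (hDw : HasWeakGradient A u D)
    {δ : ℝ≥0∞} (hδ : 0 < δ) :
    ∃ w : E → F, ContDiff ℝ 1 w ∧ HasCompactSupport w ∧
      ∫⁻ x in A, ‖w x - u x‖ₑ ^ p ≤ δ ∧ ∫⁻ x in A, ‖fderiv ℝ w x - D x‖ₑ ^ p ≤ δ := by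
  have := FiniteDimensional.proper ℝ E
  have := FiniteDimensional.complete ℝ (E →L[ℝ] F)
  have hp1 : 1 ≤ ENNReal.ofReal p := by simpa using ENNReal.ofReal_le_ofReal hp
  choose! R hR hRsh using hsh
  obtain ⟨t, f, htA, hf, hfs, hf1⟩ := exists_finite_smooth_partition hAb.isCompact_closure R hR
  have hfc : ∀ i, HasCompactSupport (f i) := fun i =>
    HasCompactSupport.of_support_subset_isCompact (isCompact_closedBall (i : E) (R i))
      ((subset_tsupport _).trans ((hfs i).trans Metric.ball_subset_closedBall))
  set U : t → E → F := fun i => A.indicator fun y => f i y • u y with hU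
  set G : t → E → E →L[ℝ] F := fun i => A.indicator fun y =>
    f i y • D y + (fderiv ℝ (f i) y).smulRight (u y) with hG
  have hmem := fun i => memLp_smul_add_smulRight hu hD (hf i) (hfc i)
  have hUm : ∀ i, MemLp (U i) (ENNReal.ofReal p) volume := fun i =>
    (hmem i).1.indicator_of_restrict hA.measurableSet
  have hGm : ∀ i, MemLp (G i) (ENNReal.ofReal p) volume := fun i =>
    (hmem i).2.2.2.indicator_of_restrict hA.measurableSet
  set N : ℝ≥0∞ := (Fintype.card t : ℝ≥0∞) ^ (p - 1) * (Fintype.card t : ℝ≥0∞) with hN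
  have hNtop : N ≠ ⊤ := ENNReal.mul_ne_top
    (ENNReal.rpow_ne_top_of_nonneg (by linarith) (ENNReal.natCast_ne_top _))
    (ENNReal.natCast_ne_top _)
  set δ' := δ / (N + 1) with hδ'
  have hδ'0 : 0 < δ' := ENNReal.div_pos hδ.ne' (by simpa using hNtop)
  have hNδ : N * δ' ≤ δ := le_trans (by gcongr; exact le_self_add) (ENNReal.mul_div_le (a := N + 1))
  have hρ : ∀ i, ∃ ρ : E → ℝ, IsMollifier ρ ∧ (∫⁻ x, ‖mollify ρ (U i) x - U i x‖ₑ ^ p ≤ δ') ∧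
      (∫⁻ x, ‖mollify ρ (G i) x - G i x‖ₑ ^ p ≤ δ') ∧
      ∀ x ∈ A, ∀ y ∈ tsupport (f i), x - y ∈ tsupport ρ → y ∈ A := by
    intro i
    obtain ⟨η₁, hη₁, h₁⟩ := exists_lintegral_mollify_sub_le hp (hUm i) hδ'0
    obtain ⟨η₂, hη₂, h₂⟩ := exists_lintegral_mollify_sub_le hp (hGm i) hδ'0
    obtain ⟨z, s, hs, hzs, hz⟩ := hRsh i (htA i) (min η₁ η₂) (lt_min hη₁ hη₂)
    obtain ⟨ρ, hρ, hρs⟩ := exists_isMollifier_tsupport_subset (-z) hs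
    have hsup : Function.support ρ ⊆ Metric.closedBall 0 (min η₁ η₂) := by
      refine (subset_tsupport _).trans (hρs.trans (Metric.closedBall_subset_closedBall' ?_))
      rw [dist_zero_right, norm_neg]
      linarith
    refine ⟨ρ, hρ, h₁ ρ hρ (hsup.trans (Metric.closedBall_subset_closedBall (min_le_left _ _))),
      h₂ ρ hρ (hsup.trans (Metric.closedBall_subset_closedBall (min_le_right _ _))),
      fun x hx y hy hxy => hz x hx y (Metric.ball_subset_closedBall (hfs i hy)) ?_⟩
    have h3 := hρs hxy
    rw [Metric.mem_closedBall, dist_eq_norm] at h3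
    rwa [show x + z - y = x - y - -z by abel]
  choose ρ hρm hρU hρG hρA using hρ
  have hUl : ∀ i, LocallyIntegrable (U i) := fun i => (hUm i).locallyIntegrable hp1
  have hGl : ∀ i, LocallyIntegrable (G i) := fun i => (hGm i).locallyIntegrable hp1
  have hUcs : ∀ i, HasCompactSupport (U i) := fun i =>
    HasCompactSupport.of_support_subset_isCompact hAb.isCompact_closure
      (Set.support_indicator_subset.trans subset_closure)
  have hmd : ∀ i, ContDiff ℝ 1 (mollify (ρ i) (U i)) := fun i =>
    ((hρm i).contDiff_mollify (hUl i)).of_le (by exact_mod_cast le_top)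
  have hsumU : ∀ x ∈ A, ∑ i, U i x = u x := by
    intro x hx
    simp only [hU, Set.indicator_of_mem hx]
    rw [← Finset.sum_smul, hf1 x (subset_closure hx), one_smul]
  -- the derivatives of the partition of unity add up to zero
  have hsumG : ∀ x ∈ A, ∑ i, G i x = D x := by
    intro x hx
    have h1 : ∑ i, fderiv ℝ (f i) x = 0 := by
      rw [← fderiv_fun_sum fun i _ => (hf i).differentiable (by simp) x]
      have h2 : (fun y => ∑ i, f i y) =ᶠ[𝓝 x] fun _ => 1 := by
        filter_upwards [hA.mem_nhds hx] with y hy using hf1 y (subset_closure hy)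
      rw [h2.fderiv_eq]
      simp
    have h2 : ∑ i, (fderiv ℝ (f i) x).smulRight (u x) = 0 := by
      ext v
      have h3 := congrArg (fun L : E →L[ℝ] ℝ => L v) h1
      simp only [sum_apply, zero_apply] at h3
      simp only [sum_apply, ContinuousLinearMap.smulRight_apply, zero_apply]
      rw [← Finset.sum_smul, h3, zero_smul]
    simp only [hG, Set.indicator_of_mem hx]
    rw [Finset.sum_add_distrib, h2, ← Finset.sum_smul, hf1 x (subset_closure hx), one_smul,
      add_zero]
  refine ⟨fun x => ∑ i, mollify (ρ i) (U i) x, ContDiff.sum fun i _ => hmd i, ?_, ?_, ?_⟩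
  · classical
    have h1 : ∀ s : Finset t, HasCompactSupport fun x => ∑ i ∈ s, mollify (ρ i) (U i) x := by
      intro s
      induction s using Finset.induction_on with
      | empty =>
        simp only [Finset.sum_empty]
        exact HasCompactSupport.zero
      | insert i s hi ih =>
        simp only [Finset.sum_insert hi]
        exact ((hρm i).hasCompactSupport_mollify (hUcs i)).add ih
    exact h1 _
  · refine (setLIntegral_enorm_rpow_le_of_eq_sum hA.measurableSet hp
      (f := fun i x => mollify (ρ i) (U i) x - U i x)
      (fun i => ?_) (fun x hx => ?_) hρU).trans hNδ
    · exact (hmd i).continuous.aestronglyMeasurable.sub (hUm i).1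
    · rw [Finset.sum_sub_distrib, hsumU x hx]
  · refine (setLIntegral_enorm_rpow_le_of_eq_sum hA.measurableSet hp
      (f := fun i x => mollify (ρ i) (G i) x - G i x)
      (fun i => ?_) (fun x hx => ?_) hρG).trans hNδ
    · exact ((hρm i).contDiff_mollify (hGl i)).continuous.aestronglyMeasurable.sub (hGm i).1
    · rw [Finset.sum_sub_distrib, hsumG x hx,
        fderiv_fun_sum fun i _ => (hmd i).differentiable one_ne_zero x]
      congr 1
      refine Finset.sum_congr rfl fun i _ => ?_
      exact (hρm i).fderiv_mollify_of_integral_fderiv_smul hA.measurableSet hDw (hf i) (hUl i)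
        (((hmem i).2.1.indicator_of_restrict hA.measurableSet).locallyIntegrable hp1)
        (((hmem i).2.2.1.indicator_of_restrict hA.measurableSet).locallyIntegrable hp1)
        (hρA i x hx)

end Approximation

/-! ### The limsup inequality -/

section UpperBound

variable {E F : Type*} [NormedAddCommGroup E] [NormedSpace ℝ E] [FiniteDimensional ℝ E]
  [MeasureSpace E] [BorelSpace E] [(volume : Measure E).IsAddHaarMeasure]
  [NormedAddCommGroup F] [NormedSpace ℝ F] [FiniteDimensional ℝ F] [CompleteSpace F]

/-- The limsup inequality for a fixed compactly supported `C^1` function. -/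
lemma KernelSequence.limsup_le_of_contDiff {p : ℝ} {b : ℕ → E → ℝ} {a : E → ℝ}
    (h : KernelSequence p b a) (hp : 1 ≤ p) {e : ℕ → ℝ} (he : ∀ j, 0 < e j)
    (he0 : Tendsto e atTop (𝓝 0)) {A : Set E} (hAb : Bornology.IsBounded A)
    {w : E → F} (hw : ContDiff ℝ 1 w) (hwc : HasCompactSupport w) :
    limsup (fun j => ∫⁻ ξ, ENNReal.ofReal (b j ξ) *
        ∫⁻ x in {x | x ∈ A ∧ x + e j • ξ ∈ A}, ‖(e j)⁻¹ • (w (x + e j • ξ) - w x)‖ₑ ^ p) atTop ≤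
      ∫⁻ ξ, ENNReal.ofReal (a ξ) * ∫⁻ x in A, ‖fderiv ℝ w x ξ‖ₑ ^ p := by
  have := FiniteDimensional.proper ℝ E
  have hp0 : 0 < p := zero_lt_one.trans_le hp
  have hAfin : volume A ≠ ⊤ := hAb.measure_lt_top.ne
  obtain ⟨B, hB⟩ := (hw.continuous_fderiv one_ne_zero).bounded_above_of_compact_support
    (hwc.fderiv ℝ)
  obtain ⟨M, hM, hbM⟩ := h.bounded
  set H : E → ℝ≥0∞ := fun ξ => ∫⁻ x in A, ‖fderiv ℝ w x ξ‖ₑ ^ p with hH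
  set X := ∫⁻ ξ, ENNReal.ofReal (a ξ) * H ξ with hX
  set Gf : ℕ → ℝ≥0∞ := fun j => ∫⁻ ξ, ENNReal.ofReal (b j ξ) *
        ∫⁻ x in {x | x ∈ A ∧ x + e j • ξ ∈ A}, ‖(e j)⁻¹ • (w (x + e j • ξ) - w x)‖ₑ ^ p with hGf
  have hcrude : ∀ j x ξ, ‖(e j)⁻¹ • (w (x + e j • ξ) - w x)‖ₑ ≤ ENNReal.ofReal B * ‖ξ‖ₑ := by
    intro j x ξ
    have h1 := convex_univ.norm_image_sub_le_of_norm_fderiv_le (𝕜 := ℝ) (f := w) (C := B)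
      (fun z _ => hw.differentiable one_ne_zero z) (fun z _ => hB z) (Set.mem_univ x)
      (Set.mem_univ (x + e j • ξ))
    rw [add_sub_cancel_left, norm_smul, Real.norm_of_nonneg (he j).le] at h1
    have hB0 : 0 ≤ B := (norm_nonneg _).trans (hB 0)
    rw [← ofReal_norm, ← ofReal_norm, ← ENNReal.ofReal_mul hB0]
    refine ENNReal.ofReal_le_ofReal ?_
    rw [norm_smul, norm_inv, Real.norm_of_nonneg (he j).le, inv_mul_le_iff₀ (he j)]
    linarith
  have hmain : ∀ l : ℝ≥0∞, 1 < l → l ≠ ⊤ → ∃ C : ℝ≥0∞, C ≠ ⊤ ∧ ∀ κ : ℝ, 0 < κ →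
      limsup Gf atTop ≤ l * X + (C * volume A * M * ENNReal.ofReal κ ^ p +
        ENNReal.ofReal B ^ p * volume A * ENNReal.ofReal κ) := by
    intro l hl hl'
    obtain ⟨C, hC, hadd⟩ := exists_add_rpow_le hp hl
    refine ⟨C, hC, fun κ hκ => ?_⟩
    obtain ⟨r, hr, htail⟩ := h.tail κ hκ
    obtain ⟨s, hs, hsq⟩ := exists_norm_smul_sub_sub_fderiv_le hw hwc hκ
    have hes : ∀ᶠ j in atTop, e j * r < s := by
      have := he0.mul_const r
      rw [zero_mul] at this
      exact this.eventually_lt_const hs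
    have hlim := h.tendsto_lintegral_directional hp0.le (hw.continuous_fderiv one_ne_zero) hB hAfin r
    set err := C * volume A * M * ENNReal.ofReal κ ^ p +
        ENNReal.ofReal B ^ p * volume A * ENNReal.ofReal κ with herr
    have hev : ∀ᶠ j in atTop, Gf j ≤ l * (∫⁻ ξ, ENNReal.ofReal (b j ξ) *
        (ENNReal.ofReal (ballCutoff r ξ) * H ξ)) + err := by
      filter_upwards [hbM, htail, hes] with j hjM hjt hjs
      -- near the origin the difference quotients are close to the derivative; for large `ξ` the
      -- Lipschitz bound is enough
      have hinner : ∀ ξ : E,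
          ∫⁻ x in {x | x ∈ A ∧ x + e j • ξ ∈ A}, ‖(e j)⁻¹ • (w (x + e j • ξ) - w x)‖ₑ ^ p ≤
          l * (ENNReal.ofReal (ballCutoff r ξ) * H ξ) +
            (C * ENNReal.ofReal κ ^ p * volume A * ‖ξ‖ₑ ^ p +
            (Metric.ball 0 r)ᶜ.indicator
              (fun ξ => ENNReal.ofReal B ^ p * volume A * ‖ξ‖ₑ ^ p) ξ) := by
        intro ξ
        refine (lintegral_mono_set (fun x hx => hx.1 : _ ⊆ A)).trans ?_
        by_cases hξ : ξ ∈ Metric.ball (0 : E) r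
        · rw [mem_ball_zero_iff] at hξ
          rw [ballCutoff_eq_one hξ.le, ENNReal.ofReal_one, one_mul]
          calc ∫⁻ x in A, ‖(e j)⁻¹ • (w (x + e j • ξ) - w x)‖ₑ ^ p
              ≤ ∫⁻ x in A, (l * ‖fderiv ℝ w x ξ‖ₑ ^ p +
                  C * (ENNReal.ofReal κ * ‖ξ‖ₑ) ^ p) := by
                refine lintegral_mono fun x => ?_
                refine le_trans (ENNReal.rpow_le_rpow ?_ hp0.le) (hadd _ _)
                have h1 := hsq (e j) (he j) x ξ (lt_of_le_of_lt
                  (mul_le_mul_of_nonneg_left hξ.le (he j).le) hjs)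
                have h2 : (e j)⁻¹ • (w (x + e j • ξ) - w x) = fderiv ℝ w x ξ +
                    ((e j)⁻¹ • (w (x + e j • ξ) - w x) - fderiv ℝ w x ξ) := by abel
                rw [h2]
                refine (enorm_add_le _ _).trans ?_
                gcongr
                rw [← ofReal_norm, ← ofReal_norm, ← ENNReal.ofReal_mul hκ.le]
                exact ENNReal.ofReal_le_ofReal h1
            _ = l * H ξ + C * (ENNReal.ofReal κ * ‖ξ‖ₑ) ^ p * volume A := by
                rw [lintegral_add_right _ measurable_const, lintegral_const_mul' _ _ hl',
                  lintegral_const, Measure.restrict_apply_univ]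
            _ ≤ _ := by
                rw [ENNReal.mul_rpow_of_nonneg _ _ hp0.le]
                refine add_le_add_right (le_trans (le_of_eq ?_) le_self_add) _
                ring
        · rw [Set.indicator_of_mem (show ξ ∈ (Metric.ball (0 : E) r)ᶜ from hξ)]
          refine le_trans ?_ (le_add_self.trans le_add_self)
          calc ∫⁻ x in A, ‖(e j)⁻¹ • (w (x + e j • ξ) - w x)‖ₑ ^ p
              ≤ ∫⁻ x in A, (ENNReal.ofReal B * ‖ξ‖ₑ) ^ p :=
                lintegral_mono fun x => ENNReal.rpow_le_rpow (hcrude j x ξ) hp0.le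
            _ = _ := by
                rw [lintegral_const, Measure.restrict_apply_univ,
                  ENNReal.mul_rpow_of_nonneg _ _ hp0.le]
                ring
      have hbm := h.aemeasurable j
      have hξm : Measurable fun ξ : E => ‖ξ‖ₑ ^ p := measurable_enorm.pow_const p
      have hbξ : AEMeasurable fun ξ : E => ENNReal.ofReal (b j ξ) * ‖ξ‖ₑ ^ p :=
        hbm.mul hξm.aemeasurable
      have hmul : ∀ ξ : E, ENNReal.ofReal (b j ξ) * ‖ξ‖ₑ ^ p =
          ENNReal.ofReal (b j ξ * ‖ξ‖ ^ p) := fun ξ => by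
        rw [ENNReal.ofReal_mul (h.nonneg _ _), ← ofReal_norm,
          ENNReal.ofReal_rpow_of_nonneg (norm_nonneg _) hp0.le]
      have hmS : MeasurableSet (Metric.ball (0 : E) r)ᶜ := Metric.isOpen_ball.measurableSet.compl
      calc Gf j ≤ ∫⁻ ξ, (l * (ENNReal.ofReal (b j ξ) * (ENNReal.ofReal (ballCutoff r ξ) * H ξ)) +
            (C * ENNReal.ofReal κ ^ p * volume A * (ENNReal.ofReal (b j ξ) * ‖ξ‖ₑ ^ p) +
            (Metric.ball 0 r)ᶜ.indicator (fun ξ => ENNReal.ofReal B ^ p * volume A *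
              (ENNReal.ofReal (b j ξ) * ‖ξ‖ₑ ^ p)) ξ)) := by
            refine lintegral_mono fun ξ => ?_
            refine (mul_le_mul_right (hinner ξ) _).trans_eq ?_
            by_cases hξ : ξ ∈ (Metric.ball (0 : E) r)ᶜ
            · simp only [Set.indicator_of_mem hξ]
              ring
            · simp only [Set.indicator_of_notMem hξ]
              ring
        _ = l * (∫⁻ ξ, ENNReal.ofReal (b j ξ) * (ENNReal.ofReal (ballCutoff r ξ) * H ξ)) +
            (C * ENNReal.ofReal κ ^ p * volume A * (∫⁻ ξ, ENNReal.ofReal (b j ξ) * ‖ξ‖ₑ ^ p) +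
            ENNReal.ofReal B ^ p * volume A *
              ∫⁻ ξ in (Metric.ball 0 r)ᶜ, ENNReal.ofReal (b j ξ) * ‖ξ‖ₑ ^ p) := by
            have hm2 : AEMeasurable ((Metric.ball (0 : E) r)ᶜ.indicator
                (fun ξ => ENNReal.ofReal B ^ p * volume A *
                (ENNReal.ofReal (b j ξ) * ‖ξ‖ₑ ^ p))) := (hbξ.const_mul _).indicator hmS
            have hm3 : AEMeasurable fun ξ : E => C * ENNReal.ofReal κ ^ p * volume A *
                (ENNReal.ofReal (b j ξ) * ‖ξ‖ₑ ^ p) + (Metric.ball (0 : E) r)ᶜ.indicator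
                (fun ξ => ENNReal.ofReal B ^ p * volume A *
                (ENNReal.ofReal (b j ξ) * ‖ξ‖ₑ ^ p)) ξ := (hbξ.const_mul _).add hm2
            rw [lintegral_add_right' _ hm3,
              lintegral_add_right' _ hm2, lintegral_const_mul' _ _ hl',
              lintegral_const_mul'' _ hbξ, lintegral_indicator hmS,
              lintegral_const_mul'' _ hbξ.restrict]
        _ ≤ l * (∫⁻ ξ, ENNReal.ofReal (b j ξ) * (ENNReal.ofReal (ballCutoff r ξ) * H ξ)) +
            (C * ENNReal.ofReal κ ^ p * volume A * M +
              ENNReal.ofReal B ^ p * volume A * ENNReal.ofReal κ) := by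
            gcongr
            · refine le_trans (lintegral_mono fun ξ => ?_) hjM
              rw [hmul]
              refine ENNReal.ofReal_le_ofReal (mul_le_mul_of_nonneg_left ?_ (h.nonneg _ _))
              linarith
            · simp only [hmul]
              exact hjt
        _ = _ := by
            rw [herr]
            ring
    have hlim2 : Tendsto (fun j => l * (∫⁻ ξ, ENNReal.ofReal (b j ξ) *
        (ENNReal.ofReal (ballCutoff r ξ) * H ξ)) + err) atTop
        (𝓝 (l * (∫⁻ ξ, ENNReal.ofReal (a ξ) *
        (ENNReal.ofReal (ballCutoff r ξ) * H ξ)) + err)) :=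
      (ENNReal.Tendsto.const_mul hlim (Or.inr hl')).add tendsto_const_nhds
    refine (limsup_le_limsup hev).trans (hlim2.limsup_eq.trans_le ?_)
    gcongr
    rw [hX]
    refine lintegral_mono fun ξ => ?_
    refine mul_le_mul_right (mul_le_of_le_one_left zero_le ?_) _
    simpa using ballCutoff_le_one r ξ
  rcases eq_or_ne X ⊤ with hXt | hXt
  · rw [hXt]
    exact le_top
  have hl : ∀ l : ℝ≥0∞, 1 < l → l ≠ ⊤ → limsup Gf atTop ≤ l * X := by
    intro l hl hl'
    obtain ⟨C, hC, hCκ⟩ := hmain l hl hl'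
    have h2 : Tendsto (fun κ : ℝ => l * X + (C * volume A * M * ENNReal.ofReal κ ^ p +
        ENNReal.ofReal B ^ p * volume A * ENNReal.ofReal κ)) (𝓝[>] 0)
        (𝓝 (l * X + (C * volume A * M * ENNReal.ofReal 0 ^ p +
        ENNReal.ofReal B ^ p * volume A * ENNReal.ofReal 0))) := by
      refine Tendsto.mono_left ?_ nhdsWithin_le_nhds
      refine tendsto_const_nhds.add (Tendsto.add ?_ ?_)
      · refine ENNReal.Tendsto.const_mul ?_ (Or.inr ?_)
        · exact ((ENNReal.continuous_rpow_const.comp ENNReal.continuous_ofReal).tendsto 0)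
        · exact ENNReal.mul_ne_top (ENNReal.mul_ne_top hC hAfin) hM
      · refine ENNReal.Tendsto.const_mul (ENNReal.continuous_ofReal.tendsto 0) (Or.inr ?_)
        exact ENNReal.mul_ne_top (ENNReal.rpow_ne_top_of_nonneg hp0.le ENNReal.ofReal_ne_top) hAfin
    rw [ENNReal.ofReal_zero, ENNReal.zero_rpow_of_pos hp0, mul_zero, mul_zero, add_zero,
      add_zero] at h2
    exact ge_of_tendsto h2 (by filter_upwards [self_mem_nhdsWithin] with κ hκ using hCκ κ hκ)
  have h3 : Tendsto (fun l : ℝ≥0∞ => l * X) (𝓝[>] 1) (𝓝 (1 * X)) :=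
    (ENNReal.Tendsto.mul_const tendsto_id (Or.inr hXt)).mono_left nhdsWithin_le_nhds
  rw [one_mul] at h3
  refine ge_of_tendsto h3 ?_
  filter_upwards [self_mem_nhdsWithin, nhdsWithin_le_nhds (eventually_ne_nhds ENNReal.one_ne_top)]
    with l hl1 hl2 using hl l hl1 hl2

/-- The limit energies of two nearby gradient fields are close. -/
lemma lintegral_apply_rpow_le_add {p : ℝ} (hp : 0 ≤ p) {a : E → ℝ}
    (ha : AEMeasurable fun ξ => ENNReal.ofReal (a ξ)) {l C : ℝ≥0∞} (hl : l ≠ ⊤)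
    (hadd : ∀ s t : ℝ≥0∞, (s + t) ^ p ≤ l * s ^ p + C * t ^ p) {A : Set E}
    {G D : E → E →L[ℝ] F}
    (hGD : AEStronglyMeasurable (fun x => G x - D x) (volume.restrict A)) :
    ∫⁻ ξ, ENNReal.ofReal (a ξ) * ∫⁻ x in A, ‖G x ξ‖ₑ ^ p ≤
      l * (∫⁻ ξ, ENNReal.ofReal (a ξ) * ∫⁻ x in A, ‖D x ξ‖ₑ ^ p) +
      C * (∫⁻ x in A, ‖G x - D x‖ₑ ^ p) * ∫⁻ ξ, ENNReal.ofReal (a ξ) * ‖ξ‖ₑ ^ p := by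
  have hξm : Measurable fun ξ : E => ‖ξ‖ₑ ^ p := measurable_enorm.pow_const p
  set I := ∫⁻ x in A, ‖G x - D x‖ₑ ^ p with hI
  have hinner : ∀ ξ, ∫⁻ x in A, ‖G x ξ‖ₑ ^ p ≤
      l * (∫⁻ x in A, ‖D x ξ‖ₑ ^ p) + C * I * ‖ξ‖ₑ ^ p := by
    intro ξ
    calc ∫⁻ x in A, ‖G x ξ‖ₑ ^ p
        ≤ ∫⁻ x in A, (l * ‖D x ξ‖ₑ ^ p + C * ‖ξ‖ₑ ^ p * ‖G x - D x‖ₑ ^ p) := by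
          refine lintegral_mono fun x => ?_
          have h1 : ‖G x ξ‖ₑ ≤ ‖D x ξ‖ₑ + ‖G x - D x‖ₑ * ‖ξ‖ₑ := by
            have h2 : G x ξ = D x ξ + (G x - D x) ξ := by simp
            rw [h2]
            refine (enorm_add_le _ _).trans ?_
            gcongr
            exact (G x - D x).le_opENorm ξ
          refine (ENNReal.rpow_le_rpow h1 hp).trans ((hadd _ _).trans_eq ?_)
          rw [ENNReal.mul_rpow_of_nonneg _ _ hp]
          ring
      _ = l * (∫⁻ x in A, ‖D x ξ‖ₑ ^ p) + C * I * ‖ξ‖ₑ ^ p := by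
          have hm : AEMeasurable (fun x => ‖G x - D x‖ₑ ^ p) (volume.restrict A) :=
            hGD.enorm.pow_const p
          rw [lintegral_add_right' _ (hm.const_mul _), lintegral_const_mul' _ _ hl,
            lintegral_const_mul'' _ hm]
          ring
  calc ∫⁻ ξ, ENNReal.ofReal (a ξ) * ∫⁻ x in A, ‖G x ξ‖ₑ ^ p
      ≤ ∫⁻ ξ, (l * (ENNReal.ofReal (a ξ) * ∫⁻ x in A, ‖D x ξ‖ₑ ^ p) +
          C * I * (ENNReal.ofReal (a ξ) * ‖ξ‖ₑ ^ p)) := by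
        refine lintegral_mono fun ξ => ?_
        refine (mul_le_mul_right (hinner ξ) _).trans_eq ?_
        ring
    _ = _ := by
        have hm : AEMeasurable fun ξ : E => ENNReal.ofReal (a ξ) * ‖ξ‖ₑ ^ p :=
          ha.mul hξm.aemeasurable
        rw [lintegral_add_right' _ (hm.const_mul _), lintegral_const_mul' _ _ hl,
          lintegral_const_mul'' _ hm]

end UpperBound

/-- A diagonal argument: recovery sequences exist once every neighbourhood of `u` contains points
whose values are almost optimal in the limit. -/
lemma exists_recovery_sequence {X : Type*} [PseudoEMetricSpace X] {Φ : ℕ → X → ℝ≥0∞} {Φ₀ : ℝ≥0∞}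
    {u : X} (h : ∀ δ : ℝ≥0∞, 0 < δ → δ ≠ ⊤ → ∃ v, edist v u ≤ δ ∧
      limsup (fun j => Φ j v) atTop ≤ Φ₀ + δ) :
    ∃ v : ℕ → X, Tendsto v atTop (𝓝 u) ∧ limsup (fun j => Φ j (v j)) atTop ≤ Φ₀ := by
  rcases eq_or_ne Φ₀ ⊤ with rfl | hΦ₀
  · exact ⟨fun _ => u, tendsto_const_nhds, le_top⟩
  -- `c j` measures how well the `j`-th functional can be recovered near `u`
  set S : ℕ → Set ℝ≥0∞ := fun j => {c | ∃ v, edist v u ≤ c ∧ Φ j v ≤ Φ₀ + c} with hS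
  set c : ℕ → ℝ≥0∞ := fun j => sInf (S j) with hc
  have hc0 : Tendsto c atTop (𝓝 0) := by
    refine ENNReal.tendsto_nhds_zero.2 fun δ hδ => ?_
    rcases eq_or_ne δ ⊤ with rfl | hδt
    · exact .of_forall fun _ => le_top
    obtain ⟨v, hv, hlim⟩ := h (δ / 2) (ENNReal.half_pos hδ.ne')
      (ENNReal.div_ne_top hδt two_ne_zero)
    have hlt : limsup (fun j => Φ j v) atTop < Φ₀ + δ :=
      hlim.trans_lt (ENNReal.add_lt_add_left hΦ₀ (ENNReal.half_lt_self hδ.ne' hδt))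
    filter_upwards [eventually_lt_of_limsup_lt hlt] with j hj
    exact sInf_le ⟨v, hv.trans ENNReal.half_le_self, hj.le⟩
  have hex : ∀ j, ∃ v, edist v u ≤ c j + ((j : ℝ≥0∞) + 1)⁻¹ ∧
      Φ j v ≤ Φ₀ + (c j + ((j : ℝ≥0∞) + 1)⁻¹) := by
    intro j
    rcases eq_or_ne (c j) ⊤ with hct | hct
    · exact ⟨u, by simp [hct], by simp [hct]⟩
    · have hlt : sInf (S j) < c j + ((j : ℝ≥0∞) + 1)⁻¹ := ENNReal.lt_add_right hct (by simp)
      obtain ⟨c', ⟨v, hv1, hv2⟩, hc'⟩ := sInf_lt_iff.1 hlt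
      exact ⟨v, hv1.trans hc'.le, hv2.trans (by gcongr)⟩
  choose v hv1 hv2 using hex
  have h1 : Tendsto (fun j : ℕ => c j + ((j : ℝ≥0∞) + 1)⁻¹) atTop (𝓝 0) := by
    have h2 : Tendsto (fun n : ℕ => ((n : ℝ≥0∞) + 1)⁻¹) atTop (𝓝 0) := by
      have := (ENNReal.tendsto_inv_nat_nhds_zero).comp (tendsto_add_atTop_nat 1)
      simpa [Function.comp_def] using this
    simpa using hc0.add h2
  refine ⟨v, ?_, ?_⟩
  · rw [tendsto_iff_edist_tendsto_0]
    exact tendsto_of_tendsto_of_tendsto_of_le_of_le tendsto_const_nhds h1 (fun _ => zero_le) hv1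
  · have h2 : Tendsto (fun j => Φ₀ + (c j + ((j : ℝ≥0∞) + 1)⁻¹)) atTop (𝓝 (Φ₀ + 0)) :=
      tendsto_const_nhds.add h1
    rw [add_zero] at h2
    exact (limsup_le_limsup (.of_forall hv2)).trans h2.limsup_eq.le

/-! ### Gamma-convergence -/

variable {d m : ℕ}

/-- The convolution functional on `A` depends only on the values of the function on `A`, up to null
sets, since translations preserve the measure. -/
lemma convFunctional_congr_ae {p ε : ℝ} {b : EuclideanSpace ℝ (Fin d) → ℝ}
    {A : Set (EuclideanSpace ℝ (Fin d))} (hA : MeasurableSet A)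
    {f g : EuclideanSpace ℝ (Fin d) → EuclideanSpace ℝ (Fin m)}
    (hfg : f =ᵐ[volume.restrict A] g) :
    convFunctional p ε b A f = convFunctional p ε b A g := by
  rw [convFunctional, convFunctional]
  congr 1
  ext ξ
  congr 1
  have hS : MeasurableSet {x | x ∈ A ∧ x + ε • ξ ∈ A} :=
    hA.inter (hA.preimage (measurable_id.add_const _))
  have h1 : ∀ᵐ x, x ∈ A → f x = g x := (ae_restrict_iff' hA).1 hfg
  have h2 : ∀ᵐ x, x + ε • ξ ∈ A → f (x + ε • ξ) = g (x + ε • ξ) :=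
    (measurePreserving_add_right volume (ε • ξ)).quasiMeasurePreserving.ae h1
  refine lintegral_congr_ae ((ae_restrict_iff' hS).2 ?_)
  filter_upwards [h1, h2] with x hx1 hx2 hx
  rw [hx1 hx.1, hx2 hx.2]

/-- Convergence in `L^p` on a bounded set implies convergence in `L^1` on its subsets. -/
lemma tendsto_setLIntegral_enorm_sub_of_tendsto_Lp {X G : Type*} [MeasurableSpace X]
    [NormedAddCommGroup G] {μ : Measure X} {Ω A : Set X} (hAΩ : A ⊆ Ω) (hΩ : μ Ω ≠ ⊤)
    {q : ℝ≥0∞} [Fact (1 ≤ q)] {v : ℕ → Lp G q (μ.restrict Ω)} {u : Lp G q (μ.restrict Ω)}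
    (hvu : Tendsto v atTop (𝓝 u)) :
    Tendsto (fun j => ∫⁻ x in A, ‖v j x - u x‖ₑ ∂μ) atTop (𝓝 0) := by
  have hq : (1 : ℝ≥0∞) ≤ q := Fact.out
  set c : ℝ≥0∞ := (μ.restrict Ω) Set.univ ^ (1 / (1 : ℝ≥0∞).toReal - 1 / q.toReal) with hc
  have hct : c ≠ ⊤ := by
    refine ENNReal.rpow_ne_top_of_nonneg ?_ (by simpa using hΩ)
    rcases eq_or_ne q ⊤ with rfl | hqt
    · simp
    · have h1 : 1 ≤ q.toReal := by
        simpa using (ENNReal.toReal_le_toReal ENNReal.one_ne_top hqt).2 hq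
      simpa using inv_le_one_of_one_le₀ h1
  have h1 : Tendsto (fun j => edist (v j) u * c) atTop (𝓝 0) := by
    have := ENNReal.Tendsto.mul_const (b := c) (tendsto_iff_edist_tendsto_0.1 hvu) (Or.inr hct)
    rwa [zero_mul] at this
  refine tendsto_of_tendsto_of_tendsto_of_le_of_le tendsto_const_nhds h1 (fun _ => zero_le)
    fun j => ?_
  have hm : AEStronglyMeasurable (fun x => v j x - u x) (μ.restrict Ω) :=
    (Lp.aestronglyMeasurable _).sub (Lp.aestronglyMeasurable _)
  calc ∫⁻ x in A, ‖v j x - u x‖ₑ ∂μ ≤ ∫⁻ x in Ω, ‖v j x - u x‖ₑ ∂μ := lintegral_mono_set hAΩ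
    _ = eLpNorm (fun x => v j x - u x) 1 (μ.restrict Ω) := eLpNorm_one_eq_lintegral_enorm.symm
    _ ≤ eLpNorm (fun x => v j x - u x) q (μ.restrict Ω) * c :=
        eLpNorm_le_eLpNorm_mul_rpow_measure_univ hq hm
    _ = edist (v j) u * c := by
        rw [Lp.edist_def]
        rfl

/-- Every `u` has arbitrarily close approximations whose energies along the sequence of scales are
almost optimal; they are smooth on `A` if `u` is a Sobolev function there. -/
lemma KernelSequence.exists_limsup_le {p : ℝ} [hp : Fact (1 < p)]
    {b : ℕ → EuclideanSpace ℝ (Fin d) → ℝ} {a : EuclideanSpace ℝ (Fin d) → ℝ}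
    (h : KernelSequence p b a) {e : ℕ → ℝ}
    (he : ∀ j, 0 < e j) (he0 : Tendsto e atTop (𝓝 0)) {Ω A : Set (EuclideanSpace ℝ (Fin d))}
    (hA : IsOpen A) (hAΩ : A ⊆ Ω) (hAb : Bornology.IsBounded A) (hsh : HasInwardShifts A)
    (u : Lp (EuclideanSpace ℝ (Fin m)) (ENNReal.ofReal p) (volume.restrict Ω))
    {δ : ℝ≥0∞} (hδ : 0 < δ) (hδt : δ ≠ ⊤) :
    ∃ v : Lp (EuclideanSpace ℝ (Fin m)) (ENNReal.ofReal p) (volume.restrict Ω), edist v u ≤ δ ∧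
      limsup (fun j => convFunctional p (e j) (b j) A v) atTop ≤ limitFunctional p a A u + δ := by
  classical
  have hp1 : 1 ≤ p := hp.out.le
  have hp0 : 0 < p := zero_lt_one.trans hp.out
  have hpE0 : ENNReal.ofReal p ≠ 0 := by simpa using hp0
  have hpr : (ENNReal.ofReal p).toReal = p := ENNReal.toReal_ofReal hp0.le
  by_cases hmem : MemW1p p A u
  swap
  · exact ⟨u, by simp, by simp [limitFunctional, hmem]⟩
  rw [limitFunctional, if_pos hmem]
  obtain ⟨hD, hDw⟩ := hmem.weakGradient_spec
  set D := weakGradient p A u with hDdef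
  set X := ∫⁻ ξ, ENNReal.ofReal (a ξ) * ∫⁻ x in A, ‖D x ξ‖ₑ ^ p with hX
  set I := ∫⁻ ξ, ENNReal.ofReal (a ξ) * ‖ξ‖ₑ ^ p with hI
  have hIt : I < ⊤ := h.lintegral_limit_lt_top hp0.le
  have hDt : ∫⁻ x in A, ‖D x‖ₑ ^ p < ⊤ := by
    have := lintegral_rpow_enorm_lt_top_of_eLpNorm_lt_top hpE0 ENNReal.ofReal_ne_top hD.2
    rwa [hpr] at this
  have hXt : X < ⊤ := by
    calc X ≤ ∫⁻ ξ, (∫⁻ x in A, ‖D x‖ₑ ^ p) * (ENNReal.ofReal (a ξ) * ‖ξ‖ₑ ^ p) := by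
          refine lintegral_mono fun ξ => ?_
          rw [mul_left_comm]
          refine mul_le_mul_right ?_ _
          rw [← lintegral_mul_const' _ _ (ENNReal.rpow_ne_top_of_nonneg hp0.le enorm_ne_top)]
          refine lintegral_mono fun x => ?_
          rw [← ENNReal.mul_rpow_of_nonneg _ _ hp0.le]
          exact ENNReal.rpow_le_rpow ((D x).le_opENorm ξ) hp0.le
      _ = (∫⁻ x in A, ‖D x‖ₑ ^ p) * I := lintegral_const_mul' _ _ hDt.ne
      _ < ⊤ := ENNReal.mul_lt_top hDt hIt
  -- `l` close to `1` and then `τ` small make the energy of the approximation at most `X + δ`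
  obtain ⟨l, hl, hlt, hlX⟩ : ∃ l : ℝ≥0∞, 1 < l ∧ l ≠ ⊤ ∧ l * X < X + δ / 2 := by
    have h3 : Tendsto (fun l : ℝ≥0∞ => l * X) (𝓝[>] 1) (𝓝 (1 * X)) :=
      (ENNReal.Tendsto.mul_const tendsto_id (Or.inr hXt.ne)).mono_left nhdsWithin_le_nhds
    rw [one_mul] at h3
    have h4 := h3.eventually_lt_const (ENNReal.lt_add_right hXt.ne (ENNReal.half_pos hδ.ne').ne')
    obtain ⟨l, hl⟩ := ((h4.and (nhdsWithin_le_nhds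
      (eventually_ne_nhds ENNReal.one_ne_top))).and self_mem_nhdsWithin).exists
    exact ⟨l, hl.2, hl.1.2, hl.1.1⟩
  obtain ⟨C, hC, hadd⟩ := exists_add_rpow_le hp1 hl
  have hCI : C * I + 1 ≠ ⊤ := ENNReal.add_ne_top.2 ⟨ENNReal.mul_ne_top hC hIt.ne, ENNReal.one_ne_top⟩
  set τ : ℝ≥0∞ := min (δ ^ p) (δ / 2 / (C * I + 1)) with hτ
  have hτ0 : 0 < τ := lt_min (ENNReal.rpow_pos hδ hδt)
    (ENNReal.div_pos (ENNReal.half_pos hδ.ne').ne' hCI)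
  obtain ⟨w, hw, hwc, hwu, hwD⟩ := exists_contDiff_lintegral_sub_le hp1 hA hAb hsh hmem.1 hD hDw hτ0
  have hwp : MemLp w (ENNReal.ofReal p) (volume.restrict Ω) :=
    (hw.continuous.memLp_of_hasCompactSupport hwc).restrict Ω
  have hgp : MemLp (A.indicator fun x => w x - u x) (ENNReal.ofReal p) (volume.restrict Ω) :=
    (hwp.sub (Lp.memLp u)).indicator hA.measurableSet
  have hrestr : (volume.restrict Ω).restrict A = volume.restrict A :=
    Measure.restrict_restrict_of_subset hAΩ
  -- the function equal to `w` on `A` and to `u` elsewhere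
  refine ⟨u + hgp.toLp _, ?_, ?_⟩
  · rw [edist_eq_enorm_sub, add_sub_cancel_left, Lp.enorm_toLp,
      eLpNorm_indicator_eq_eLpNorm_restrict hA.measurableSet, hrestr,
      eLpNorm_eq_lintegral_rpow_enorm_toReal hpE0 ENNReal.ofReal_ne_top, hpr, one_div,
      ENNReal.rpow_inv_le_iff hp0]
    exact hwu.trans (min_le_left _ _)
  · have hcongr : (u + hgp.toLp _ : Lp (EuclideanSpace ℝ (Fin m)) (ENNReal.ofReal p)
        (volume.restrict Ω)) =ᵐ[volume.restrict A] w := by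
      have h1 := ae_restrict_of_ae_restrict_of_subset hAΩ (Lp.coeFn_add u (hgp.toLp _))
      have h2 := ae_restrict_of_ae_restrict_of_subset hAΩ hgp.coeFn_toLp
      filter_upwards [h1, h2, ae_restrict_mem hA.measurableSet] with x hx1 hx2 hx
      rw [hx1, Pi.add_apply, hx2, Set.indicator_of_mem hx]
      simp
    simp only [convFunctional_congr_ae hA.measurableSet hcongr]
    have hmeas : AEStronglyMeasurable (fun x => fderiv ℝ w x - D x) (volume.restrict A) :=
      ((hw.continuous_fderiv one_ne_zero).aestronglyMeasurable).sub hD.1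
    calc limsup (fun j => convFunctional p (e j) (b j) A w) atTop
        ≤ ∫⁻ ξ, ENNReal.ofReal (a ξ) * ∫⁻ x in A, ‖fderiv ℝ w x ξ‖ₑ ^ p :=
          h.limsup_le_of_contDiff hp1 he he0 hAb hw hwc
      _ ≤ l * X + C * (∫⁻ x in A, ‖fderiv ℝ w x - D x‖ₑ ^ p) * I :=
          lintegral_apply_rpow_le_add hp0.le h.aemeasurable_limit hlt hadd hmeas
      _ ≤ (X + δ / 2) + δ / 2 := by
          refine add_le_add hlX.le ?_
          calc C * (∫⁻ x in A, ‖fderiv ℝ w x - D x‖ₑ ^ p) * I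
              ≤ C * (δ / 2 / (C * I + 1)) * I := by
                gcongr
                exact hwD.trans (min_le_right _ _)
            _ = δ / 2 / (C * I + 1) * (C * I) := by ring
            _ ≤ δ / 2 / (C * I + 1) * (C * I + 1) := by
                gcongr
                exact le_self_add
            _ = δ / 2 := ENNReal.div_mul_cancel (by simp) hCI
      _ = X + δ := by rw [add_assoc, ENNReal.add_halves]

/-- The Gamma-convergence along a fixed sequence of scales. -/
theorem KernelSequence.gamma_convergence {p : ℝ} [hp : Fact (1 < p)]
    {b : ℕ → EuclideanSpace ℝ (Fin d) → ℝ} {a : EuclideanSpace ℝ (Fin d) → ℝ}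
    (h : KernelSequence p b a) (hne : ¬ a =ᵐ[volume] 0) {e : ℕ → ℝ}
    (he : ∀ j, 0 < e j) (he0 : Tendsto e atTop (𝓝 0)) {Ω A : Set (EuclideanSpace ℝ (Fin d))}
    (hΩb : Bornology.IsBounded Ω) (hA : IsOpen A) (hAΩ : A ⊆ Ω) (hsh : HasInwardShifts A)
    (u : Lp (EuclideanSpace ℝ (Fin m)) (ENNReal.ofReal p) (volume.restrict Ω)) :
    (∀ v : ℕ → Lp (EuclideanSpace ℝ (Fin m)) (ENNReal.ofReal p) (volume.restrict Ω),
      Tendsto v atTop (𝓝 u) → limitFunctional p a A u ≤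
        liminf (fun j => convFunctional p (e j) (b j) A (v j)) atTop) ∧
    ∃ v : ℕ → Lp (EuclideanSpace ℝ (Fin m)) (ENNReal.ofReal p) (volume.restrict Ω),
      Tendsto v atTop (𝓝 u) ∧
        limsup (fun j => convFunctional p (e j) (b j) A (v j)) atTop ≤ limitFunctional p a A u := by
  have hAb := hΩb.subset hAΩ
  have hp1 : 1 ≤ ENNReal.ofReal p := Fact.out
  have hfin : IsFiniteMeasure (volume.restrict A) := ⟨by simpa using hAb.measure_lt_top⟩
  have hmono : volume.restrict A ≤ volume.restrict Ω := Measure.restrict_mono hAΩ le_rfl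
  refine ⟨fun v hv => ?_, exists_recovery_sequence fun δ hδ hδt =>
    h.exists_limsup_le he he0 hA hAΩ hAb hsh u hδ hδt⟩
  exact h.limitFunctional_le_liminf hp.out hne he he0 hA hAb
    (fun j => ((Lp.memLp (v j)).mono_measure hmono).integrable hp1)
    ((Lp.memLp u).mono_measure hmono)
    (tendsto_setLIntegral_enorm_sub_of_tendsto_Lp hAΩ hΩb.measure_lt_top.ne hv)

/-- A fixed kernel with finite `p`-th moment is an admissible constant sequence. -/
lemma kernelSequence_const {p : ℝ} {a : EuclideanSpace ℝ (Fin d) → ℝ}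
    (ha : ∀ ξ, 0 ≤ a ξ) (hai : Integrable a)
    (hap : Integrable fun ξ => a ξ * (1 + ‖ξ‖ ^ p)) :
    KernelSequence p (fun _ => a) a where
  integrable _ := hai
  nonneg _ := ha
  bounded := by
    refine ⟨_, hap.lintegral_lt_top.ne, .of_forall fun _ => le_of_eq ?_⟩
    simp only [add_comm]
  tail δ hδ := by
    have hle : ∀ ξ, ENNReal.ofReal (a ξ * ‖ξ‖ ^ p) ≤ ENNReal.ofReal (a ξ * (1 + ‖ξ‖ ^ p)) :=
      fun ξ => ENNReal.ofReal_le_ofReal (mul_le_mul_of_nonneg_left (by linarith) (ha ξ))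
    have hm : AEMeasurable fun ξ => ENNReal.ofReal (a ξ * ‖ξ‖ ^ p) :=
      (hai.aemeasurable.mul (measurable_norm.pow_const p).aemeasurable).ennreal_ofReal
    have hfin : ∫⁻ ξ, ENNReal.ofReal (a ξ * ‖ξ‖ ^ p) ≠ ⊤ :=
      ((lintegral_mono hle).trans_lt hap.lintegral_lt_top).ne
    have hlim : Tendsto (fun n : ℕ => ∫⁻ ξ in (Metric.ball (0 : EuclideanSpace ℝ (Fin d)) n)ᶜ,
        ENNReal.ofReal (a ξ * ‖ξ‖ ^ p)) atTop (𝓝 0) := by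
      have h1 := tendsto_lintegral_of_dominated_convergence' (μ := volume)
        (F := fun (n : ℕ) ξ => (Metric.ball (0 : EuclideanSpace ℝ (Fin d)) n)ᶜ.indicator
          (fun ξ => ENNReal.ofReal (a ξ * ‖ξ‖ ^ p)) ξ) (f := fun _ => 0)
        (fun ξ => ENNReal.ofReal (a ξ * ‖ξ‖ ^ p))
        (fun n => hm.indicator Metric.isOpen_ball.measurableSet.compl)
        (fun n => .of_forall fun ξ => Set.indicator_le_self _ _ ξ) hfin
        (.of_forall fun ξ => by
          refine tendsto_const_nhds.congr' ?_
          filter_upwards [eventually_gt_atTop ⌈‖ξ‖⌉₊] with n hn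
          rw [Set.indicator_of_notMem]
          simpa using (Nat.le_ceil ‖ξ‖).trans_lt (by exact_mod_cast hn))
      simpa only [lintegral_indicator Metric.isOpen_ball.measurableSet.compl, lintegral_zero]
        using h1
    obtain ⟨n, hn1, hn2⟩ := ((hlim.eventually_lt_const (ENNReal.ofReal_pos.2 hδ)).and
      (eventually_gt_atTop 0)).exists
    exact ⟨n, by exact_mod_cast hn2, .of_forall fun _ => hn1.le⟩
  integrable_limit := hai
  tendsto _ _ _ := tendsto_const_nhds

/-- Tonelli's theorem identifies the two forms of the limit functional. -/
lemma limitFunctional_eq_gradientNormFunctional {p : ℝ} {a : EuclideanSpace ℝ (Fin d) → ℝ}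
    (ha : AEMeasurable a) (A : Set (EuclideanSpace ℝ (Fin d)))
    (u : EuclideanSpace ℝ (Fin d) → EuclideanSpace ℝ (Fin m)) :
    limitFunctional p a A u = gradientNormFunctional p a A u := by
  classical
  by_cases hmem : MemW1p p A u
  swap
  · simp [limitFunctional, gradientNormFunctional, hmem]
  rw [limitFunctional, gradientNormFunctional, if_pos hmem, if_pos hmem]
  have hD := hmem.weakGradient_spec.1.1.aemeasurable
  set D := weakGradient p A u
  have hm1 : AEMeasurable (fun z : EuclideanSpace ℝ (Fin d) × EuclideanSpace ℝ (Fin d) =>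
      D z.2 z.1) (volume.prod (volume.restrict A)) := by
    have h1 : AEMeasurable (fun z : EuclideanSpace ℝ (Fin d) × EuclideanSpace ℝ (Fin d) =>
      (D z.2, z.1)) (volume.prod (volume.restrict A)) :=
      (hD.comp_quasiMeasurePreserving Measure.quasiMeasurePreserving_snd).prodMk
        measurable_fst.aemeasurable
    have h2 : Continuous fun y : (EuclideanSpace ℝ (Fin d) →L[ℝ] EuclideanSpace ℝ (Fin m)) ×
      EuclideanSpace ℝ (Fin d) => y.1 y.2 := isBoundedBilinearMap_apply.continuous
    exact h2.measurable.comp_aemeasurable h1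
  have hm : AEMeasurable (Function.uncurry fun ξ x => ENNReal.ofReal (a ξ) * ‖D x ξ‖ₑ ^ p)
      (volume.prod (volume.restrict A)) :=
    ((ha.comp_quasiMeasurePreserving Measure.quasiMeasurePreserving_fst).ennreal_ofReal).mul
      (hm1.enorm.pow_const p)
  simp only [kernelNormPow]
  rw [← lintegral_lintegral_swap hm]
  refine lintegral_congr fun ξ => ?_
  rw [lintegral_const_mul' _ _ ENNReal.ofReal_ne_top]

theorem mainTheorem4 {d m : ℕ} (p : ℝ) [Fact (1 < p)]
    (Ω : Set (EuclideanSpace ℝ (Fin d))) (hΩ : IsOpen Ω) (hΩb : Bornology.IsBounded Ω)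
    (hΩlip : HasLipschitzBoundary Ω) :
    (∀ A : Set (EuclideanSpace ℝ (Fin d)), IsOpen A → A ⊆ Ω → HasLipschitzBoundary A →
      ∀ (aε : ℝ → EuclideanSpace ℝ (Fin d) → ℝ) (a : EuclideanSpace ℝ (Fin d) → ℝ),
        (∀ ε, 0 < ε → Integrable (aε ε)) →
        (∀ ε, 0 < ε → ∀ ξ, 0 ≤ aε ε ξ) →
        limsup (fun ε => ∫⁻ ξ, ENNReal.ofReal (aε ε ξ * (‖ξ‖ ^ p + 1))) (𝓝[>] 0) < ⊤ →
        (∀ δ : ℝ, 0 < δ → ∃ r : ℝ, 0 < r ∧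
          limsup (fun ε => ∫⁻ ξ in (Metric.ball 0 r)ᶜ, ENNReal.ofReal (aε ε ξ * ‖ξ‖ ^ p)) (𝓝[>] 0)
            < ENNReal.ofReal δ) →
        Integrable a →
        ¬ (a =ᵐ[volume] 0) →
        KernelsWeakStarConverge aε a →
        GammaConverges
          (fun ε (u : Lp (EuclideanSpace ℝ (Fin m)) (ENNReal.ofReal p) (volume.restrict Ω)) =>
            convFunctional p ε (aε ε) A u)
          (fun u => limitFunctional p a A u)) ∧
    (∀ a : EuclideanSpace ℝ (Fin d) → ℝ,
        (∀ ξ, 0 ≤ a ξ) →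
        Integrable (fun ξ => a ξ * (1 + ‖ξ‖ ^ p)) →
        ¬ (a =ᵐ[volume] 0) →
        GammaConverges
          (fun ε (u : Lp (EuclideanSpace ℝ (Fin m)) (ENNReal.ofReal p) (volume.restrict Ω)) =>
            convFunctional p ε a Ω u)
          (fun u => gradientNormFunctional p a Ω u)) := by
  refine ⟨fun A hA hAΩ hAlip aε a hint hnn hbdd htail hai hne hconv e he he0 u => ?_,
    fun a ha hap hne e he he0 u => ?_⟩
  · have he' : Tendsto e atTop (𝓝[>] 0) :=
      tendsto_nhdsWithin_iff.2 ⟨he0, .of_forall he⟩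
    have hker : KernelSequence p (fun j => aε (e j)) a :=
      { integrable := fun j => hint _ (he j)
        nonneg := fun j => hnn _ (he j)
        bounded := by
          obtain ⟨M, hM1, hM2⟩ := exists_between hbdd
          exact ⟨M, hM2.ne, (he'.eventually (eventually_lt_of_limsup_lt hM1)).mono
            fun _ hj => hj.le⟩
        tail := fun δ hδ => by
          obtain ⟨r, hr, hlim⟩ := htail δ hδ
          exact ⟨r, hr, (he'.eventually (eventually_lt_of_limsup_lt hlim)).mono
            fun _ hj => hj.le⟩
        integrable_limit := hai
        tendsto := fun φ hφ hφc => (hconv φ hφ hφc).comp he' }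
    exact hker.gamma_convergence hne he he0 hΩb hA hAΩ (hAlip.hasInwardShifts hA) u
  · -- the weight `1 + ‖ξ‖ ^ p` is continuous and at least `1`, so `a` itself is integrable
    have hai : Integrable a := by
      have hpos : ∀ ξ : EuclideanSpace ℝ (Fin d), 1 ≤ 1 + ‖ξ‖ ^ p := fun ξ => by
        linarith [Real.rpow_nonneg (norm_nonneg ξ) p]
      have hm : AEStronglyMeasurable a := by
        have h1 : Measurable fun ξ : EuclideanSpace ℝ (Fin d) => (1 + ‖ξ‖ ^ p)⁻¹ :=
          ((measurable_norm.pow_const p).const_add 1).inv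
        refine (hap.1.mul h1.aestronglyMeasurable).congr (.of_forall fun ξ => ?_)
        exact mul_inv_cancel_right₀ (zero_lt_one.trans_le (hpos ξ)).ne' _
      refine hap.mono' hm (.of_forall fun ξ => ?_)
      rw [Real.norm_of_nonneg (ha ξ)]
      exact le_mul_of_one_le_right (ha ξ) (hpos ξ)
    simp only [← limitFunctional_eq_gradientNormFunctional hai.aemeasurable]
    exact (kernelSequence_const ha hai hap).gamma_convergence hne he he0
      hΩb hΩ subset_rfl (hΩlip.hasInwardShifts hΩ) u
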